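/- Fix an integer $p\ge 2$. For $N\ge 1$, $\beta\ge 0$ and $\boldsymbol x\in\{-1,1\}^N$ let $$H_N(\boldsymbol x)=\frac1{N^{p-1}}\sum_{1\le i_1,\dots,i_p\le N}x_{i_1}\cdots x_{i_p},\qquad \mathbb P_\beta(\boldsymbol x)=\frac{e^{\beta H_N(\boldsymbol x)}}{\sum_{\boldsymbol y\in\{-1,1\}^N}e^{\beta H_N(\boldsymbol y)}}$$ (the $p$-spin Curie–Weiss model), and let $m_i(\boldsymbol x)=\frac1{N^{p-1}}\sum_{1\le i_2,\dots,i_p\le N}x_{i_2}\cdots x_{i_p}$ for $1\le i\le N$. The maximum pseudo-likelihood (MPL) estimate is $$\hat\beta_N(\boldsymbol x)=\inf\Big\{b\ge 0:\ H_N(\boldsymbol x)=\sum_{i=1}^N m_i(\boldsymbol x)\tanh\big(p\,b\,m_i(\boldsymbol x)\big)\Big\}\in[0,+\infty],\qquad \inf\emptyset=+\infty .$$ Let $I(t)=\frac12\{(1+t)\log(1+t)+(1-t)\log(1-t)\}$ for $t\in[-1,1]$ (with $0\log 0=0$), and $$\beta^*_{\mathrm{CW}}(p)=\sup\Big\{\beta\ge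 0:\ \sup_{t\in[0,1]}\{\beta t^p-I(t)\}=0\Big\}.$$ Let $\beta>\beta^*_{\mathrm{CW}}(p)$ and $g(t)=\beta t^p-I(t)$, $t\in[-1,1]$. Then $g$ has exactly one positive global maximizer $m_*$ on $[-1,1]$; moreover $m_*<1$ and $g''(m_*)<0$. If $\boldsymbol X\sim\mathbb P_\beta$, then as $N\to\infty$ $$\sqrt N\,(\hat\beta_N(\boldsymbol X)-\beta)\ \xrightarrow{D}\ N\Big(0,\ -\frac{g''(m_*)}{p^2m_*^{2p-2}}\Big),$$ as random variables with values in the extended real line. Moreover, the MPL estimate attains the Cramér–Rao bound asymptotically: with the scaled Fisher information $I_N(\beta)=\frac1N\mathbb E_\beta\big[\big(\frac{\mathrm d}{\mathrm d\beta}\log\mathbb P_\beta(\boldsymbol X)\big)^2\big]$, $$\lim_{N\to\infty}\frac1{I_N(\beta)}=-\frac{g''(m_*)}{p^2m_*^{2p-2}},$$ that is, the limiting variance above equals the limit of the (scaled) Cramér–Rao bound. -/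

import Mathlib

open MeasureTheory ProbabilityTheory Filter Topology

namespace TensorIsing

noncomputable section

/-- The real value `±1` of a binary spin (`true` is `+1`, `false` is `-1`). -/
def spin (b : Bool) : ℝ := if b then 1 else -1

/-- Spin configurations `{-1, 1}^N`. -/
abbrev Config (N : ℕ) : Type := Fin N → Bool

/-- Real `p`-tensors with `N^p` entries `J_{i_1 … i_p}`. -/
abbrev Tensor (p N : ℕ) : Type := (Fin p → Fin N) → ℝ

variable {p N : ℕ}

/-- The Hamiltonian `H_N(x) = ∑_{i_1, …, i_p} J_{i_1 … i_p} x_{i_1} ⋯ x_{i_p}`. -/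
def hamiltonian (J : Tensor p N) (x : Config N) : ℝ :=
  ∑ i : Fin p → Fin N, J i * ∏ k : Fin p, spin (x (i k))

/-- The partition function `Z_N(β) = 2^{-N} ∑_x exp (β H_N(x))`. -/
def partitionFn (J : Tensor p N) (β : ℝ) : ℝ :=
  (1 / 2 ^ N) * ∑ x : Config N, Real.exp (β * hamiltonian J x)

/-- The probability mass `P_β(x) = exp (β H_N(x)) / (2^N Z_N(β))`. -/
def prob (J : Tensor p N) (β : ℝ) (x : Config N) : ℝ :=
  Real.exp (β * hamiltonian J x) / (2 ^ N * partitionFn J β)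

theorem prob_nonneg (J : Tensor p N) (β : ℝ) (x : Config N) : 0 ≤ prob J β x := by
  unfold prob partitionFn
  positivity

theorem sum_prob (J : Tensor p N) (β : ℝ) : ∑ x : Config N, prob J β x = 1 := by
  have hpos : 0 < ∑ x : Config N, Real.exp (β * hamiltonian J x) :=
    Finset.sum_pos (fun x _ => Real.exp_pos _) Finset.univ_nonempty
  unfold prob partitionFn
  rw [← Finset.sum_div]
  field_simp

theorem sum_ofReal_prob (J : Tensor p N) (β : ℝ) :
    ∑ x : Config N, ENNReal.ofReal (prob J β x) = 1 := by
  rw [← ENNReal.ofReal_sum_of_nonneg (fun x _ => prob_nonneg J β x), sum_prob,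
    ENNReal.ofReal_one]

/-- The law `P_β` of the `p`-tensor Ising model, as a measure on `{-1, 1}^N`. -/
def law (J : Tensor p N) (β : ℝ) : Measure (Config N) :=
  (PMF.ofFintype (fun x => ENNReal.ofReal (prob J β x)) (sum_ofReal_prob J β)).toMeasure

instance instIsProbabilityMeasureLaw (J : Tensor p N) (β : ℝ) :
    IsProbabilityMeasure (law J β) := by
  unfold law
  infer_instance

/-- The local field `m_i(x) = ∑_{i_2, …, i_p} J_{i i_2 … i_p} x_{i_2} ⋯ x_{i_p}`: the sum over
all index tuples whose first entry is `i`, the product over all entries but the first. -/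
def localField (J : Tensor p N) (x : Config N) (i : Fin N) : ℝ :=
  ∑ j : Fin p → Fin N with (∀ k : Fin p, k.val = 0 → j k = i),
    J j * ∏ k : Fin p with k.val ≠ 0, spin (x (j k))

/-- The maximum pseudo-likelihood estimate: the infimum in `[-∞, ∞]` of all `b ≥ 0` with
`H_N(x) = ∑_i m_i(x) tanh (p b m_i(x))`; it is `+∞` if there is no such `b`. -/
def mple (J : Tensor p N) (x : Config N) : EReal :=
  sInf ((fun b : ℝ => (b : EReal)) '' {b : ℝ | 0 ≤ b ∧
    hamiltonian J x = ∑ i : Fin N, localField J x i * Real.tanh (p * b * localField J x i)})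

/-- The scaled Fisher information `I_N(β) = (1 / N) E_β [(d/dβ log P_β(X))^2]`. -/
def fisherInfo (J : Tensor p N) (β : ℝ) : ℝ :=
  (1 / N) * ∫ x, (deriv (fun b : ℝ => Real.log (prob J b x)) β) ^ 2 ∂(law J β)

/-- The Curie–Weiss interaction tensor: all entries, including those with repeated indices,
are `1 / N^(p-1)`. -/
def cwTensor (p N : ℕ) : Tensor p N := fun _ => 1 / (N : ℝ) ^ (p - 1)

/-- The binary entropy function
`I(t) = ((1 + t) log (1 + t) + (1 - t) log (1 - t)) / 2`, with `0 log 0 = 0`. -/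
def entropyI (t : ℝ) : ℝ :=
  (1 / 2) * ((1 + t) * Real.log (1 + t) + (1 - t) * Real.log (1 - t))

/-- The function `g(t) = β t^p - I(t)`; only its values on `[-1, 1]` matter. -/
def gFun (p : ℕ) (β t : ℝ) : ℝ := β * t ^ p - entropyI t

/-- The Curie–Weiss threshold
`β*_CW(p) = sup {β ≥ 0 : sup_{t ∈ [0, 1]} (β t^p - I(t)) = 0}`. -/
def cwThreshold (p : ℕ) : ℝ :=
  sSup {β : ℝ | 0 ≤ β ∧ sSup (gFun p β '' Set.Icc 0 1) = 0}

/-- `m` is a positive global maximizer of `g` on `[-1, 1]`. -/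
def IsPosMaximizer (p : ℕ) (β m : ℝ) : Prop :=
  0 < m ∧ m ∈ Set.Icc (-1 : ℝ) 1 ∧ IsMaxOn (gFun p β) (Set.Icc (-1) 1) m

/-- The limiting variance `-g''(m) / (p^2 m^(2p-2))`. -/
def limitVariance (p : ℕ) (β m : ℝ) : ℝ :=
  -(deriv (deriv (gFun p β)) m) / ((p : ℝ) ^ 2 * m ^ (2 * p - 2))

end

end TensorIsing

namespace TensorIsing

/-! Everything in the Curie–Weiss model is a function of the magnetization `u = mag x`: the
Hamiltonian is `N u ^ p`, every local field is `u ^ (p - 1)`, and for `0 < |u| < 1` the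
pseudo-likelihood equation reads `u = tanh (p b u ^ (p - 1))`. Near the maximizers the estimate is
therefore `artanh |u| / (p |u| ^ (p - 1))`, a smooth function with value `β` at `m`. The theorem
becomes a central limit theorem for `u` with variance `1 / s`, `s = -g''(m)`, followed by the delta
method. The estimator has slope `s / (p m ^ (p - 1))` at `m`, so the limiting variance is `s / (p ^
2 m ^ (2 p - 2))`. The Fisher information is `N Var (u ^ p)`, with limit `(p m ^ (p - 1)) ^ 2 / s`,
the reciprocal.

Uniqueness and nondegeneracy of `m` come from the stationary equation `artanh t / t ^ (p - 1) = β
p`. The sign of the derivative of the left side is that of `slopeAux (p - 1)`, which stays positive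
once it is nonnegative at a positive point; a maximizer with positive value must lie where it is
positive (`slopeAux_pos_of_lt`, `IsPosMaximizer.slopeAux_pos`).

Concentration at `m` (and at `-m` for even `p`) combines a variational lower bound for the partition
function (`le_sum_weight`) with a count of the at most `N + 1` magnetizations
(`sum_exp_entropyI_le`). The fluctuations are found by Stein's method. Reversing single spin flips
gives `E[drift φ] ≈ E[upRate (φ(u + 2/N) - φ(u))]` (`exists_stein_bound`), where `drift` vanishes at
`m` with slope `2 (1 + m) s` and `upRate` equals `1 + m` there. Polynomial-type `φ` bound the
moments of `u - m`. A complex exponential `φ` shows that the characteristic function `ψ` of `√N (u -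
m)` satisfies `ψ' = -(t / s) ψ + O(1/√N)`, which forces the Gaussian limit
(`tendsto_posMean_phase`). For even `p` the two wells are folded onto `u > 0` by symmetry. -/

/-! ### Calculus of `artanh`, the entropy and `g` -/

theorem artanh_eq_log_sub_log {t : ℝ} (h1 : -1 < t) (h2 : t < 1) :
    Real.artanh t = (Real.log (1 + t) - Real.log (1 - t)) / 2 := by
  rw [Real.artanh_eq_half_log ⟨h1.le, h2.le⟩, Real.log_div (by linarith) (by linarith)]
  ring

theorem hasDerivAt_artanh {t : ℝ} (h1 : -1 < t) (h2 : t < 1) :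
    HasDerivAt Real.artanh (1 / (1 - t ^ 2)) t := by
  have hd : HasDerivAt (fun s : ℝ => (Real.log (1 + s) - Real.log (1 - s)) / 2)
      ((1 / (1 + t) - (-1) / (1 - t)) / 2) t :=
    ((((hasDerivAt_id t).const_add 1).log (by simp; linarith)).sub
      (((hasDerivAt_id t).const_sub 1).log (by simp; linarith))).div_const 2
  have h3 : (1 + t) ≠ 0 := by linarith
  have h4 : (1 - t) ≠ 0 := by linarith
  have h5 : (1 - t ^ 2) ≠ 0 := by
    have : (1 - t ^ 2) = (1 + t) * (1 - t) := by ring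
    rw [this]; positivity
  have he : ((1 / (1 + t) - (-1) / (1 - t)) / 2) = 1 / (1 - t ^ 2) := by
    field_simp
    ring
  rw [he] at hd
  refine hd.congr_of_eventuallyEq ?_
  filter_upwards [Ioo_mem_nhds h1 h2] with s hs
  exact artanh_eq_log_sub_log hs.1 hs.2

theorem continuous_entropyI : Continuous entropyI := by
  unfold entropyI
  have h := Real.continuous_mul_log
  exact continuous_const.mul ((h.comp (by fun_prop : Continuous fun t : ℝ => 1 + t)).add
    (h.comp (by fun_prop : Continuous fun t : ℝ => 1 - t)))

theorem entropyI_neg (t : ℝ) : entropyI (-t) = entropyI t := by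
  unfold entropyI
  simp only [sub_neg_eq_add, ← sub_eq_add_neg]
  ring

theorem entropyI_zero : entropyI 0 = 0 := by simp [entropyI]

theorem hasDerivAt_entropyI {t : ℝ} (h1 : -1 < t) (h2 : t < 1) :
    HasDerivAt entropyI (Real.artanh t) t := by
  have h3 : (1 + t) ≠ 0 := by linarith
  have h4 : (1 - t) ≠ 0 := by linarith
  have hd := (((((hasDerivAt_id t).const_add 1).mul
    (((hasDerivAt_id t).const_add 1).log (by simpa using h3))).add
      (((hasDerivAt_id t).const_sub 1).mul
    (((hasDerivAt_id t).const_sub 1).log (by simpa using h4)))).const_mul (1 / 2))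
  rw [artanh_eq_log_sub_log h1 h2]
  convert! hd using 1
  simp only [id]
  field_simp
  ring

theorem continuous_gFun (p : ℕ) (β : ℝ) : Continuous (gFun p β) := by
  unfold gFun
  exact (by fun_prop : Continuous fun t : ℝ => β * t ^ p).sub continuous_entropyI

theorem hasDerivAt_gFun (p : ℕ) (β : ℝ) {t : ℝ} (h1 : -1 < t) (h2 : t < 1) :
    HasDerivAt (gFun p β) (β * (p * t ^ (p - 1)) - Real.artanh t) t :=
  ((hasDerivAt_pow p t).const_mul β).sub (hasDerivAt_entropyI h1 h2)

theorem deriv_deriv_gFun (p : ℕ) (β : ℝ) {t : ℝ} (h1 : -1 < t) (h2 : t < 1) :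
    deriv (deriv (gFun p β)) t
      = β * (p * ((p - 1 : ℕ) * t ^ (p - 1 - 1))) - 1 / (1 - t ^ 2) := by
  have he : deriv (gFun p β) =ᶠ[𝓝 t] fun s => β * (p * s ^ (p - 1)) - Real.artanh s := by
    filter_upwards [Ioo_mem_nhds h1 h2] with s hs
    exact (hasDerivAt_gFun p β hs.1 hs.2).deriv
  rw [he.deriv_eq]
  exact ((((hasDerivAt_pow (p - 1) t).const_mul (p : ℝ)).const_mul β).sub
    (hasDerivAt_artanh h1 h2)).deriv

theorem gFun_zero {p : ℕ} (hp : p ≠ 0) (β : ℝ) : gFun p β 0 = 0 := by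
  simp [gFun, entropyI_zero, hp]

theorem gFun_neg_le (p : ℕ) {β t : ℝ} (hβ : 0 ≤ β) (ht : 0 ≤ t) :
    gFun p β (-t) ≤ gFun p β t := by
  have : (-t) ^ p ≤ t ^ p := by
    calc (-t) ^ p ≤ |(-t) ^ p| := le_abs_self _
      _ = t ^ p := by rw [abs_pow, abs_neg, abs_of_nonneg ht]
  unfold gFun
  rw [entropyI_neg]
  have := mul_le_mul_of_nonneg_left this hβ
  linarith

/-! ### The positive maximizer: existence, uniqueness, nondegeneracy -/

/-- `t ^ (q + 1)` times the derivative of `artanh t / t ^ q`. -/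
noncomputable def slopeAux (q : ℕ) (t : ℝ) : ℝ := t / (1 - t ^ 2) - q * Real.artanh t

theorem hasDerivAt_slopeAux (q : ℕ) {t : ℝ} (h1 : -1 < t) (h2 : t < 1) :
    HasDerivAt (slopeAux q) (((q + 1) * t ^ 2 - (q - 1)) / (1 - t ^ 2) ^ 2) t := by
  have h5 : (1 - t ^ 2) ≠ 0 := by nlinarith
  have hd := ((hasDerivAt_id t).div ((hasDerivAt_pow 2 t).const_sub 1) h5).sub
    ((hasDerivAt_artanh h1 h2).const_mul (q : ℝ))
  convert! hd using 1
  simp only [id]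
  field_simp
  push_cast
  ring

/-- Since `slopeAux q` vanishes at `0`, the mean value theorem gives `c` in `(0, a)` with
nonnegative derivative. The numerator `(q + 1) s ^ 2 - (q - 1)` of the derivative increases with `s
> 0`, so the derivative is positive beyond `c`, in particular on `(a, t)`. -/
theorem slopeAux_pos_of_lt {q : ℕ} {a t : ℝ} (ha : 0 < a) (hk : 0 ≤ slopeAux q a)
    (hat : a < t) (ht : t < 1) : 0 < slopeAux q t := by
  have hc : ∀ s ∈ Set.Ico (0 : ℝ) 1, ContinuousAt (slopeAux q) s := fun s hs =>
    (hasDerivAt_slopeAux q (by linarith [hs.1]) hs.2).continuousAt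
  have hz : slopeAux q 0 = 0 := by simp [slopeAux]
  obtain ⟨c, hc1, hc2⟩ := exists_hasDerivAt_eq_slope (slopeAux q) _ ha
    (fun s hs => (hc s ⟨hs.1, by linarith [hs.2]⟩).continuousWithinAt)
    (fun s hs => hasDerivAt_slopeAux q (by linarith [hs.1]) (by linarith [hs.2]))
  rw [hz] at hc2
  have hpos : ∀ s : ℝ, 0 < s → s < 1 → 0 < (1 - s ^ 2) ^ 2 := fun s h0 h1 => by
    have : 0 < 1 - s ^ 2 := by nlinarith
    positivity
  have hcn : 0 ≤ (q + 1) * c ^ 2 - ((q : ℝ) - 1) := by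
    have h0 : 0 ≤ (slopeAux q a - 0) / (a - 0) := by
      rw [sub_zero, sub_zero]; positivity
    rw [← hc2] at h0
    by_contra! hneg
    exact absurd (div_neg_of_neg_of_pos hneg (hpos c hc1.1 (by linarith [hc1.2])))
      (not_lt.2 h0)
  have hmono : StrictMonoOn (slopeAux q) (Set.Icc a t) := by
    refine strictMonoOn_of_deriv_pos (convex_Icc a t)
      (fun s hs => (hc s ⟨by linarith [hs.1], by linarith [hs.2]⟩).continuousWithinAt) ?_
    intro s hs
    rw [interior_Icc] at hs
    rw [(hasDerivAt_slopeAux q (by linarith [hs.1]) (by linarith [hs.2])).deriv]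
    refine div_pos ?_ (hpos s (by linarith [hs.1]) (by linarith [hs.2]))
    have h3 : c ^ 2 < s ^ 2 := by nlinarith [hc1.1, hc1.2, hs.1]
    have h4 : (0 : ℝ) < q + 1 := by positivity
    nlinarith
  have := hmono (Set.left_mem_Icc.2 hat.le) (Set.right_mem_Icc.2 hat.le) hat
  linarith

theorem hasDerivAt_artanh_div_pow (q : ℕ) {t : ℝ} (h1 : 0 < t) (h2 : t < 1) :
    HasDerivAt (fun s => Real.artanh s / s ^ q) (slopeAux q t / t ^ (q + 1)) t := by
  have h5 : (1 - t ^ 2) ≠ 0 := by nlinarith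
  have hd := (hasDerivAt_artanh (by linarith) h2).div (hasDerivAt_pow q t) (by positivity)
  convert! hd using 1
  unfold slopeAux
  rcases q with _ | q
  · simp; field_simp
  · simp only [Nat.add_sub_cancel]
    field_simp
    ring

/-- If `g ≤ 0` on `[0, 1]`, then `g 0 = 0` makes the supremum equal to `0`, so `β` itself lies in
the set defining the threshold. -/
theorem exists_pos_of_cwThreshold_lt {p : ℕ} (hp : 2 ≤ p) {β : ℝ} (hβ : cwThreshold p < β) :
    0 < β ∧ ∃ t ∈ Set.Icc (0 : ℝ) 1, 0 < gFun p β t := by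
  have h0 : 0 ≤ cwThreshold p := Real.sSup_nonneg fun b hb => hb.1
  refine ⟨h0.trans_lt hβ, ?_⟩
  have hbdd : ∀ b : ℝ, BddAbove (gFun p b '' Set.Icc 0 1) := fun b =>
    (isCompact_Icc.image (continuous_gFun p b)).bddAbove
  by_contra! hall
  have hmem : β ∈ {b : ℝ | 0 ≤ b ∧ sSup (gFun p b '' Set.Icc 0 1) = 0} := by
    refine ⟨(h0.trans_lt hβ).le, le_antisymm ?_ ?_⟩
    · exact csSup_le (Set.Nonempty.image _ ⟨0, by simp⟩) (by rintro _ ⟨t, ht, rfl⟩; exact hall t ht)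
    · exact le_csSup (hbdd β) ⟨0, by simp, gFun_zero (by omega) β⟩
  have : β ≤ cwThreshold p := by
    -- The real `sSup` needs an upper bound for the set; evaluating `g ≤ 0` at `t = 1` bounds its
    -- members by `I(1) = log 2`.
    refine le_csSup ⟨entropyI 1, ?_⟩ hmem
    rintro b ⟨_, hb⟩
    have := le_csSup (hbdd b) ⟨1, by simp, rfl⟩
    rw [hb] at this
    simpa [gFun] using this
  linarith

/-- Near `1` the term `artanh t` of `g'` exceeds `|β| p`, which dominates the other term, so `g`
strictly decreases up to the endpoint. This makes every positive maximizer an interior critical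
point. -/
theorem exists_lt_gFun_one (p : ℕ) (β : ℝ) : ∃ t ∈ Set.Ioo (0 : ℝ) 1, gFun p β 1 < gFun p β t := by
  set y := |β| * p + 1 with hy
  have hy0 : 0 < y := by positivity
  have hs : Real.tanh y < 1 := Real.tanh_lt_one y
  have hs0 : 0 < Real.tanh y := by
    rw [Real.tanh_eq_sinh_div_cosh]
    exact div_pos (Real.sinh_pos_iff.2 hy0) (Real.cosh_pos y)
  refine ⟨Real.tanh y, ⟨hs0, hs⟩, ?_⟩
  have hanti : StrictAntiOn (gFun p β) (Set.Icc (Real.tanh y) 1) := by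
    refine strictAntiOn_of_deriv_neg (convex_Icc _ _) (continuous_gFun p β).continuousOn ?_
    intro s hs'
    rw [interior_Icc] at hs'
    rw [(hasDerivAt_gFun p β (by linarith [hs'.1]) hs'.2).deriv]
    have h1 : y < Real.artanh s := by
      rw [← Real.artanh_tanh y]
      exact Real.artanh_lt_artanh (by linarith) hs'.2 hs'.1
    have h2 : β * (p * s ^ (p - 1)) ≤ |β| * p := by
      have h3 : s ^ (p - 1) ≤ 1 := pow_le_one₀ (by linarith [hs'.1]) hs'.2.le
      have h4 : 0 ≤ s ^ (p - 1) := pow_nonneg (by linarith [hs'.1]) _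
      calc β * (p * s ^ (p - 1)) ≤ |β| * (p * s ^ (p - 1)) := by
            gcongr; exact le_abs_self β
        _ ≤ |β| * (p * 1) := by gcongr
        _ = |β| * p := by ring
    linarith
  exact hanti (Set.left_mem_Icc.2 hs.le) (Set.right_mem_Icc.2 hs.le) hs

section Maximizer

variable {p : ℕ} {β m : ℝ}

theorem IsPosMaximizer.lt_one (h : IsPosMaximizer p β m) : m < 1 := by
  rcases h.2.1.2.lt_or_eq with h1 | h1
  · exact h1
  · obtain ⟨t, ht, hlt⟩ := exists_lt_gFun_one p β
    have h2 : gFun p β t ≤ gFun p β m := h.2.2 ⟨by linarith [ht.1], ht.2.le⟩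
    rw [h1] at h2
    linarith

theorem IsPosMaximizer.artanh_eq (h : IsPosMaximizer p β m) :
    Real.artanh m = β * (p * m ^ (p - 1)) := by
  have h1 := h.lt_one
  have h0 := h.1
  have hloc : IsLocalMax (gFun p β) m := h.2.2.isLocalMax (Icc_mem_nhds (by linarith) h1)
  have := hloc.hasDerivAt_eq_zero (hasDerivAt_gFun p β (by linarith) h1)
  linarith

theorem IsPosMaximizer.artanh_div_eq (h : IsPosMaximizer p β m) :
    Real.artanh m / m ^ (p - 1) = β * p := by
  have h0 := h.1
  rw [h.artanh_eq]
  field_simp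

/-- Otherwise `slopeAux (p - 1)` is negative on `(0, m)`, so `artanh t / t ^ (p - 1)` decreases
there to its value `β p` at `m`. Then `g' < 0` on `(0, m)` and `g m < g 0 = 0`, against the positive
value of `g` assumed to exist. -/
theorem IsPosMaximizer.slopeAux_pos (hp : 2 ≤ p) (hg : ∃ t ∈ Set.Icc (0 : ℝ) 1, 0 < gFun p β t)
    (h : IsPosMaximizer p β m) : 0 < slopeAux (p - 1) m := by
  have h1 := h.lt_one
  have h0 := h.1
  by_contra! hk
  have hneg : ∀ t, 0 < t → t < m → slopeAux (p - 1) t < 0 := fun t ht htm => by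
    by_contra! hk'
    linarith [slopeAux_pos_of_lt ht hk' htm h1]
  have hder : ∀ t ∈ Set.Ioc 0 m, HasDerivAt (fun s => Real.artanh s / s ^ (p - 1)) _ t :=
    fun t ht => hasDerivAt_artanh_div_pow (p - 1) ht.1 (by linarith [ht.2])
  have hanti : StrictAntiOn (fun s => Real.artanh s / s ^ (p - 1)) (Set.Ioc 0 m) := by
    refine strictAntiOn_of_deriv_neg (convex_Ioc 0 m)
      (fun t ht => (hder t ht).continuousAt.continuousWithinAt) ?_
    intro t ht
    rw [interior_Ioc] at ht
    rw [(hder t ⟨ht.1, ht.2.le⟩).deriv]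
    exact div_neg_of_neg_of_pos (hneg t ht.1 ht.2) (pow_pos ht.1 _)
  have hg2 : StrictAntiOn (gFun p β) (Set.Icc 0 m) := by
    refine strictAntiOn_of_deriv_neg (convex_Icc _ _) (continuous_gFun p β).continuousOn ?_
    intro t ht
    rw [interior_Icc] at ht
    rw [(hasDerivAt_gFun p β (by linarith [ht.1]) (by linarith [ht.2])).deriv]
    have h3 := hanti ⟨ht.1, ht.2.le⟩ ⟨h0, le_rfl⟩ ht.2
    simp only at h3
    rw [h.artanh_div_eq, lt_div_iff₀ (pow_pos ht.1 _)] at h3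
    linarith
  have h4 := hg2 (Set.left_mem_Icc.2 h0.le) (Set.right_mem_Icc.2 h0.le) h0
  rw [gFun_zero (by omega)] at h4
  obtain ⟨t, ht, htp⟩ := hg
  have : gFun p β t ≤ gFun p β m := h.2.2 ⟨by linarith [ht.1], ht.2⟩
  linarith

/-- Beyond the smaller of two maximizers `slopeAux (p - 1)` stays positive, so `artanh t / t ^ (p -
1)` is strictly increasing between them; yet it equals `β p` at both. -/
theorem IsPosMaximizer.unique (hp : 2 ≤ p) (hg : ∃ t ∈ Set.Icc (0 : ℝ) 1, 0 < gFun p β t)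
    {m' : ℝ} (h : IsPosMaximizer p β m) (h' : IsPosMaximizer p β m') : m' = m := by
  have key : ∀ a b, IsPosMaximizer p β a → IsPosMaximizer p β b → ¬ a < b := by
    intro a b ha hb hab
    have hb1 := hb.lt_one
    have ha0 := ha.1
    have hpos := ha.slopeAux_pos hp hg
    have hder : ∀ t ∈ Set.Icc a b, HasDerivAt (fun s => Real.artanh s / s ^ (p - 1)) _ t :=
      fun t ht => hasDerivAt_artanh_div_pow (p - 1) (by linarith [ht.1]) (by linarith [ht.2])
    have hmono : StrictMonoOn (fun s => Real.artanh s / s ^ (p - 1)) (Set.Icc a b) := by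
      refine strictMonoOn_of_deriv_pos (convex_Icc a b)
        (fun t ht => (hder t ht).continuousAt.continuousWithinAt) ?_
      intro t ht
      rw [interior_Icc] at ht
      rw [(hder t ⟨ht.1.le, ht.2.le⟩).deriv]
      exact div_pos (slopeAux_pos_of_lt ha0 hpos.le ht.1 (by linarith [ht.2]))
        (pow_pos (by linarith [ht.1]) _)
    have h3 := hmono (Set.left_mem_Icc.2 hab.le) (Set.right_mem_Icc.2 hab.le) hab
    simp only at h3
    rw [ha.artanh_div_eq, hb.artanh_div_eq] at h3
    exact lt_irrefl _ h3
  exact le_antisymm (not_lt.1 (key m m' h h')) (not_lt.1 (key m' m h' h))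

/-- Stationarity eliminates `β`; nondegeneracy of the maximum thereby becomes the positivity of
`slopeAux`. -/
theorem IsPosMaximizer.deriv_deriv_eq (hp : 2 ≤ p) (h : IsPosMaximizer p β m) :
    deriv (deriv (gFun p β)) m = -(slopeAux (p - 1) m / m) := by
  have h1 := h.lt_one
  have h0 := h.1
  have h5 : (1 - m ^ 2) ≠ 0 := by nlinarith
  rw [deriv_deriv_gFun p β (by linarith) h1]
  unfold slopeAux
  rw [h.artanh_eq]
  obtain ⟨q, rfl⟩ : ∃ q, p = q + 2 := ⟨p - 2, by omega⟩
  have e1 : q + 2 - 1 = q + 1 := rfl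
  have e2 : q + 1 - 1 = q := rfl
  rw [e1, e2]
  field_simp
  ring

/-- For `β ≥ 0`, reflecting a negative point to the positive side does not decrease `g`, so a
maximizer over `[0, 1]` is one over `[-1, 1]`. -/
theorem exists_isPosMaximizer (hp : 2 ≤ p) (hβ : 0 ≤ β)
    (hg : ∃ t ∈ Set.Icc (0 : ℝ) 1, 0 < gFun p β t) : ∃ m, IsPosMaximizer p β m := by
  obtain ⟨m, hm, hmax⟩ := (isCompact_Icc (a := (0 : ℝ)) (b := 1)).exists_isMaxOn ⟨0, by simp⟩
    (continuous_gFun p β).continuousOn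
  obtain ⟨t, ht, htp⟩ := hg
  have hpos : 0 < gFun p β m := htp.trans_le (hmax ht)
  have hm0 : m ≠ 0 := by
    rintro rfl
    rw [gFun_zero (by omega)] at hpos
    exact lt_irrefl _ hpos
  refine ⟨m, lt_of_le_of_ne hm.1 hm0.symm, ⟨by linarith [hm.1], hm.2⟩, fun s hs => ?_⟩
  rcases le_total 0 s with h | h
  · exact hmax ⟨h, hs.2⟩
  · have h1 := gFun_neg_le p hβ (neg_nonneg.2 h)
    rw [neg_neg] at h1
    exact h1.trans (hmax (⟨by linarith, by linarith [hs.1]⟩ : -s ∈ Set.Icc (0 : ℝ) 1))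

theorem IsPosMaximizer.pos (hg : ∃ t ∈ Set.Icc (0 : ℝ) 1, 0 < gFun p β t)
    (h : IsPosMaximizer p β m) : 0 < gFun p β m := by
  obtain ⟨t, ht, htp⟩ := hg
  exact htp.trans_le (h.2.2 ⟨by linarith [ht.1], ht.2⟩)

theorem entropyI_nonneg {t : ℝ} (ht : t ∈ Set.Icc (0 : ℝ) 1) : 0 ≤ entropyI t := by
  have hmono : MonotoneOn entropyI (Set.Icc 0 1) := by
    refine monotoneOn_of_deriv_nonneg (convex_Icc _ _) continuous_entropyI.continuousOn ?_ ?_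
    · intro s hs
      rw [interior_Icc] at hs
      exact (hasDerivAt_entropyI (by linarith [hs.1]) hs.2).differentiableAt.differentiableWithinAt
    · intro s hs
      rw [interior_Icc] at hs
      rw [(hasDerivAt_entropyI (by linarith [hs.1]) hs.2).deriv]
      exact Real.artanh_nonneg hs.1.le
  have := hmono (Set.left_mem_Icc.2 zero_le_one) ht ht.1
  rwa [entropyI_zero] at this

/-- The maximum of `g` is attained only at `m`, and at `-m` for even `p`. -/
theorem IsPosMaximizer.eq_or_eq_neg (hp : 2 ≤ p) (hβ : 0 ≤ β)
    (hg : ∃ t ∈ Set.Icc (0 : ℝ) 1, 0 < gFun p β t) (h : IsPosMaximizer p β m)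
    {t : ℝ} (ht : t ∈ Set.Icc (-1 : ℝ) 1) (hgt : gFun p β m ≤ gFun p β t) :
    t = m ∨ (Even p ∧ t = -m) := by
  have hmax : ∀ s, gFun p β m ≤ gFun p β s → IsMaxOn (gFun p β) (Set.Icc (-1) 1) s :=
    fun s hs u hu => (h.2.2 hu).trans hs
  have hpos := h.pos hg
  rcases lt_trichotomy t 0 with h0 | h0 | h0
  · right
    rcases Nat.even_or_odd p with he | ho
    · refine ⟨he, ?_⟩
      have h1 : gFun p β (-t) = gFun p β t := by simp [gFun, entropyI_neg, he.neg_pow]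
      have := h.unique hp hg ⟨neg_pos.2 h0, ⟨by linarith [ht.2], by linarith [ht.1]⟩,
        hmax _ (hgt.trans h1.ge)⟩
      linarith
    · exfalso
      have h1 : 0 ≤ entropyI (-t) := entropyI_nonneg ⟨by linarith, by linarith [ht.1]⟩
      rw [entropyI_neg] at h1
      have h2 : β * t ^ p ≤ 0 := mul_nonpos_of_nonneg_of_nonpos hβ (ho.pow_neg h0).le
      have : gFun p β t ≤ 0 := by unfold gFun; linarith
      linarith
  · rw [h0, gFun_zero (by omega)] at hgt
    linarith
  · exact Or.inl (h.unique hp hg ⟨h0, ht, hmax t hgt⟩)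

end Maximizer

/-! ### Reduction of the model and the estimator to the magnetization -/

/-- The magnetization `N⁻¹ ∑ x_i`. -/
noncomputable def mag {N : ℕ} (x : Config N) : ℝ := (∑ i, spin (x i)) / N

theorem spin_mem (b : Bool) : spin b = 1 ∨ spin b = -1 := by
  cases b <;> simp [spin]

theorem sum_spin_eq {N : ℕ} (hN : N ≠ 0) (x : Config N) : ∑ i, spin (x i) = N * mag x := by
  unfold mag; field_simp

theorem abs_mag_le {N : ℕ} (x : Config N) : |mag x| ≤ 1 := by
  unfold mag
  rw [abs_div, Nat.abs_cast]
  refine div_le_one_of_le₀ ?_ (Nat.cast_nonneg N)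
  refine (Finset.abs_sum_le_sum_abs _ _).trans ?_
  refine (Finset.sum_le_sum (g := fun _ => (1 : ℝ)) fun i _ => ?_).trans (by simp)
  rcases spin_mem (x i) with h | h <;> simp [h]

theorem mag_mem {N : ℕ} (x : Config N) : mag x ∈ Set.Icc (-1 : ℝ) 1 := abs_le.1 (abs_mag_le x)

/-- Repeated indices are allowed, so the sum over tuples factorizes exactly as the `p`-th power of
the total spin. -/
theorem hamiltonian_cwTensor {p N : ℕ} (hp : p ≠ 0) (hN : N ≠ 0) (x : Config N) :
    hamiltonian (cwTensor p N) x = N * mag x ^ p := by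
  unfold hamiltonian cwTensor
  rw [← Finset.mul_sum, ← Fintype.sum_pow (fun i => spin (x i)) p, sum_spin_eq hN, mul_pow]
  obtain ⟨q, rfl⟩ := Nat.exists_eq_succ_of_ne_zero hp
  simp only [Nat.succ_eq_add_one, Nat.add_sub_cancel]
  field_simp
  ring

theorem localField_cwTensor {p N : ℕ} (hp : p ≠ 0) (hN : N ≠ 0) (x : Config N) (i : Fin N) :
    localField (cwTensor p N) x i = mag x ^ (p - 1) := by
  obtain ⟨q, rfl⟩ := Nat.exists_eq_succ_of_ne_zero hp
  unfold localField cwTensor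
  rw [← Finset.mul_sum, Finset.sum_filter,
    ← (Fin.consEquiv (fun _ : Fin (q + 1) => Fin N)).sum_comp, Fintype.sum_prod_type]
  have h1 : ∀ (a : Fin N) (t : Fin q → Fin N),
      (∀ k : Fin (q + 1), k.val = 0 → (Fin.consEquiv (fun _ : Fin (q + 1) => Fin N)) (a, t) k = i)
        ↔ a = i := by
    intro a t
    constructor
    · intro h
      simpa using h 0 rfl
    · rintro rfl k hk
      obtain rfl : k = 0 := Fin.ext hk
      simp
  have h2 : ∀ (a : Fin N) (t : Fin q → Fin N),
      (∏ k : Fin (q + 1) with k.val ≠ 0,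
        spin (x ((Fin.consEquiv (fun _ : Fin (q + 1) => Fin N)) (a, t) k)))
        = ∏ k : Fin q, spin (x (t k)) := by
    intro a t
    rw [Finset.prod_filter, Fin.prod_univ_succ]
    simp
  simp_rw [h1, h2]
  rw [Finset.sum_comm]
  simp only [Finset.sum_ite_eq', Finset.mem_univ, if_true]
  rw [← Fintype.sum_pow (fun i => spin (x i)) q, sum_spin_eq hN, mul_pow]
  simp only [Nat.succ_eq_add_one, Nat.add_sub_cancel]
  field_simp

/-- After cancelling `N u ^ (p - 1)` the equation is `u = tanh (p b u ^ (p - 1))`, which injectivity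
of `tanh` solves uniquely for `b`. The sign condition keeps this root nonnegative: for odd `p` and
`u < 0` it would be negative and hence inadmissible. -/
theorem mple_cwTensor {p N : ℕ} (hp : 2 ≤ p) (hN : N ≠ 0) (x : Config N)
    (h0 : mag x ≠ 0) (h1 : |mag x| < 1) (hs : 0 < mag x ∨ Even p) :
    mple (cwTensor p N) x = ((Real.artanh |mag x| / (p * |mag x| ^ (p - 1)) : ℝ) : EReal) := by
  set u := mag x with hu
  have hmem : u ∈ Set.Ioo (-1 : ℝ) 1 := abs_lt.1 h1
  have hp0 : (p : ℝ) ≠ 0 := by positivity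
  -- For even `p` both `artanh u` and `u ^ (p - 1)` are odd, so their quotient does not see the sign
  -- of `u`.
  have hart : Real.artanh |u| / (p * |u| ^ (p - 1)) = Real.artanh u / (p * u ^ (p - 1)) := by
    rcases lt_or_gt_of_ne h0 with hneg | hpos
    · have he : Even p := hs.resolve_left (not_lt.2 hneg.le)
      have ho : Odd (p - 1) := by
        obtain ⟨r, rfl⟩ := he
        exact ⟨r - 1, by omega⟩
      rw [abs_of_neg hneg, ho.neg_pow, artanh_eq_log_sub_log (by linarith) (by linarith [hmem.1]),
        artanh_eq_log_sub_log hmem.1 hmem.2]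
      have : u ^ (p - 1) ≠ 0 := pow_ne_zero _ h0
      rw [sub_neg_eq_add, ← sub_eq_add_neg]
      field_simp
      ring
    · rw [abs_of_pos hpos]
  have hnn : 0 ≤ Real.artanh |u| / (p * |u| ^ (p - 1)) :=
    div_nonneg (Real.artanh_nonneg (abs_nonneg u)) (by positivity)
  have hset : {b : ℝ | 0 ≤ b ∧ hamiltonian (cwTensor p N) x = ∑ i : Fin N,
      localField (cwTensor p N) x i * Real.tanh (p * b * localField (cwTensor p N) x i)}
      = {Real.artanh |u| / (p * |u| ^ (p - 1))} := by
    ext b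
    simp only [Set.mem_ofPred_eq, Set.mem_singleton_iff]
    simp_rw [localField_cwTensor (by omega : p ≠ 0) hN, hamiltonian_cwTensor (by omega : p ≠ 0) hN,
      Finset.sum_const, Finset.card_univ, Fintype.card_fin, nsmul_eq_mul, ← hu]
    have hup : u ^ (p - 1) ≠ 0 := pow_ne_zero _ h0
    have hpow : u ^ p = u ^ (p - 1) * u := by
      rw [← pow_succ]; congr 1; omega
    have heq : ((N : ℝ) * u ^ p = N * (u ^ (p - 1) * Real.tanh (p * b * u ^ (p - 1))))
        ↔ u = Real.tanh (p * b * u ^ (p - 1)) := by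
      rw [hpow, mul_right_inj' (by positivity), mul_right_inj' hup]
    rw [heq]
    constructor
    · rintro ⟨_, h⟩
      rw [hart, eq_div_iff (mul_ne_zero hp0 hup)]
      conv_rhs => rw [h]
      rw [Real.artanh_tanh]
      ring
    · rintro rfl
      refine ⟨hnn, ?_⟩
      rw [hart]
      have : p * (Real.artanh u / (p * u ^ (p - 1))) * u ^ (p - 1) = Real.artanh u := by
        field_simp
      rw [this, Real.tanh_artanh hmem]
  unfold mple
  rw [hset, Set.image_singleton, sInf_singleton]

/-! ### Gibbs averages of the magnetization and single-flip balance -/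

/-- The Gibbs weight `exp (β N u ^ p)` of a configuration with magnetization `u`. -/
noncomputable def weight (p N : ℕ) (β u : ℝ) : ℝ := Real.exp (β * (N * u ^ p))

theorem weight_pos (p N : ℕ) (β u : ℝ) : 0 < weight p N β u := Real.exp_pos _

theorem sum_weight_pos (p N : ℕ) (β : ℝ) : 0 < ∑ y : Config N, weight p N β (mag y) :=
  Finset.sum_pos (fun _ _ => weight_pos _ _ _ _) Finset.univ_nonempty

theorem prob_cwTensor {p N : ℕ} (hp : p ≠ 0) (hN : N ≠ 0) (β : ℝ) (x : Config N) :
    prob (cwTensor p N) β x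
      = weight p N β (mag x) / ∑ y : Config N, weight p N β (mag y) := by
  unfold prob partitionFn weight
  simp_rw [hamiltonian_cwTensor hp hN]
  congr 1
  field_simp

/-- The expectation under the Curie–Weiss law of a function of the magnetization. -/
noncomputable def mean {E : Type*} [AddCommGroup E] [Module ℝ E] (p N : ℕ) (β : ℝ) (f : ℝ → E) :
    E := ∑ x : Config N, prob (cwTensor p N) β x • f (mag x)

theorem mag_not {N : ℕ} (x : Config N) : mag (fun i => !x i) = -mag x := by
  unfold mag
  rw [← neg_div, ← Finset.sum_neg_distrib]
  congr 1
  refine Finset.sum_congr rfl fun i _ => ?_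
  rcases Bool.eq_false_or_eq_true (x i) with h | h <;> simp [spin, h]

theorem mean_comp_neg {E : Type*} [AddCommGroup E] [Module ℝ E] {p N : ℕ} (hp : p ≠ 0)
    (he : Even p) (hN : N ≠ 0) (β : ℝ) (f : ℝ → E) :
    mean p N β (fun u => f (-u)) = mean p N β f := by
  unfold mean
  have hinv : Function.Involutive (fun (x : Config N) (i : Fin N) => !x i) := fun x => by
    funext i; simp
  rw [← Equiv.sum_comp (Function.Involutive.toPerm _ hinv)]
  refine Finset.sum_congr rfl fun x _ => ?_
  have : Function.Involutive.toPerm _ hinv x = fun i => !x i := rfl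
  rw [this, prob_cwTensor hp hN, prob_cwTensor hp hN, mag_not]
  simp only [weight, he.neg_pow, neg_neg]

theorem mag_update {N : ℕ} (x : Config N) (i : Fin N) (hi : x i = false) :
    mag (Function.update x i true) = mag x + 2 / N := by
  unfold mag
  rw [← add_div]
  congr 1
  rw [← Finset.add_sum_erase _ _ (Finset.mem_univ i),
    ← Finset.add_sum_erase (a := i) Finset.univ (fun j => spin (x j)) (Finset.mem_univ i)]
  rw [Finset.sum_congr rfl (g := fun j => spin (x j)) fun j hj => by
    rw [Function.update_of_ne (Finset.ne_of_mem_erase hj)]]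
  simp [spin, hi]
  ring

/-- Detailed balance for single spin flips. -/
theorem sum_one_add_mag_smul {E : Type*} [AddCommGroup E] [Module ℝ E] {N : ℕ} (hN : N ≠ 0)
    (F : ℝ → E) :
    ∑ x : Config N, (1 + mag x) • F (mag x) = ∑ x : Config N, (1 - mag x) • F (mag x + 2 / N) := by
  have hcount : ∀ x : Config N, (N : ℝ) * (1 + mag x) = ∑ i, (1 + spin (x i)) := fun x => by
    rw [Finset.sum_add_distrib, sum_spin_eq hN]; simp; ring
  have hcount' : ∀ x : Config N, (N : ℝ) * (1 - mag x) = ∑ i, (1 - spin (x i)) := fun x => by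
    rw [Finset.sum_sub_distrib, sum_spin_eq hN]; simp; ring
  have hN' : (N : ℝ) ≠ 0 := Nat.cast_ne_zero.2 hN
  have key : (N : ℝ) • ∑ x : Config N, (1 + mag x) • F (mag x)
      = (N : ℝ) • ∑ x : Config N, (1 - mag x) • F (mag x + 2 / N) := by
    simp_rw [Finset.smul_sum, smul_smul, hcount, hcount', Finset.sum_smul]
    rw [Finset.sum_comm, Finset.sum_comm (γ := Config N)]
    refine Finset.sum_congr rfl fun i _ => ?_
    -- After multiplication by `N` both sides are sums over sites. Site `i` contributes only where
    -- `x i` is up on the left and down on the right, and flipping it matches the two; the flip from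
    -- down to up raises `mag` by `2 / N`.
    have hinv : Function.Involutive (fun x : Config N => Function.update x i (!x i)) := fun x => by
      simp
    rw [← Equiv.sum_comp (Function.Involutive.toPerm _ hinv)]
    refine Finset.sum_congr rfl fun x _ => ?_
    have hx : Function.Involutive.toPerm _ hinv x = Function.update x i (!x i) := rfl
    rw [hx, Function.update_self]
    rcases Bool.eq_false_or_eq_true (x i) with h | h
    · simp [h, spin]
    · rw [h, Bool.not_false, mag_update x i h]
      simp [spin]
  exact smul_right_injective E hN' key

/-- This is the flip balance for `F` times the Gibbs probability; the exponential is the ratio of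
the weights at `u + 2 / N` and `u`. -/
theorem mean_one_add_smul {E : Type*} [AddCommGroup E] [Module ℝ E] {p N : ℕ} (hp : p ≠ 0)
    (hN : N ≠ 0) (β : ℝ) (F : ℝ → E) :
    mean p N β (fun u => (1 + u) • F u) = mean p N β (fun u =>
      ((1 - u) * Real.exp (β * (N * ((u + 2 / N) ^ p - u ^ p)))) • F (u + 2 / N)) := by
  unfold mean
  have h := sum_one_add_mag_smul hN
    (fun u => (weight p N β u / ∑ y : Config N, weight p N β (mag y)) • F u)
  simp_rw [prob_cwTensor hp hN, smul_smul]
  convert h using 2 with x _ x _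
  · rw [smul_smul, mul_comm]
  · rw [smul_smul]
    congr 1
    have : weight p N β (mag x + 2 / N)
        = weight p N β (mag x) * Real.exp (β * (N * ((mag x + 2 / N) ^ p - mag x ^ p))) := by
      unfold weight
      rw [← Real.exp_add]
      ring_nf
    rw [this]
    ring

section MeanLemmas

variable {E : Type*} {p N : ℕ} {β : ℝ}

theorem mean_add [AddCommGroup E] [Module ℝ E] (f g : ℝ → E) :
    mean p N β (fun u => f u + g u) = mean p N β f + mean p N β g := by
  simp [mean, Finset.sum_add_distrib]

theorem mean_sub [AddCommGroup E] [Module ℝ E] (f g : ℝ → E) :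
    mean p N β (fun u => f u - g u) = mean p N β f - mean p N β g := by
  simp [mean, smul_sub, Finset.sum_sub_distrib]

theorem mean_const [AddCommGroup E] [Module ℝ E] (c : E) :
    mean p N β (fun _ => c) = c := by
  simp [mean, ← Finset.sum_smul, sum_prob]

theorem mean_mul (c : ℝ) (f : ℝ → ℝ) :
    mean p N β (fun u => c * f u) = c * mean p N β f := by
  simp only [mean, Finset.mul_sum, smul_eq_mul]
  exact Finset.sum_congr rfl fun x _ => by ring

theorem mean_mul_complex (c : ℂ) (f : ℝ → ℂ) :
    mean p N β (fun u => c * f u) = c * mean p N β f := by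
  simp only [mean, Finset.mul_sum, Complex.real_smul]
  exact Finset.sum_congr rfl fun x _ => by ring

theorem mean_mono {f g : ℝ → ℝ} (h : ∀ u ∈ Set.Icc (-1 : ℝ) 1, f u ≤ g u) :
    mean p N β f ≤ mean p N β g :=
  Finset.sum_le_sum fun x _ =>
    mul_le_mul_of_nonneg_left (h _ (mag_mem x)) (prob_nonneg _ _ _)

theorem norm_mean_le [NormedAddCommGroup E] [NormedSpace ℝ E] {f : ℝ → E} {g : ℝ → ℝ}
    (h : ∀ u ∈ Set.Icc (-1 : ℝ) 1, ‖f u‖ ≤ g u) : ‖mean p N β f‖ ≤ mean p N β g := by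
  refine (norm_sum_le _ _).trans (Finset.sum_le_sum fun x _ => ?_)
  rw [norm_smul, Real.norm_of_nonneg (prob_nonneg _ _ _), smul_eq_mul]
  exact mul_le_mul_of_nonneg_left (h _ (mag_mem x)) (prob_nonneg _ _ _)

theorem mean_nonneg {f : ℝ → ℝ} (h : ∀ u ∈ Set.Icc (-1 : ℝ) 1, 0 ≤ f u) :
    0 ≤ mean p N β f :=
  Finset.sum_nonneg fun x _ => mul_nonneg (prob_nonneg _ _ _) (h _ (mag_mem x))

end MeanLemmas

theorem integral_law_eq_sum {E : Type*} [NormedAddCommGroup E] [NormedSpace ℝ E]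
    [CompleteSpace E] {p N : ℕ} (J : Tensor p N) (β : ℝ) (f : Config N → E) :
    ∫ x, f x ∂(law J β) = ∑ x, prob J β x • f x := by
  unfold law
  rw [PMF.integral_eq_sum]
  refine Finset.sum_congr rfl fun x _ => ?_
  rw [PMF.ofFintype_apply, ENNReal.toReal_ofReal (prob_nonneg _ _ _)]

/-- The score is `N` times the centred `u ^ p`, so the scaled information is `N Var (u ^ p)`. The
variance is written about an arbitrary `c`, so that the explicit value `m ^ p` can replace the
unknown mean. -/
theorem fisherInfo_cwTensor {p N : ℕ} (hp : p ≠ 0) (hN : N ≠ 0) (β c : ℝ) :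
    fisherInfo (cwTensor p N) β
      = N * (mean p N β (fun u => (u ^ p - c) ^ 2) - mean p N β (fun u => u ^ p - c) ^ 2) := by
  have hder : ∀ x : Config N, deriv (fun b : ℝ => Real.log (prob (cwTensor p N) b x)) β
      = N * mag x ^ p - N * mean p N β (fun u => u ^ p) := by
    intro x
    have hZ := sum_weight_pos p N β
    have h1 : (fun b : ℝ => Real.log (prob (cwTensor p N) b x))
        = fun b => b * (N * mag x ^ p) - Real.log (∑ y : Config N, weight p N b (mag y)) := by
      funext b
      rw [prob_cwTensor hp hN, Real.log_div (weight_pos _ _ _ _).ne' (sum_weight_pos p N b).ne']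
      simp [weight]
    have h2 : HasDerivAt (fun b => ∑ y : Config N, weight p N b (mag y))
        (∑ y : Config N, weight p N β (mag y) * (N * mag y ^ p)) β := by
      refine HasDerivAt.fun_sum fun y _ => ?_
      have := ((hasDerivAt_id β).mul_const ((N : ℝ) * mag y ^ p)).exp
      simpa [weight] using this
    rw [h1, HasDerivAt.deriv (((hasDerivAt_id' β).mul_const _).fun_sub (h2.log hZ.ne'))]
    congr 1
    · simp
    · unfold mean
      rw [Finset.sum_div, Finset.mul_sum]
      refine Finset.sum_congr rfl fun y _ => ?_
      rw [prob_cwTensor hp hN, smul_eq_mul]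
      ring
  unfold fisherInfo
  rw [integral_law_eq_sum]
  simp_rw [hder]
  set M := mean p N β (fun u => u ^ p) with hM
  have e1 : ∑ x : Config N, prob (cwTensor p N) β x • (N * mag x ^ p - N * M) ^ 2
      = mean p N β (fun u => (N : ℝ) ^ 2 * (u ^ p - M) ^ 2) := by
    unfold mean
    exact Finset.sum_congr rfl fun x _ => by simp only [smul_eq_mul]; ring
  have e2 : mean p N β (fun u => u ^ p - c) = M - c := by rw [mean_sub, mean_const]
  have e3 : mean p N β (fun u => (u ^ p - c) ^ 2)
      = mean p N β (fun u => (u ^ p - M) ^ 2) + (M - c) ^ 2 := by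
    have : (fun u : ℝ => (u ^ p - c) ^ 2)
        = fun u => (u ^ p - M) ^ 2 + ((2 * (M - c)) * (u ^ p - M) + (M - c) ^ 2) := by
      funext u; ring
    rw [this, mean_add, mean_add, mean_mul, mean_sub, mean_const, mean_const, ← hM]
    ring
  rw [e1, e2, e3, mean_mul]
  have : (N : ℝ) ≠ 0 := Nat.cast_ne_zero.2 hN
  field_simp
  ring

/-! ### Product laws, entropy bounds and concentration of the magnetization -/

/-- The product law on `{-1, 1}^N` with mean `v` in each coordinate. -/
noncomputable def prodMass {N : ℕ} (v : ℝ) (x : Config N) : ℝ := ∏ i, ((1 + v * spin (x i)) / 2)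

theorem sum_prodMass_mul_prod {N : ℕ} (v : ℝ) (h : Fin N → ℝ → ℝ) :
    ∑ x : Config N, prodMass v x * ∏ i, h i (spin (x i))
      = ∏ i, ((1 + v) / 2 * h i 1 + (1 - v) / 2 * h i (-1)) := by
  unfold prodMass
  simp_rw [← Finset.prod_mul_distrib]
  rw [← Fintype.piFinset_univ,
    ← Finset.prod_univ_sum (fun _ => Finset.univ)
      (fun i b => (1 + v * spin b) / 2 * h i (spin b))]
  refine Finset.prod_congr rfl fun i _ => ?_
  simp [spin, sub_eq_add_neg]

theorem sum_prodMass {N : ℕ} (v : ℝ) : ∑ x : Config N, prodMass v x = 1 := by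
  have := sum_prodMass_mul_prod (N := N) v (fun _ _ => 1)
  simp only [Finset.prod_const_one, mul_one] at this
  rw [this]
  refine Finset.prod_eq_one fun i _ => by ring

theorem prodMass_nonneg {N : ℕ} {v : ℝ} (hv : |v| ≤ 1) (x : Config N) : 0 ≤ prodMass v x := by
  refine Finset.prod_nonneg fun i _ => ?_
  have := abs_le.1 hv
  rcases spin_mem (x i) with h | h <;> rw [h] <;> linarith [this.1, this.2]

theorem sum_prodMass_mul_spin_sub {N : ℕ} (v : ℝ) (j : Fin N) :
    ∑ x : Config N, prodMass v x * (spin (x j) - v) = 0 := by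
  have := sum_prodMass_mul_prod (N := N) v (fun i s => if i = j then s - v else 1)
  simp only [Finset.prod_ite_eq', Finset.mem_univ, if_true] at this
  rw [this]
  refine Finset.prod_eq_zero (Finset.mem_univ j) ?_
  simp only [if_true]
  ring

theorem sum_prodMass_mul_spin_sub_mul {N : ℕ} (v : ℝ) (j k : Fin N) :
    ∑ x : Config N, prodMass v x * ((spin (x j) - v) * (spin (x k) - v))
      = if j = k then 1 - v ^ 2 else 0 := by
  have := sum_prodMass_mul_prod (N := N) v
    (fun i s => (if i = j then s - v else 1) * (if i = k then s - v else 1))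
  simp only [Finset.prod_mul_distrib, Finset.prod_ite_eq', Finset.mem_univ, if_true] at this
  rw [this]
  split_ifs with hjk
  · subst hjk
    rw [Finset.prod_eq_single j]
    · simp only [if_true]; ring
    · intro i _ hi
      simp only [hi, if_false]
      ring
    · simp
  · refine Finset.prod_eq_zero (Finset.mem_univ j) ?_
    simp only [if_true, hjk, if_false]
    ring

theorem sum_prodMass_mul_mag_sub {N : ℕ} (hN : N ≠ 0) (v : ℝ) :
    ∑ x : Config N, prodMass v x * (mag x - v) = 0 := by
  have hN' : (N : ℝ) ≠ 0 := Nat.cast_ne_zero.2 hN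
  have h : ∀ x : Config N, prodMass v x * (mag x - v)
      = (N : ℝ)⁻¹ * ∑ j, prodMass v x * (spin (x j) - v) := fun x => by
    rw [← Finset.mul_sum, Finset.sum_sub_distrib, sum_spin_eq hN]
    simp
    field_simp
  simp_rw [h]
  rw [← Finset.mul_sum, Finset.sum_comm]
  simp [sum_prodMass_mul_spin_sub]

theorem sum_prodMass_mul_mag_sub_sq {N : ℕ} (hN : N ≠ 0) (v : ℝ) :
    ∑ x : Config N, prodMass v x * (mag x - v) ^ 2 = (1 - v ^ 2) / N := by
  have hN' : (N : ℝ) ≠ 0 := Nat.cast_ne_zero.2 hN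
  have h : ∀ x : Config N, prodMass v x * (mag x - v) ^ 2
      = ((N : ℝ) ^ 2)⁻¹ * ∑ j, ∑ k, prodMass v x * ((spin (x j) - v) * (spin (x k) - v)) :=
    fun x => by
    simp_rw [← Finset.mul_sum]
    rw [← Finset.sum_mul, Finset.sum_sub_distrib, sum_spin_eq hN]
    simp
    field_simp
  simp_rw [h]
  rw [← Finset.mul_sum, Finset.sum_comm]
  simp_rw [Finset.sum_comm (s := (Finset.univ : Finset (Config N))), sum_prodMass_mul_spin_sub_mul]
  simp
  field_simp

/-- On `{-1, 1}` the function `log (1 + v s)` is affine in `s`, so the product depends on `x` only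
through its magnetization. -/
theorem prod_one_add_mul_spin_eq_exp {N : ℕ} (hN : N ≠ 0) {v : ℝ} (x : Config N)
    (hv : ∀ i, 0 < 1 + v * spin (x i)) :
    ∏ i, (1 + v * spin (x i)) = Real.exp (N * ((1 / 2) * ((1 + mag x) * Real.log (1 + v)
      + (1 - mag x) * Real.log (1 - v)))) := by
  have h1 : ∀ i, Real.log (1 + v * spin (x i)) = (1 + spin (x i)) * (Real.log (1 + v) / 2)
      + (1 - spin (x i)) * (Real.log (1 - v) / 2) := fun i => by
    rcases spin_mem (x i) with h | h <;> rw [h]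
    · ring_nf
    · rw [mul_neg_one, ← sub_eq_add_neg]; ring_nf
  rw [← Real.exp_log (Finset.prod_pos fun i _ => hv i), Real.log_prod fun i _ => (hv i).ne']
  congr 1
  simp_rw [h1]
  rw [Finset.sum_add_distrib, ← Finset.sum_mul, ← Finset.sum_mul, Finset.sum_add_distrib,
    Finset.sum_sub_distrib, sum_spin_eq hN]
  simp
  ring

/-- The entropy weight is, up to `2 ^ N`, the likelihood of `x` under the product law whose mean is
the magnetization of `x` itself. -/
theorem exp_entropyI_mag {N : ℕ} (hN : N ≠ 0) (x : Config N) :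
    Real.exp (N * entropyI (mag x)) = 2 ^ N * prodMass (mag x) x := by
  -- Positivity holds even if `mag x = ±1`: the average of `1 + x_j x_i` over `j` has nonnegative
  -- terms, and the term `j = i` is `2`.
  have hpos : ∀ i, 0 < 1 + mag x * spin (x i) := fun i => by
    have h1 : (N : ℝ) * (1 + mag x * spin (x i)) = ∑ j, (1 + spin (x j) * spin (x i)) := by
      rw [Finset.sum_add_distrib, ← Finset.sum_mul, sum_spin_eq hN]; simp; ring
    have h2 : 1 + spin (x i) * spin (x i) ≤ ∑ j, (1 + spin (x j) * spin (x i)) := by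
      refine Finset.single_le_sum (f := fun j => 1 + spin (x j) * spin (x i)) (fun j _ => ?_)
        (Finset.mem_univ i)
      rcases spin_mem (x i) with h | h <;> rcases spin_mem (x j) with h' | h' <;> simp [h, h']
    have h3 : 0 < (N : ℝ) * (1 + mag x * spin (x i)) := by
      rw [h1]
      exact lt_of_lt_of_le (by nlinarith [mul_self_nonneg (spin (x i))]) h2
    exact pos_of_mul_pos_right h3 (Nat.cast_nonneg N)
  unfold prodMass
  rw [Finset.prod_div_distrib, prod_one_add_mul_spin_eq_exp hN x hpos]
  simp only [entropyI, Finset.prod_const, Finset.card_univ, Fintype.card_fin]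
  field_simp

theorem exists_mag_eq {N : ℕ} (x : Config N) :
    ∃ k ∈ Finset.range (N + 1), mag x = (2 * k - N) / N := by
  refine ⟨(Finset.univ.filter fun i => x i = true).card, ?_, ?_⟩
  · rw [Finset.mem_range, Nat.lt_succ_iff]
    exact (Finset.card_filter_le _ _).trans (by simp)
  · unfold mag
    congr 1
    have h : ∀ i, spin (x i) = 2 * (if x i = true then 1 else 0) - 1 := fun i => by
      unfold spin; split_ifs <;> norm_num
    simp_rw [h]
    rw [Finset.sum_sub_distrib, ← Finset.mul_sum, Finset.sum_boole]
    simp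

/-- Method of types: there are only `N + 1` candidate values for the magnetization. Each likelihood
is bounded by the sum over these candidates, and each candidate product law has total mass `1`. -/
theorem sum_exp_entropyI_le {N : ℕ} (hN : N ≠ 0) :
    ∑ x : Config N, Real.exp (N * entropyI (mag x)) ≤ 2 ^ N * (N + 1) := by
  simp_rw [exp_entropyI_mag hN]
  rw [← Finset.mul_sum]
  refine mul_le_mul_of_nonneg_left ?_ (by positivity)
  have hv : ∀ k ∈ Finset.range (N + 1), |((2 * k - N) / N : ℝ)| ≤ 1 := fun k hk => by
    have h1 : (k : ℝ) ≤ N := by exact_mod_cast Nat.lt_succ_iff.1 (Finset.mem_range.1 hk)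
    have h2 : (0 : ℝ) ≤ k := Nat.cast_nonneg k
    rw [abs_div, Nat.abs_cast]
    exact div_le_one_of_le₀ (abs_le.2 ⟨by linarith, by linarith⟩) (Nat.cast_nonneg N)
  calc ∑ x : Config N, prodMass (mag x) x
      ≤ ∑ x : Config N, ∑ k ∈ Finset.range (N + 1), prodMass ((2 * k - N) / N : ℝ) x := by
        refine Finset.sum_le_sum fun x _ => ?_
        obtain ⟨k, hk, he⟩ := exists_mag_eq x
        rw [he]
        exact Finset.single_le_sum (f := fun k : ℕ => prodMass ((2 * k - N) / N : ℝ) x)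
          (fun j hj => prodMass_nonneg (hv j hj) x) hk
    _ = (N + 1 : ℝ) := by
        rw [Finset.sum_comm]
        simp [sum_prodMass]

/-- Second-order Taylor bound for powers. -/
theorem abs_pow_sub_le {a b : ℝ} (ha : |a| ≤ 3) (hb : |b| ≤ 3) (p : ℕ) :
    |a ^ p - b ^ p - p * b ^ (p - 1) * (a - b)| ≤ p ^ 2 * 3 ^ p * (a - b) ^ 2 := by
  induction p with
  | zero => simp
  | succ p ih =>
    have h1 : a ^ (p + 1) - b ^ (p + 1) - (p + 1 : ℕ) * b ^ (p + 1 - 1) * (a - b)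
        = a * (a ^ p - b ^ p - p * b ^ (p - 1) * (a - b)) + p * b ^ (p - 1) * (a - b) ^ 2 := by
      rcases p with _ | p
      · simp
      · simp only [Nat.add_sub_cancel]
        push_cast
        ring
    rw [h1]
    -- The radius `3` leaves room for a flipped magnetization `u + 2 / N` with `|u| ≤ 1`.
    have h2 : |b| ^ (p - 1) ≤ 3 ^ p :=
      (pow_le_pow_left₀ (abs_nonneg b) hb _).trans
        (pow_le_pow_right₀ (by norm_num) (Nat.sub_le p 1))
    have hsq := sq_nonneg (a - b)
    calc |a * (a ^ p - b ^ p - p * b ^ (p - 1) * (a - b)) + p * b ^ (p - 1) * (a - b) ^ 2|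
        ≤ |a| * |a ^ p - b ^ p - p * b ^ (p - 1) * (a - b)| + p * |b| ^ (p - 1) * (a - b) ^ 2 := by
          refine (abs_add_le _ _).trans (le_of_eq ?_)
          rw [abs_mul, abs_mul, abs_mul, abs_pow, Nat.abs_cast, abs_of_nonneg hsq]
      _ ≤ 3 * (p ^ 2 * 3 ^ p * (a - b) ^ 2) + p * 3 ^ p * (a - b) ^ 2 := by gcongr
      _ ≤ ((p + 1 : ℕ) : ℝ) ^ 2 * 3 ^ (p + 1) * (a - b) ^ 2 := by
          push_cast
          have : (0 : ℝ) ≤ 3 ^ p * (a - b) ^ 2 := by positivity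
          have hp : (0 : ℝ) ≤ p := Nat.cast_nonneg p
          rw [pow_succ (3 : ℝ) p]
          nlinarith [mul_nonneg hp this]

/-- The variational lower bound for the partition function. -/
theorem le_sum_weight {p N : ℕ} (hN : N ≠ 0) {β m : ℝ} (hβ : 0 ≤ β) (hm0 : 0 < m)
    (hm1 : m < 1) :
    Real.exp (-(β * (p ^ 2 * 3 ^ p))) * (2 ^ N * Real.exp (N * gFun p β m))
      ≤ ∑ x : Config N, weight p N β (mag x) := by
  have hNpos : (0 : ℝ) < N := by positivity
  set K := β * ((p : ℝ) ^ 2 * 3 ^ p) with hK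
  have hK0 : 0 ≤ K := by positivity
  set b := β * (p * m ^ (p - 1)) - Real.artanh m with hb
  have hm : |m| ≤ 1 := abs_le.2 ⟨by linarith, hm1.le⟩
  -- The weight is compared with the product law of mean `m`: Taylor's bound on `u ^ p` and `exp y ≥
  -- 1 + y` give a quadratic lower bound in `u - m`. On summation the linear term vanishes and the
  -- quadratic one costs `K (1 - m ^ 2)`; the added `K` keeps the total, `1 + K m ^ 2`, at least
  -- `1`.
  have hx : ∀ x : Config N, prodMass m x *
      (1 + N * b * (mag x - m) - N * K * (mag x - m) ^ 2 + K)
      ≤ Real.exp K * Real.exp (-(N * gFun p β m)) * (2 ^ N)⁻¹ * weight p N β (mag x) := by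
    intro x
    have hpos : ∀ i, 0 < 1 + m * spin (x i) := fun i => by
      rcases spin_mem (x i) with h | h <;> rw [h] <;> linarith
    have hq : prodMass m x = (2 ^ N)⁻¹ *
        Real.exp (N * (entropyI m + (mag x - m) * Real.artanh m)) := by
      unfold prodMass
      rw [Finset.prod_div_distrib, prod_one_add_mul_spin_eq_exp hN x hpos,
        artanh_eq_log_sub_log (by linarith) hm1]
      simp only [Finset.prod_const, Finset.card_univ, Fintype.card_fin, entropyI]
      rw [div_eq_inv_mul]
      congr 3
      ring
    have hT := (abs_le.1 (abs_pow_sub_le (a := mag x) (b := m)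
      ((abs_mag_le x).trans (by norm_num)) (hm.trans (by norm_num)) p)).1
    have hle : N * b * (mag x - m) - N * K * (mag x - m) ^ 2 + K ≤
        K - N * gFun p β m + β * (N * mag x ^ p)
          - N * (entropyI m + (mag x - m) * Real.artanh m) := by
      have h1 := mul_le_mul_of_nonneg_left hT (mul_nonneg hNpos.le hβ)
      unfold gFun
      rw [hb, hK]
      nlinarith [h1]
    have hexp : Real.exp K * Real.exp (-(N * gFun p β m)) * (2 ^ N)⁻¹ * weight p N β (mag x)
        = prodMass m x * Real.exp (K - N * gFun p β m + β * (N * mag x ^ p)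
          - N * (entropyI m + (mag x - m) * Real.artanh m)) := by
      rw [hq]
      unfold weight
      rw [mul_assoc ((2 ^ N)⁻¹ : ℝ), ← Real.exp_add, ← Real.exp_add, mul_right_comm,
        ← Real.exp_add, mul_comm]
      congr 2
      ring
    rw [hexp]
    refine mul_le_mul_of_nonneg_left ?_ (prodMass_nonneg hm x)
    have := Real.add_one_le_exp (K - N * gFun p β m + β * (N * mag x ^ p)
          - N * (entropyI m + (mag x - m) * Real.artanh m))
    linarith
  have hsum := Finset.sum_le_sum fun x (_ : x ∈ Finset.univ) => hx x
  rw [← Finset.mul_sum] at hsum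
  have hleft : ∑ x : Config N, prodMass m x *
      (1 + N * b * (mag x - m) - N * K * (mag x - m) ^ 2 + K) = 1 + K * m ^ 2 := by
    have : ∀ x : Config N, prodMass m x *
      (1 + N * b * (mag x - m) - N * K * (mag x - m) ^ 2 + K)
      = (1 + K) * prodMass m x + (N * b) * (prodMass m x * (mag x - m))
        - (N * K) * (prodMass m x * (mag x - m) ^ 2) := fun x => by ring
    simp_rw [this]
    rw [Finset.sum_sub_distrib, Finset.sum_add_distrib, ← Finset.mul_sum, ← Finset.mul_sum,
      ← Finset.mul_sum, sum_prodMass, sum_prodMass_mul_mag_sub hN, sum_prodMass_mul_mag_sub_sq hN]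
    field_simp
    ring
  rw [hleft] at hsum
  have h1 : 1 ≤ Real.exp K * Real.exp (-(N * gFun p β m)) * (2 ^ N)⁻¹ *
      ∑ x : Config N, weight p N β (mag x) := le_trans (by nlinarith [sq_nonneg m]) hsum
  calc Real.exp (-K) * (2 ^ N * Real.exp (N * gFun p β m))
      = (Real.exp (-K) * (2 ^ N * Real.exp (N * gFun p β m))) * 1 := (mul_one _).symm
    _ ≤ (Real.exp (-K) * (2 ^ N * Real.exp (N * gFun p β m))) *
        (Real.exp K * Real.exp (-(N * gFun p β m)) * (2 ^ N)⁻¹ *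
          ∑ x : Config N, weight p N β (mag x)) :=
        mul_le_mul_of_nonneg_left h1 (by positivity)
    _ = ∑ x : Config N, weight p N β (mag x) := by
        rw [Real.exp_neg, Real.exp_neg]
        field_simp

/-- The numerator is split as `exp (N g(u)) exp (N I(u))`: the first factor is controlled by the gap
`η`, the second by the count of types. The factors `2 ^ N exp (N g(m))` cancel against the lower
bound for the partition function. -/
theorem mean_indicator_le {p N : ℕ} (hp : p ≠ 0) (hN : N ≠ 0) {β m η : ℝ} (hβ : 0 ≤ β)
    (hm0 : 0 < m) (hm1 : m < 1) (A : Set ℝ)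
    (hA : ∀ u ∈ A, u ∈ Set.Icc (-1 : ℝ) 1 → gFun p β u ≤ gFun p β m - η) :
    mean p N β (A.indicator fun _ => (1 : ℝ))
      ≤ Real.exp (β * (p ^ 2 * 3 ^ p)) * (N + 1) * Real.exp (-(N * η)) := by
  classical
  have hNpos : (0 : ℝ) < N := by positivity
  have hZ := sum_weight_pos p N β
  have hlow := le_sum_weight (p := p) hN hβ hm0 hm1
  unfold mean
  simp_rw [prob_cwTensor hp hN, smul_eq_mul, div_mul_eq_mul_div]
  rw [← Finset.sum_div, div_le_iff₀ hZ]
  have h1 : ∑ x : Config N, weight p N β (mag x) * A.indicator (fun _ => (1 : ℝ)) (mag x)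
      ≤ ∑ x : Config N, Real.exp (N * (gFun p β m - η)) * Real.exp (N * entropyI (mag x)) := by
    refine Finset.sum_le_sum fun x _ => ?_
    by_cases hx : mag x ∈ A
    · rw [Set.indicator_of_mem hx, mul_one, ← Real.exp_add]
      unfold weight
      refine Real.exp_le_exp.2 ?_
      have := mul_le_mul_of_nonneg_left (hA _ hx (mag_mem x)) hNpos.le
      unfold gFun at this ⊢
      linarith
    · rw [Set.indicator_of_notMem hx, mul_zero]
      positivity
  rw [← Finset.mul_sum] at h1
  refine h1.trans ((mul_le_mul_of_nonneg_left (sum_exp_entropyI_le hN) (Real.exp_pos _).le).trans ?_)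
  refine le_trans (le_of_eq ?_) (mul_le_mul_of_nonneg_left hlow (by positivity))
  rw [mul_sub, sub_eq_add_neg, Real.exp_add, Real.exp_neg (β * _)]
  field_simp

/-- Magnetizations at distance at least `δ` from the maximizers of `g`. -/
def farSet (p : ℕ) (m δ : ℝ) : Set ℝ := {u | δ ≤ |u - m| ∧ (Even p → δ ≤ |u + m|)}

/-- On the compact far set `g` attains a maximum, strictly below `g m` by uniqueness, so the
probability is exponentially small. A rate `N ^ (-2)` is all that is needed later. -/
theorem IsPosMaximizer.exists_mean_farSet_le {p : ℕ} (hp : 2 ≤ p) {β m : ℝ} (hβ : 0 ≤ β)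
    (hg : ∃ t ∈ Set.Icc (0 : ℝ) 1, 0 < gFun p β t) (h : IsPosMaximizer p β m) {δ : ℝ}
    (hδ : 0 < δ) :
    ∃ C, 0 ≤ C ∧ ∀ N : ℕ, N ≠ 0 →
      mean p N β ((farSet p m δ).indicator fun _ => (1 : ℝ)) ≤ C / (N : ℝ) ^ 2 := by
  have hclosed : IsClosed (farSet p m δ) := by
    have h1 : IsClosed {u : ℝ | δ ≤ |u - m|} := isClosed_le continuous_const (by fun_prop)
    have h2 : IsClosed {u : ℝ | Even p → δ ≤ |u + m|} := by
      by_cases he : Even p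
      · simp only [he, true_imp_iff]
        exact isClosed_le continuous_const (by fun_prop)
      · simp [he]
    exact h1.inter h2
  have hcomp : IsCompact (Set.Icc (-1 : ℝ) 1 ∩ farSet p m δ) := isCompact_Icc.inter_right hclosed
  obtain ⟨η, hη, hA⟩ : ∃ η, 0 < η ∧ ∀ u ∈ farSet p m δ, u ∈ Set.Icc (-1 : ℝ) 1 →
      gFun p β u ≤ gFun p β m - η := by
    rcases Set.eq_empty_or_nonempty (Set.Icc (-1 : ℝ) 1 ∩ farSet p m δ) with he | hne
    · refine ⟨1, one_pos, fun u hu hu' => ?_⟩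
      have : u ∈ Set.Icc (-1 : ℝ) 1 ∩ farSet p m δ := ⟨hu', hu⟩
      rw [he] at this
      exact this.elim
    · obtain ⟨t, ht, htmax⟩ := hcomp.exists_isMaxOn hne (continuous_gFun p β).continuousOn
      refine ⟨gFun p β m - gFun p β t, ?_, fun u hu hu' => ?_⟩
      · rw [sub_pos]
        by_contra! hle
        rcases h.eq_or_eq_neg hp hβ hg ht.1 hle with rfl | ⟨he, rfl⟩
        · have := ht.2.1
          rw [sub_self, abs_zero] at this
          linarith
        · have := ht.2.2 he
          rw [neg_add_cancel, abs_zero] at this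
          linarith
      · have : gFun p β u ≤ gFun p β t := htmax ⟨hu', hu⟩
        linarith
  -- The `12` is `2 * 6`, from `N + 1 ≤ 2 N` and `exp y ≥ y ^ 3 / 6` at `y = N η`.
  refine ⟨Real.exp (β * (p ^ 2 * 3 ^ p)) * (12 / η ^ 3), by positivity, fun N hN => ?_⟩
  refine (mean_indicator_le (by omega) hN hβ h.1 h.lt_one _ hA).trans ?_
  have hN1 : (1 : ℝ) ≤ N := by exact_mod_cast Nat.one_le_iff_ne_zero.2 hN
  have h3 : ((N : ℝ) * η) ^ 3 / 6 ≤ Real.exp (N * η) := by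
    have := Real.pow_div_factorial_le_exp (N * η) (by positivity) 3
    norm_num [Nat.factorial] at this
    exact this
  have h4 : Real.exp (-(N * η)) ≤ 6 / ((N : ℝ) * η) ^ 3 := by
    rw [Real.exp_neg, inv_le_comm₀ (Real.exp_pos _) (by positivity), inv_div]
    exact h3
  calc Real.exp (β * (p ^ 2 * 3 ^ p)) * (N + 1) * Real.exp (-(N * η))
      ≤ Real.exp (β * (p ^ 2 * 3 ^ p)) * (2 * N) * (6 / ((N : ℝ) * η) ^ 3) := by
        gcongr
        linarith
    _ = Real.exp (β * (p ^ 2 * 3 ^ p)) * (12 / η ^ 3) / (N : ℝ) ^ 2 := by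
        field_simp
        ring

/-! ### Quadratic Taylor bounds, drift and folded averages -/

/-- The derivative of a `C²` function is locally Lipschitz, so the mean value inequality for `s ↦ f
s - f'(m) s` on the ball of radius `|u - m|` gives a quadratic error. -/
theorem exists_taylor_bound {f : ℝ → ℝ} {m : ℝ} (hf : ContDiffAt ℝ 2 f m) :
    ∃ δ, 0 < δ ∧ ∃ C, 0 ≤ C ∧ ∀ u, |u - m| < δ →
      |f u - f m - deriv f m * (u - m)| ≤ C * (u - m) ^ 2 := by
  have hd : ContDiffAt ℝ 1 (deriv f) m := hf.derivWithin (by norm_num)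
  obtain ⟨K, t, ht, hK⟩ := hd.exists_lipschitzOnWith
  have hdiff : ∀ᶠ u in 𝓝 m, DifferentiableAt ℝ f u := by
    filter_upwards [hf.eventually (by simp)] with u hu
    exact hu.differentiableAt (by norm_num)
  obtain ⟨δ, hδ, hball⟩ := Metric.mem_nhds_iff.1 (Filter.inter_mem ht hdiff)
  refine ⟨δ, hδ, K, K.2, fun u hu => ?_⟩
  have hsub : Metric.closedBall m |u - m| ⊆ Metric.ball m δ := Metric.closedBall_subset_ball hu
  have hmt : m ∈ t := mem_of_mem_nhds ht
  have := (convex_closedBall m |u - m|).norm_image_sub_le_of_norm_hasDerivWithin_le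
    (f := fun s => f s - deriv f m * s) (f' := fun s => deriv f s - deriv f m)
    (C := K * |u - m|) (x := m) (y := u) ?_ ?_ (by simp) (by simp [Real.dist_eq])
  · calc |f u - f m - deriv f m * (u - m)|
        = ‖f u - deriv f m * u - (f m - deriv f m * m)‖ := by
          rw [Real.norm_eq_abs]; congr 1; ring
      _ ≤ K * |u - m| * ‖u - m‖ := this
      _ = K * (u - m) ^ 2 := by rw [Real.norm_eq_abs, mul_assoc, ← sq, sq_abs]
  · intro s hs
    have h1 : DifferentiableAt ℝ f s := (hball (hsub hs)).2
    have h2 := (h1.hasDerivAt.fun_sub ((hasDerivAt_id s).const_mul (deriv f m))).hasDerivWithinAt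
      (s := Metric.closedBall m |u - m|)
    simpa using h2
  · intro s hs
    have h1 := hK.dist_le_mul s (hball (hsub hs)).1 m hmt
    rw [Real.dist_eq] at h1
    refine h1.trans ?_
    have h2 : dist s m ≤ |u - m| := hs
    gcongr

theorem exists_taylor_bound_Icc {f : ℝ → ℝ} {m f' : ℝ} (hf : ContDiff ℝ 2 f)
    (hf' : HasDerivAt f f' m) :
    ∃ C, 0 ≤ C ∧ ∀ u ∈ Set.Icc (-1 : ℝ) 1, |f u - f m - f' * (u - m)| ≤ C * (u - m) ^ 2 := by
  obtain ⟨δ, hδ, C, hC, hb⟩ := exists_taylor_bound (hf.contDiffAt (x := m))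
  rw [hf'.deriv] at hb
  have hcont : Continuous fun u => f u - f m - f' * (u - m) :=
    (hf.continuous.sub continuous_const).sub (by fun_prop)
  obtain ⟨B, hB⟩ := isCompact_Icc.exists_bound_of_continuousOn (s := Set.Icc (-1 : ℝ) 1)
    hcont.continuousOn
  have hB0 : 0 ≤ B := (norm_nonneg _).trans (hB 0 (by simp))
  -- Outside the `δ`-neighbourhood the remainder is at most `B`, and `(u - m) ^ 2 ≥ δ ^ 2`.
  refine ⟨C + B / δ ^ 2, by positivity, fun u hu => ?_⟩
  by_cases h : |u - m| < δ
  · refine (hb u h).trans ?_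
    have : 0 ≤ B / δ ^ 2 * (u - m) ^ 2 := by positivity
    linarith
  · have h1 : δ ^ 2 ≤ (u - m) ^ 2 := by
      rw [← sq_abs (u - m)]
      exact pow_le_pow_left₀ hδ.le (not_lt.1 h) 2
    have h2 : B ≤ B / δ ^ 2 * (u - m) ^ 2 := by
      rw [div_mul_eq_mul_div, le_div_iff₀ (by positivity)]
      exact mul_le_mul_of_nonneg_left h1 hB0
    have h3 := hB u hu
    rw [Real.norm_eq_abs] at h3
    have : 0 ≤ C * (u - m) ^ 2 := by positivity
    linarith

/-- The upward rate `(1 - u) exp (2 β p u ^ (p - 1))` of the single-spin dynamics. -/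
noncomputable def upRate (p : ℕ) (β u : ℝ) : ℝ := (1 - u) * Real.exp (2 * β * p * u ^ (p - 1))

/-- The drift `(1 + u) - (1 - u) exp (2 β p u ^ (p - 1))`, which vanishes at critical points
of `g`. -/
noncomputable def drift (p : ℕ) (β u : ℝ) : ℝ := (1 + u) - upRate p β u

theorem contDiff_upRate (p : ℕ) (β : ℝ) : ContDiff ℝ 2 (upRate p β) := by
  unfold upRate
  fun_prop

theorem contDiff_drift (p : ℕ) (β : ℝ) : ContDiff ℝ 2 (drift p β) := by
  unfold drift
  exact (by fun_prop : ContDiff ℝ 2 fun u : ℝ => 1 + u).sub (contDiff_upRate p β)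

section Maximizer

variable {p : ℕ} {β m : ℝ}

theorem IsPosMaximizer.exp_eq (h : IsPosMaximizer p β m) :
    Real.exp (2 * β * p * m ^ (p - 1)) = (1 + m) / (1 - m) := by
  have h0 := h.1
  have h1 := h.lt_one
  have h2 : 2 * β * p * m ^ (p - 1) = Real.log (1 + m) - Real.log (1 - m) := by
    have := h.artanh_eq
    rw [artanh_eq_log_sub_log (by linarith) h1] at this
    linarith
  rw [h2, Real.exp_sub, Real.exp_log (by linarith), Real.exp_log (by linarith)]

theorem IsPosMaximizer.upRate_eq (h : IsPosMaximizer p β m) : upRate p β m = 1 + m := by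
  have h1 := h.lt_one
  have : 1 - m ≠ 0 := by linarith
  unfold upRate
  rw [h.exp_eq]
  field_simp

theorem IsPosMaximizer.drift_eq (h : IsPosMaximizer p β m) : drift p β m = 0 := by
  unfold drift
  rw [h.upRate_eq, sub_self]

theorem hasDerivAt_upRate (p : ℕ) (β u : ℝ) :
    HasDerivAt (upRate p β) (deriv (upRate p β) u) u :=
  ((contDiff_upRate p β).differentiable (by norm_num) u).hasDerivAt

/-- When `g''(m) < 0` this slope is positive, so the drift pulls `u` back to `m`. Dividing it into
the jump coefficient `2 (1 + m)` produces the variance `1 / -g''(m)`. -/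
theorem IsPosMaximizer.hasDerivAt_drift (h : IsPosMaximizer p β m) :
    HasDerivAt (drift p β) (2 * (1 + m) * -(deriv (deriv (gFun p β)) m)) m := by
  have h0 := h.1
  have h1 := h.lt_one
  have h3 : 1 - m ≠ 0 := by linarith
  have h4 : 1 + m ≠ 0 := by linarith
  have h5 : 1 - m ^ 2 ≠ 0 := by nlinarith
  have hd := ((hasDerivAt_id m).const_add 1).sub (((hasDerivAt_id m).const_sub 1).mul
    (((hasDerivAt_pow (p - 1) m).const_mul (2 * β * p)).exp))
  convert! hd using 1
  rw [deriv_deriv_gFun p β (by linarith) h1, h.exp_eq]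
  simp only [id]
  have h6 : 1 - m ^ 2 = (1 - m) * (1 + m) := by ring
  rw [h6]
  field_simp
  ring

end Maximizer

/-- The indicator of `u > 0`, doubled for even `p` to account for the symmetry `u ↦ -u`. -/
noncomputable def posWeight (p : ℕ) (u : ℝ) : ℝ :=
  if 0 < u then (if Even p then 2 else 1) else 0

theorem posWeight_nonneg (p : ℕ) (u : ℝ) : 0 ≤ posWeight p u := by
  unfold posWeight; split_ifs <;> norm_num

theorem posWeight_le_two (p : ℕ) (u : ℝ) : posWeight p u ≤ 2 := by
  unfold posWeight; split_ifs <;> norm_num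

/-- The expectation over positive magnetizations, normalized by symmetry. -/
noncomputable def posMean {E : Type*} [AddCommGroup E] [Module ℝ E] (p N : ℕ) (β : ℝ)
    (f : ℝ → E) : E := mean p N β fun u => posWeight p u • f u

section PosMeanLemmas

variable {E : Type*} {p N : ℕ} {β : ℝ}

theorem posMean_add [AddCommGroup E] [Module ℝ E] (f g : ℝ → E) :
    posMean p N β (fun u => f u + g u) = posMean p N β f + posMean p N β g := by
  simp [posMean, smul_add, mean_add]

theorem posMean_sub [AddCommGroup E] [Module ℝ E] (f g : ℝ → E) :
    posMean p N β (fun u => f u - g u) = posMean p N β f - posMean p N β g := by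
  simp [posMean, smul_sub, mean_sub]

theorem posMean_mul (c : ℝ) (f : ℝ → ℝ) :
    posMean p N β (fun u => c * f u) = c * posMean p N β f := by
  unfold posMean
  rw [← mean_mul]
  congr 1; funext u; simp only [smul_eq_mul]; ring

theorem posMean_mul_complex (c : ℂ) (f : ℝ → ℂ) :
    posMean p N β (fun u => c * f u) = c * posMean p N β f := by
  unfold posMean
  rw [← mean_mul_complex]
  congr 1; funext u; simp only [Complex.real_smul]; ring

theorem posMean_mono {f g : ℝ → ℝ} (h : ∀ u ∈ Set.Ioc (0 : ℝ) 1, f u ≤ g u) :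
    posMean p N β f ≤ posMean p N β g := by
  refine mean_mono fun u hu => ?_
  by_cases h0 : 0 < u
  · exact mul_le_mul_of_nonneg_left (h u ⟨h0, hu.2⟩) (posWeight_nonneg p u)
  · simp [posWeight, h0]

theorem norm_posMean_le [NormedAddCommGroup E] [NormedSpace ℝ E] {f : ℝ → E} {g : ℝ → ℝ}
    (h : ∀ u ∈ Set.Ioc (0 : ℝ) 1, ‖f u‖ ≤ g u) : ‖posMean p N β f‖ ≤ posMean p N β g := by
  refine norm_mean_le fun u hu => ?_
  by_cases h0 : 0 < u
  · rw [norm_smul, Real.norm_of_nonneg (posWeight_nonneg p u), smul_eq_mul]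
    exact mul_le_mul_of_nonneg_left (h u ⟨h0, hu.2⟩) (posWeight_nonneg p u)
  · simp [posWeight, h0]

theorem posMean_nonneg {f : ℝ → ℝ} (h : ∀ u ∈ Set.Ioc (0 : ℝ) 1, 0 ≤ f u) :
    0 ≤ posMean p N β f := by
  have := posMean_mono (p := p) (N := N) (β := β) (f := fun _ => 0) h
  simpa [posMean, mean] using this

theorem posMean_const_le {c : ℝ} (hc : 0 ≤ c) : posMean p N β (fun _ => c) ≤ 2 * c := by
  have h : posMean p N β (fun _ => c) ≤ mean p N β (fun _ => 2 * c) := by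
    refine mean_mono fun u _ => ?_
    exact mul_le_mul_of_nonneg_right (posWeight_le_two p u) hc
  rwa [mean_const] at h

end PosMeanLemmas

theorem abs_exp_sub_exp_le {x y R : ℝ} (hx : x ≤ R) (hy : y ≤ R) :
    |Real.exp x - Real.exp y| ≤ Real.exp R * |x - y| := by
  have key : ∀ a b : ℝ, a ≤ R → Real.exp a - Real.exp b ≤ Real.exp R * |a - b| := by
    intro a b ha
    have h1 := Real.add_one_le_exp (b - a)
    have h2 : Real.exp b = Real.exp a * Real.exp (b - a) := by rw [← Real.exp_add]; ring_nf
    calc Real.exp a - Real.exp b ≤ Real.exp a * (a - b) := by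
          rw [h2]; nlinarith [Real.exp_pos a]
      _ ≤ Real.exp a * |a - b| := mul_le_mul_of_nonneg_left (le_abs_self _) (Real.exp_pos a).le
      _ ≤ Real.exp R * |a - b| :=
          mul_le_mul_of_nonneg_right (Real.exp_le_exp.2 ha) (abs_nonneg _)
  rw [abs_le]
  have h1 := key x y hx
  have h2 := key y x hy
  rw [abs_sub_comm] at h2
  constructor <;> linarith

/-- A flip moves `u` by `2 / N`; Taylor's bound shows that the energy change equals its derivative
term `2 β p u ^ (p - 1)` up to `O(1 / N)`. -/
theorem exists_flipRatio_bound (p : ℕ) {β : ℝ} (hβ : 0 ≤ β) :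
    ∃ C, 0 ≤ C ∧ ∀ N : ℕ, N ≠ 0 → ∀ u ∈ Set.Icc (-1 : ℝ) 1,
      Real.exp (β * (N * ((u + 2 / N) ^ p - u ^ p))) ≤ C ∧
      |Real.exp (β * (N * ((u + 2 / N) ^ p - u ^ p))) - Real.exp (2 * β * p * u ^ (p - 1))|
        ≤ C / N := by
  set D : ℝ := 4 * (p ^ 2 * 3 ^ p) with hD
  have hD0 : 0 ≤ D := by positivity
  set R := β * (2 * p + D) with hR
  have hR0 : 0 ≤ R := by positivity
  refine ⟨Real.exp R * (1 + β * D), by positivity, fun N hN u hu => ?_⟩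
  have hN1 : (1 : ℝ) ≤ N := by exact_mod_cast Nat.one_le_iff_ne_zero.2 hN
  have hNpos : (0 : ℝ) < N := by linarith
  have h2N : 2 / (N : ℝ) ≤ 2 := by rw [div_le_iff₀ hNpos]; linarith
  have h2N0 : 0 ≤ 2 / (N : ℝ) := by positivity
  have hua : |u| ≤ 1 := abs_le.2 hu
  have hT := abs_pow_sub_le (a := u + 2 / N) (b := u)
    (abs_le.2 ⟨by linarith [hu.1], by linarith [hu.2]⟩) (hua.trans (by norm_num)) p
  rw [add_sub_cancel_left] at hT
  set x := β * (N * ((u + 2 / N) ^ p - u ^ p)) with hx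
  set y := 2 * β * p * u ^ (p - 1) with hy
  have hxy : |x - y| ≤ β * D / N := by
    have e : x - y = β * N * ((u + 2 / N) ^ p - u ^ p - p * u ^ (p - 1) * (2 / N)) := by
      rw [hx, hy]; field_simp
    rw [e, abs_mul, abs_of_nonneg (by positivity)]
    refine (mul_le_mul_of_nonneg_left hT (by positivity)).trans (le_of_eq ?_)
    rw [hD]; field_simp; ring
  have hyR : y ≤ β * (2 * p) := by
    have h1 : u ^ (p - 1) ≤ 1 := by
      calc u ^ (p - 1) ≤ |u ^ (p - 1)| := le_abs_self _
        _ = |u| ^ (p - 1) := abs_pow _ _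
        _ ≤ 1 := pow_le_one₀ (abs_nonneg u) hua
    calc y = (2 * β * p) * u ^ (p - 1) := rfl
      _ ≤ (2 * β * p) * 1 := mul_le_mul_of_nonneg_left h1 (by positivity)
      _ = β * (2 * p) := by ring
  have hbD : β * D / N ≤ β * D := div_le_self (by positivity) hN1
  have hbD0 : 0 ≤ β * D := by positivity
  have hxR : x ≤ R := by
    have := (abs_le.1 hxy).2
    rw [hR, mul_add]; linarith
  have hyR' : y ≤ R := by rw [hR, mul_add]; linarith
  have hexp := Real.exp_pos R
  refine ⟨(Real.exp_le_exp.2 hxR).trans ?_, (abs_exp_sub_exp_le hxR hyR').trans ?_⟩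
  · nlinarith
  · calc Real.exp R * |x - y| ≤ Real.exp R * (β * D / N) := by gcongr
      _ = Real.exp R * (β * D) / N := by ring
      _ ≤ Real.exp R * (1 + β * D) / N := by gcongr; linarith

/-! ### Stein's identity for the magnetization -/

section Stein

variable {p : ℕ} {β m : ℝ}

/-- In this window a flip crosses `0`, where `posWeight` jumps. For `N ≥ 4 / m` the window lies at
distance at least `m / 2` from `±m`; for smaller `N` the term `16 / m ^ 2` makes the bound trivial.
-/
theorem IsPosMaximizer.exists_mean_boundary_le (hp : 2 ≤ p) (hβ : 0 ≤ β)
    (hg : ∃ t ∈ Set.Icc (0 : ℝ) 1, 0 < gFun p β t) (h : IsPosMaximizer p β m) :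
    ∃ C, 0 ≤ C ∧ ∀ N : ℕ, N ≠ 0 →
      mean p N β ((Set.Ioc (-(2 / (N : ℝ))) 0).indicator fun _ => (1 : ℝ)) ≤ C / (N : ℝ) ^ 2 := by
  have h0 := h.1
  obtain ⟨C, hC, hb⟩ := h.exists_mean_farSet_le hp hβ hg (half_pos h0)
  refine ⟨C + 16 / m ^ 2, by positivity, fun N hN => ?_⟩
  have hNpos : (0 : ℝ) < N := by positivity
  rw [add_div]
  by_cases hNm : 4 / m ≤ N
  · have h1 : 2 / (N : ℝ) ≤ m / 2 := by
      rw [div_le_iff₀ h0] at hNm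
      rw [div_le_iff₀ hNpos]
      linarith
    have h2 : (0 : ℝ) ≤ 16 / m ^ 2 / (N : ℝ) ^ 2 := by positivity
    refine (le_trans ?_ (hb N hN)).trans (by linarith)
    refine mean_mono fun u _ => ?_
    refine Set.indicator_le_indicator_of_subset (fun u hu => ?_) (fun _ => zero_le_one) u
    refine ⟨?_, fun _ => ?_⟩
    · rw [abs_sub_comm]
      exact le_trans (by linarith [hu.2]) (le_abs_self _)
    · exact le_trans (by linarith [hu.1]) (le_abs_self _)
  · have h1 : mean p N β ((Set.Ioc (-(2 / (N : ℝ))) 0).indicator fun _ => (1 : ℝ)) ≤ 1 := by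
      rw [← mean_const (p := p) (N := N) (β := β) (1 : ℝ)]
      refine mean_mono fun u _ => ?_
      rw [mean_const]
      exact Set.indicator_le_self' (fun _ _ => zero_le_one) u
    have h2 : 1 ≤ 16 / m ^ 2 / (N : ℝ) ^ 2 := by
      rw [div_div, le_div_iff₀ (by positivity), ← mul_pow]
      rw [not_le, lt_div_iff₀ h0] at hNm
      have : 0 < m * N := by positivity
      nlinarith
    have h3 : 0 ≤ C / (N : ℝ) ^ 2 := by positivity
    linarith

/-- Stein's identity for the magnetization, up to an error. -/
theorem IsPosMaximizer.exists_stein_bound (E : Type*) [NormedAddCommGroup E] [NormedSpace ℝ E]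
    (hp : 2 ≤ p) (hβ : 0 ≤ β)
    (hg : ∃ t ∈ Set.Icc (0 : ℝ) 1, 0 < gFun p β t) (h : IsPosMaximizer p β m) :
    ∃ C, 0 ≤ C ∧ ∀ N : ℕ, N ≠ 0 → ∀ (φ : ℝ → E) (M : ℝ),
      (∀ u ∈ Set.Icc (-1 : ℝ) 3, ‖φ u‖ ≤ M) →
      ‖posMean p N β (fun u => drift p β u • φ u)
        - posMean p N β (fun u => upRate p β u • (φ (u + 2 / N) - φ u))‖
        ≤ C / N * posMean p N β (fun u => ‖φ (u + 2 / N)‖) + C * M / (N : ℝ) ^ 2 := by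
  obtain ⟨C₁, hC₁, hr⟩ := exists_flipRatio_bound p hβ
  obtain ⟨C₂, hC₂, hbd⟩ := h.exists_mean_boundary_le hp hβ hg
  refine ⟨2 * C₁ + 4 * C₁ * C₂, by positivity, fun N hN φ M hM => ?_⟩
  have hN1 : (1 : ℝ) ≤ N := by exact_mod_cast Nat.one_le_iff_ne_zero.2 hN
  have hNpos : (0 : ℝ) < N := by linarith
  have h2N : 2 / (N : ℝ) ≤ 2 := by rw [div_le_iff₀ hNpos]; linarith
  have h2N0 : 0 < 2 / (N : ℝ) := by positivity
  have hM0 : 0 ≤ M := (norm_nonneg _).trans (hM 0 (by constructor <;> norm_num))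
  set e : ℝ → ℝ := fun u => Real.exp (β * (N * ((u + 2 / N) ^ p - u ^ p))) with he
  have hbal := mean_one_add_smul (by omega : p ≠ 0) hN β (fun u => posWeight p u • φ u)
  -- Two errors remain after the exact balance for `posWeight • φ`: replacing the flip ratio by its
  -- limit costs `O(1 / N)` times the average of `‖φ (u + 2 / N)‖`, and the jump of `posWeight` is
  -- confined to the boundary window of probability `O(N ^ (-2))`.
  have hdiff : posMean p N β (fun u => drift p β u • φ u)
        - posMean p N β (fun u => upRate p β u • (φ (u + 2 / N) - φ u))
      = mean p N β (fun u => ((1 - u) * (e u - Real.exp (2 * β * p * u ^ (p - 1))) * posWeight p u)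
            • φ (u + 2 / N))
        + mean p N β (fun u => ((1 - u) * e u * (posWeight p (u + 2 / N) - posWeight p u))
            • φ (u + 2 / N)) := by
    have e1 : posMean p N β (fun u => drift p β u • φ u)
        - posMean p N β (fun u => upRate p β u • (φ (u + 2 / N) - φ u))
        = mean p N β (fun u => (1 + u) • (posWeight p u • φ u))
          - mean p N β (fun u => (upRate p β u * posWeight p u) • φ (u + 2 / N)) := by
      unfold posMean
      rw [← mean_sub, ← mean_sub]
      congr 1
      funext u
      unfold drift
      module
    rw [e1, hbal, ← mean_sub, ← mean_add]
    congr 1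
    funext u
    simp only [he]
    unfold upRate
    module
  rw [hdiff]
  refine (norm_add_le _ _).trans ?_
  have hA : ‖mean p N β (fun u =>
      ((1 - u) * (e u - Real.exp (2 * β * p * u ^ (p - 1))) * posWeight p u) • φ (u + 2 / N))‖
      ≤ 2 * C₁ / N * posMean p N β (fun u => ‖φ (u + 2 / N)‖) := by
    rw [← posMean_mul]
    refine norm_mean_le fun u hu => ?_
    rw [norm_smul, norm_mul, norm_mul, Real.norm_of_nonneg (posWeight_nonneg p u),
      Real.norm_of_nonneg (by linarith [hu.2] : 0 ≤ 1 - u), smul_eq_mul]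
    have h1 := (hr N hN u hu).2
    have h2 : 1 - u ≤ 2 := by linarith [hu.1]
    have h3 : 0 ≤ 1 - u := by linarith [hu.2]
    have hw := posWeight_nonneg p u
    calc (1 - u) * ‖e u - Real.exp (2 * β * p * u ^ (p - 1))‖ * posWeight p u * ‖φ (u + 2 / N)‖
        ≤ 2 * (C₁ / N) * posWeight p u * ‖φ (u + 2 / N)‖ := by
          gcongr
          exact h1
      _ = _ := by ring
  have hB : ‖mean p N β (fun u => ((1 - u) * e u * (posWeight p (u + 2 / N) - posWeight p u))
            • φ (u + 2 / N))‖ ≤ 4 * C₁ * M * (C₂ / (N : ℝ) ^ 2) := by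
    refine le_trans ?_ (mul_le_mul_of_nonneg_left (hbd N hN) (by positivity))
    rw [← mean_mul]
    refine norm_mean_le fun u hu => ?_
    by_cases hub : u ∈ Set.Ioc (-(2 / (N : ℝ))) 0
    · rw [Set.indicator_of_mem hub, mul_one, norm_smul, norm_mul, norm_mul,
        Real.norm_of_nonneg (by linarith [hu.2] : 0 ≤ 1 - u), Real.norm_of_nonneg (Real.exp_pos _).le]
      have h1 := (hr N hN u hu).1
      have h2 : 1 - u ≤ 2 := by linarith [hu.1]
      have h3 : ‖posWeight p (u + 2 / N) - posWeight p u‖ ≤ 2 := by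
        rw [Real.norm_eq_abs, abs_le]
        constructor <;> linarith [posWeight_nonneg p (u + 2 / N), posWeight_nonneg p u,
          posWeight_le_two p (u + 2 / N), posWeight_le_two p u]
      have h4 := hM (u + 2 / N) ⟨by linarith [hu.1], by linarith [hu.2]⟩
      calc (1 - u) * e u * ‖posWeight p (u + 2 / N) - posWeight p u‖ * ‖φ (u + 2 / N)‖
          ≤ 2 * C₁ * 2 * M := by gcongr
        _ = _ := by ring
    · have : posWeight p (u + 2 / N) = posWeight p u := by
        unfold posWeight
        by_cases h0 : 0 < u
        · rw [if_pos h0, if_pos (by linarith)]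
        · have : ¬ (0 < u + 2 / N) := fun h' => hub ⟨by linarith, not_lt.1 h0⟩
          rw [if_neg h0, if_neg this]
      rw [Set.indicator_of_notMem hub, this, sub_self, mul_zero, zero_smul, norm_zero, mul_zero]
  refine (add_le_add hA hB).trans ?_
  have hpm : 0 ≤ posMean p N β (fun u => ‖φ (u + 2 / N)‖) := posMean_nonneg fun u _ => norm_nonneg _
  have e2 : 4 * C₁ * M * (C₂ / (N : ℝ) ^ 2) = 4 * C₁ * C₂ * M / (N : ℝ) ^ 2 := by ring
  rw [e2]
  gcongr
  · have : 0 ≤ 4 * C₁ * C₂ := by positivity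
    linarith
  · linarith

end Stein

/-! ### Moments of the magnetization about the maximizer -/

/-- The fluctuation scale `1 / √N`. -/
noncomputable def rootInv (N : ℕ) : ℝ := (√(N : ℝ))⁻¹

theorem rootInv_pos {N : ℕ} (hN : N ≠ 0) : 0 < rootInv N := by
  unfold rootInv
  have : (0 : ℝ) < N := by positivity
  positivity

theorem rootInv_le_one (N : ℕ) : rootInv N ≤ 1 := by
  unfold rootInv
  rcases Nat.eq_zero_or_pos N with rfl | h
  · simp
  · refine inv_le_one_of_one_le₀ (Real.one_le_sqrt.2 ?_)
    exact_mod_cast h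

theorem rootInv_sq (N : ℕ) : rootInv N ^ 2 = 1 / N := by
  unfold rootInv
  rw [inv_pow, Real.sq_sqrt (Nat.cast_nonneg N), one_div]

theorem rootInv_pow_four (N : ℕ) : rootInv N ^ 4 = 1 / (N : ℝ) ^ 2 := by
  rw [show 4 = 2 * 2 from rfl, pow_mul, rootInv_sq, div_pow, one_pow]

theorem rootInv_pow_le {N : ℕ} (hN : N ≠ 0) {j k : ℕ} (hjk : j ≤ k) :
    rootInv N ^ k ≤ rootInv N ^ j :=
  pow_le_pow_of_le_one (rootInv_pos hN).le (rootInv_le_one N) hjk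

theorem tendsto_rootInv : Tendsto rootInv atTop (𝓝 0) := by
  unfold rootInv
  exact tendsto_inv_atTop_zero.comp (Real.tendsto_sqrt_atTop.comp tendsto_natCast_atTop_atTop)

theorem abs_mul_eq_abs_mul_of_pos (x : ℝ) {a : ℝ} (ha : 0 < a) : |x| * a = |a * x| := by
  rw [abs_mul, abs_of_pos ha, mul_comm]

section Moments

variable {p : ℕ} {β m : ℝ}

theorem IsPosMaximizer.exists_stein_bound_rootInv (E : Type*) [NormedAddCommGroup E]
    [NormedSpace ℝ E] (hp : 2 ≤ p) (hβ : 0 ≤ β)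
    (hg : ∃ t ∈ Set.Icc (0 : ℝ) 1, 0 < gFun p β t) (h : IsPosMaximizer p β m) :
    ∃ C, 0 ≤ C ∧ ∀ N : ℕ, N ≠ 0 → ∀ (φ : ℝ → E) (M : ℝ),
      (∀ u ∈ Set.Icc (-1 : ℝ) 3, ‖φ u‖ ≤ M) →
      ‖posMean p N β (fun u => drift p β u • φ u)
        - posMean p N β (fun u => upRate p β u • (φ (u + 2 * rootInv N ^ 2) - φ u))‖
        ≤ C * rootInv N ^ 2 * posMean p N β (fun u => ‖φ (u + 2 * rootInv N ^ 2)‖)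
          + C * M * rootInv N ^ 4 := by
  obtain ⟨C, hC, hb⟩ := h.exists_stein_bound E hp hβ hg
  refine ⟨C, hC, fun N hN φ M hM => ?_⟩
  have := hb N hN φ M hM
  rw [rootInv_sq, rootInv_pow_four, mul_one_div, mul_one_div, mul_one_div]
  exact this

/-- Functions that are even for even `p` have nearly the same `mean` and `posMean`. -/
theorem IsPosMaximizer.exists_norm_mean_sub_posMean_le (E : Type*) [NormedAddCommGroup E]
    [NormedSpace ℝ E] (hp : 2 ≤ p) (hβ : 0 ≤ β)
    (hg : ∃ t ∈ Set.Icc (0 : ℝ) 1, 0 < gFun p β t) (h : IsPosMaximizer p β m) :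
    ∃ C, 0 ≤ C ∧ ∀ N : ℕ, N ≠ 0 → ∀ (f : ℝ → E) (M : ℝ),
      (∀ u ∈ Set.Icc (-1 : ℝ) 1, ‖f u‖ ≤ M) → (Even p → ∀ u, f (-u) = f u) →
      ‖mean p N β f - posMean p N β f‖ ≤ C * M * rootInv N ^ 4 := by
  have h0 := h.1
  obtain ⟨C, hC, hb⟩ := h.exists_mean_farSet_le hp hβ hg h0
  refine ⟨C, hC, fun N hN f M hM hf => ?_⟩
  have hM0 : 0 ≤ M := (norm_nonneg _).trans (hM 0 (by constructor <;> norm_num))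
  have hfin : M * mean p N β ((farSet p m m).indicator fun _ => (1 : ℝ))
      ≤ C * M * rootInv N ^ 4 := by
    refine (mul_le_mul_of_nonneg_left (hb N hN) hM0).trans (le_of_eq ?_)
    rw [rootInv_pow_four]; ring
  refine le_trans ?_ hfin
  rw [← mean_mul]
  -- For even `p` symmetry equates the two half-lines and only `u = 0` is miscounted; for odd `p`
  -- the whole of `u ≤ 0` is lost. Both exceptional sets lie at distance at least `m` from the
  -- maximizers.
  rcases Nat.even_or_odd p with he | ho
  · have hsym : mean p N β (fun u => if 0 < u then f u else 0)
        = mean p N β (fun u => if u < 0 then f u else 0) := by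
      rw [← mean_comp_neg (by omega) he hN β (fun u => if u < 0 then f u else 0)]
      congr 1
      funext u
      simp only [Left.neg_neg_iff, hf he u]
    have e1 : posMean p N β f = mean p N β (fun u => if 0 < u then f u else 0)
        + mean p N β (fun u => if u < 0 then f u else 0) := by
      rw [← hsym, ← mean_add]
      unfold posMean posWeight
      congr 1
      funext u
      simp only [he, if_true]
      split_ifs
      · rw [two_smul]
      · simp
    rw [e1, ← mean_add, ← mean_sub]
    refine norm_mean_le fun u hu => ?_
    rcases lt_trichotomy u 0 with hu0 | hu0 | hu0
    · simp only [hu0, not_lt.2 hu0.le, if_true, if_false, zero_add, sub_self, norm_zero]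
      exact mul_nonneg hM0 (Set.indicator_nonneg (fun _ _ => zero_le_one) u)
    · have hmem : u ∈ farSet p m m := by
        refine ⟨?_, fun _ => ?_⟩ <;> simp [hu0, abs_of_pos h0]
      rw [Set.indicator_of_mem hmem, mul_one]
      simpa [hu0] using hM u hu
    · simp only [hu0, not_lt.2 hu0.le, if_true, if_false, add_zero, sub_self, norm_zero]
      exact mul_nonneg hM0 (Set.indicator_nonneg (fun _ _ => zero_le_one) u)
  · unfold posMean posWeight
    rw [← mean_sub]
    refine norm_mean_le fun u hu => ?_
    have hne : ¬ Even p := Nat.not_even_iff_odd.2 ho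
    by_cases hu0 : 0 < u
    · simp only [hu0, hne, if_true, if_false, one_smul, sub_self, norm_zero]
      exact mul_nonneg hM0 (Set.indicator_nonneg (fun _ _ => zero_le_one) u)
    · have hmem : u ∈ farSet p m m := by
        refine ⟨?_, fun he => absurd he hne⟩
        rw [abs_sub_comm]
        exact le_trans (by linarith) (le_abs_self _)
      rw [Set.indicator_of_mem hmem, mul_one]
      simpa [hu0] using hM u hu

theorem IsPosMaximizer.exists_abs_posMean_one_sub_one_le (hp : 2 ≤ p) (hβ : 0 ≤ β)
    (hg : ∃ t ∈ Set.Icc (0 : ℝ) 1, 0 < gFun p β t) (h : IsPosMaximizer p β m) :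
    ∃ C, 0 ≤ C ∧ ∀ N : ℕ, N ≠ 0 →
      |posMean p N β (fun _ => (1 : ℝ)) - 1| ≤ C * rootInv N ^ 4 := by
  obtain ⟨C, hC, hb⟩ := h.exists_norm_mean_sub_posMean_le ℝ hp hβ hg
  refine ⟨C, hC, fun N hN => ?_⟩
  have := hb N hN (fun _ => 1) 1 (by simp) (by simp)
  rwa [mean_const, mul_one, norm_sub_rev, Real.norm_eq_abs] at this

/-- On `u > 0` the distance to `-m` exceeds `m ≥ δ`, so being far from `m` alone already means lying
in `farSet`. -/
theorem IsPosMaximizer.exists_posMean_far_le (hp : 2 ≤ p) (hβ : 0 ≤ β)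
    (hg : ∃ t ∈ Set.Icc (0 : ℝ) 1, 0 < gFun p β t) (h : IsPosMaximizer p β m) {δ : ℝ}
    (hδ : 0 < δ) (hδm : δ ≤ m) :
    ∃ C, 0 ≤ C ∧ ∀ N : ℕ, N ≠ 0 →
      posMean p N β ({u : ℝ | δ ≤ |u - m|}.indicator fun _ => (1 : ℝ)) ≤ C * rootInv N ^ 4 := by
  obtain ⟨C, hC, hb⟩ := h.exists_mean_farSet_le hp hβ hg hδ
  refine ⟨2 * C, by positivity, fun N hN => ?_⟩
  have h1 : posMean p N β ({u : ℝ | δ ≤ |u - m|}.indicator fun _ => (1 : ℝ))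
      ≤ 2 * mean p N β ((farSet p m δ).indicator fun _ => (1 : ℝ)) := by
    rw [← mean_mul]
    refine mean_mono fun u hu => ?_
    by_cases h0 : 0 < u
    · refine mul_le_mul (posWeight_le_two p u) ?_
        (Set.indicator_nonneg (fun _ _ => zero_le_one) u) zero_le_two
      by_cases hmem : u ∈ {u : ℝ | δ ≤ |u - m|}
      · have : u ∈ farSet p m δ :=
          ⟨hmem, fun _ => le_trans (by linarith) (le_abs_self _)⟩
        rw [Set.indicator_of_mem hmem, Set.indicator_of_mem this]
      · rw [Set.indicator_of_notMem hmem]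
        exact Set.indicator_nonneg (fun _ _ => zero_le_one) u
    · simp only [posWeight, h0, if_false, zero_smul]
      exact mul_nonneg zero_le_two (Set.indicator_nonneg (fun _ _ => zero_le_one) u)
  refine h1.trans ((mul_le_mul_of_nonneg_left (hb N hN) zero_le_two).trans (le_of_eq ?_))
  rw [rootInv_pow_four]; ring

theorem exists_abs_upRate_le (p : ℕ) (β : ℝ) :
    ∃ C, 0 ≤ C ∧ ∀ u ∈ Set.Icc (-1 : ℝ) 1, |upRate p β u| ≤ C ∧ |drift p β u| ≤ C := by
  obtain ⟨B, hB⟩ := isCompact_Icc.exists_bound_of_continuousOn (s := Set.Icc (-1 : ℝ) 1)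
    (contDiff_upRate p β).continuous.continuousOn
  obtain ⟨B', hB'⟩ := isCompact_Icc.exists_bound_of_continuousOn (s := Set.Icc (-1 : ℝ) 1)
    (contDiff_drift p β).continuous.continuousOn
  exact ⟨max B B', ((norm_nonneg _).trans (hB 0 (by simp))).trans (le_max_left _ _), fun u hu =>
    ⟨(hB u hu).trans (le_max_left _ _), (hB' u hu).trans (le_max_right _ _)⟩⟩

/-- Coercivity of the drift, for the two test functions `u - m` and `(u - m) |u - m|` that yield the
second and third moments. Near `m` the linear part dominates; elsewhere the indicator term pays for
a bounded loss. -/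
theorem IsPosMaximizer.exists_drift_lower_bound (hs : deriv (deriv (gFun p β)) m < 0)
    (h : IsPosMaximizer p β m) :
    ∃ δ, 0 < δ ∧ δ ≤ m ∧ ∃ c, 0 < c ∧ ∃ C, 0 ≤ C ∧ ∀ u ∈ Set.Ioc (0 : ℝ) 1,
      c * (u - m) ^ 2 ≤ drift p β u * (u - m)
        + C * {u : ℝ | δ ≤ |u - m|}.indicator (fun _ => (1 : ℝ)) u ∧
      c * |u - m| ^ 3 ≤ drift p β u * ((u - m) * |u - m|)
        + C * {u : ℝ | δ ≤ |u - m|}.indicator (fun _ => (1 : ℝ)) u := by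
  have h0 := h.1
  have h1 := h.lt_one
  obtain ⟨C₀, hC₀, hT⟩ := exists_taylor_bound_Icc (contDiff_drift p β) h.hasDerivAt_drift
  obtain ⟨B, hB, hbd⟩ := exists_abs_upRate_le p β
  set a := 2 * (1 + m) * -(deriv (deriv (gFun p β)) m) with ha
  have ha0 : 0 < a := mul_pos (by linarith) (by linarith)
  rw [h.drift_eq] at hT
  -- This radius makes the Taylor error at most half of the linear term; the `+ 1` avoids dividing
  -- by zero. Far from `m`, `a / 2` covers the left side and `B` the drift.
  refine ⟨min m (a / (2 * (C₀ + 1))), lt_min h0 (by positivity), min_le_left _ _, a / 2,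
    by positivity, a / 2 + B, by positivity, fun u hu => ?_⟩
  set δ := min m (a / (2 * (C₀ + 1))) with hδ
  have hu' : u ∈ Set.Icc (-1 : ℝ) 1 := ⟨by linarith [hu.1], hu.2⟩
  have hd1 : |u - m| ≤ 1 := abs_le.2 ⟨by linarith [hu.1], by linarith [hu.2]⟩
  have hd0 := abs_nonneg (u - m)
  by_cases hmem : δ ≤ |u - m|
  · rw [Set.indicator_of_mem (s := {u : ℝ | δ ≤ |u - m|}) hmem, mul_one]
    have hx : ∀ v w : ℝ, |v| ≤ 1 → w ≤ 1 → a / 2 * w ≤ drift p β u * v + (a / 2 + B) := by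
      intro v w hv hw
      have h2 : |drift p β u * v| ≤ B * 1 := by
        rw [abs_mul]
        exact mul_le_mul (hbd u hu').2 hv (abs_nonneg _) hB
      have h3 := (abs_le.1 h2).1
      have h4 : a / 2 * w ≤ a / 2 * 1 := mul_le_mul_of_nonneg_left hw (by positivity)
      linarith
    refine ⟨hx _ _ hd1 ?_, hx _ _ ?_ (pow_le_one₀ hd0 hd1)⟩
    · rw [← sq_abs]; exact pow_le_one₀ hd0 hd1
    · rw [abs_mul, abs_abs]; exact mul_le_one₀ hd1 hd0 hd1
  · have hlt := not_le.1 hmem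
    rw [Set.indicator_of_notMem (s := {u : ℝ | δ ≤ |u - m|}) hmem, mul_zero, add_zero, add_zero]
    have h2 : C₀ * |u - m| ≤ a / 2 := by
      have h3 : |u - m| ≤ a / (2 * (C₀ + 1)) := hlt.le.trans (min_le_right _ _)
      rw [le_div_iff₀ (by positivity)] at h3
      nlinarith
    have h4 : drift p β u * (u - m) ≥ a / 2 * (u - m) ^ 2 := by
      have h5 : |(drift p β u - 0 - a * (u - m)) * (u - m)| ≤ C₀ * |u - m| * (u - m) ^ 2 := by
        rw [abs_mul]
        calc _ ≤ C₀ * (u - m) ^ 2 * |u - m| := mul_le_mul_of_nonneg_right (hT u hu') hd0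
          _ = _ := by ring
      have h6 := (abs_le.1 h5).1
      have h7 : C₀ * |u - m| * (u - m) ^ 2 ≤ a / 2 * (u - m) ^ 2 :=
        mul_le_mul_of_nonneg_right h2 (sq_nonneg _)
      nlinarith
    refine ⟨h4, ?_⟩
    calc a / 2 * |u - m| ^ 3 = (a / 2 * (u - m) ^ 2) * |u - m| := by
          rw [← sq_abs (u - m)]; ring
      _ ≤ drift p β u * (u - m) * |u - m| := mul_le_mul_of_nonneg_right h4 hd0
      _ = _ := by ring

/-- Stein's identity with `φ = u - m`: coercivity bounds the drift side below, and a flip changes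
`φ` by exactly `2 ρ ^ 2`, so the other side is `O(ρ ^ 2)`. -/
theorem IsPosMaximizer.exists_posMean_sq_le (hp : 2 ≤ p) (hβ : 0 ≤ β)
    (hg : ∃ t ∈ Set.Icc (0 : ℝ) 1, 0 < gFun p β t) (hs : deriv (deriv (gFun p β)) m < 0)
    (h : IsPosMaximizer p β m) :
    ∃ C, 0 ≤ C ∧ ∀ N : ℕ, N ≠ 0 →
      posMean p N β (fun u => (u - m) ^ 2) ≤ C * rootInv N ^ 2 := by
  have h0 := h.1
  have h1 := h.lt_one
  obtain ⟨δ, hδ, hδm, c, hc, C₁, hC₁, hlow⟩ := h.exists_drift_lower_bound hs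
  obtain ⟨C₂, hC₂, hfar⟩ := h.exists_posMean_far_le hp hβ hg hδ hδm
  obtain ⟨C₃, hC₃, hst⟩ := h.exists_stein_bound_rootInv ℝ hp hβ hg
  obtain ⟨B, hB, hbd⟩ := exists_abs_upRate_le p β
  refine ⟨(C₁ * C₂ + 6 * C₃ + 4 * C₃ + 4 * B) / c, by positivity, fun N hN => ?_⟩
  set ρ := rootInv N with hρ
  have hρ0 : 0 < ρ := rootInv_pos hN
  have hρ1 : ρ ≤ 1 := rootInv_le_one N
  have h42 : ρ ^ 4 ≤ ρ ^ 2 := rootInv_pow_le hN (by norm_num)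
  have h20 : ρ ^ 2 ≤ 1 := pow_le_one₀ hρ0.le hρ1
  have hS := hst N hN (fun u => u - m) 4 (fun u hu => by
    rw [Real.norm_eq_abs, abs_le]; constructor <;> linarith [hu.1, hu.2])
  simp only [smul_eq_mul, ← hρ] at hS
  have hA : posMean p N β (fun u => ‖u + 2 * ρ ^ 2 - m‖) ≤ 2 * 3 := by
    refine (posMean_mono fun u hu => ?_).trans (posMean_const_le (by norm_num))
    rw [Real.norm_eq_abs, abs_le]
    constructor <;> linarith [hu.1, hu.2, sq_nonneg ρ]
  have hK : posMean p N β (fun u => upRate p β u * (u + 2 * ρ ^ 2 - m - (u - m)))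
      ≤ 2 * (B * (2 * ρ ^ 2)) := by
    refine (posMean_mono fun u hu => ?_).trans (posMean_const_le (by positivity))
    rw [show u + 2 * ρ ^ 2 - m - (u - m) = 2 * ρ ^ 2 by ring]
    exact mul_le_mul_of_nonneg_right
      ((le_abs_self _).trans (hbd u ⟨by linarith [hu.1], hu.2⟩).1) (by positivity)
  have hL : c * posMean p N β (fun u => (u - m) ^ 2) ≤
      posMean p N β (fun u => drift p β u * (u - m)) + C₁ * (C₂ * ρ ^ 4) := by
    refine le_trans ?_ (add_le_add_right (mul_le_mul_of_nonneg_left (hfar N hN) hC₁) _)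
    rw [← posMean_mul, ← posMean_mul, ← posMean_add]
    exact posMean_mono fun u hu => (hlow u hu).1
  have hS' := (abs_le.1 hS).2
  have hA' := mul_le_mul_of_nonneg_left hA (by positivity : 0 ≤ C₃ * ρ ^ 2)
  have h5 : C₁ * (C₂ * ρ ^ 4) ≤ C₁ * (C₂ * ρ ^ 2) := by gcongr
  have h6 : C₃ * 4 * ρ ^ 4 ≤ C₃ * 4 * ρ ^ 2 := by gcongr
  rw [div_mul_eq_mul_div, le_div_iff₀ hc]
  linarith

/-- From the second moment through `2 |u - m| ≤ ρ + (u - m) ^ 2 / ρ`. -/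
theorem IsPosMaximizer.exists_posMean_abs_le (hp : 2 ≤ p) (hβ : 0 ≤ β)
    (hg : ∃ t ∈ Set.Icc (0 : ℝ) 1, 0 < gFun p β t) (hs : deriv (deriv (gFun p β)) m < 0)
    (h : IsPosMaximizer p β m) :
    ∃ C, 0 ≤ C ∧ ∀ N : ℕ, N ≠ 0 →
      posMean p N β (fun u => |u - m|) ≤ C * rootInv N := by
  obtain ⟨C, hC, hsq⟩ := h.exists_posMean_sq_le hp hβ hg hs
  refine ⟨2 + C, by positivity, fun N hN => ?_⟩
  set ρ := rootInv N with hρ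
  have hρ0 : 0 < ρ := rootInv_pos hN
  have h1 : posMean p N β (fun u => |u - m|)
      ≤ posMean p N β (fun _ => ρ) + ρ⁻¹ * posMean p N β (fun u => (u - m) ^ 2) := by
    rw [← posMean_mul, ← posMean_add]
    refine posMean_mono fun u _ => ?_
    have h2 : ρ⁻¹ * (ρ - |u - m|) ^ 2 = ρ - 2 * |u - m| + ρ⁻¹ * (u - m) ^ 2 := by
      rw [← sq_abs (u - m)]; field_simp; ring
    have h3 : 0 ≤ ρ⁻¹ * (ρ - |u - m|) ^ 2 := by positivity
    linarith [abs_nonneg (u - m)]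
  have h4 := mul_le_mul_of_nonneg_left (hsq N hN) (inv_pos.2 hρ0).le
  have h5 : ρ⁻¹ * (C * ρ ^ 2) = C * ρ := by field_simp
  have h6 : posMean p N β (fun _ => ρ) ≤ 2 * ρ := posMean_const_le hρ0.le
  rw [← hρ, h5] at h4
  linarith

theorem abs_mul_abs_sub_le (d k : ℝ) (hk : 0 ≤ k) :
    abs ((d + k) * |d + k| - d * |d|) ≤ 2 * k * |d| + k ^ 2 := by
  have e : (d + k) * |d + k| - d * |d| = k * |d + k| + d * (|d + k| - |d|) := by ring
  have h1 : |d + k| ≤ |d| + k := (abs_add_le d k).trans_eq (by rw [abs_of_nonneg hk])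
  have h2 : abs (|d + k| - |d|) ≤ k := by
    refine (abs_abs_sub_abs_le_abs_sub _ _).trans_eq ?_
    rw [add_sub_cancel_left, abs_of_nonneg hk]
  rw [e]
  refine (abs_add_le _ _).trans ?_
  rw [abs_mul, abs_mul, abs_abs, abs_of_nonneg hk]
  have h3 := mul_le_mul_of_nonneg_left h1 hk
  have h4 := mul_le_mul_of_nonneg_left h2 (abs_nonneg d)
  nlinarith

/-- Stein's identity with `φ = (u - m) |u - m|`: a flip changes `φ` by `O(ρ ^ 2 |u - m| + ρ ^ 4)`,
and the first absolute moment supplies the third factor `ρ`. -/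
theorem IsPosMaximizer.exists_posMean_abs_cube_le (hp : 2 ≤ p) (hβ : 0 ≤ β)
    (hg : ∃ t ∈ Set.Icc (0 : ℝ) 1, 0 < gFun p β t) (hs : deriv (deriv (gFun p β)) m < 0)
    (h : IsPosMaximizer p β m) :
    ∃ C, 0 ≤ C ∧ ∀ N : ℕ, N ≠ 0 →
      posMean p N β (fun u => |u - m| ^ 3) ≤ C * rootInv N ^ 3 := by
  have h0 := h.1
  have h1 := h.lt_one
  obtain ⟨δ, hδ, hδm, c, hc, C₁, hC₁, hlow⟩ := h.exists_drift_lower_bound hs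
  obtain ⟨C₂, hC₂, hfar⟩ := h.exists_posMean_far_le hp hβ hg hδ hδm
  obtain ⟨C₃, hC₃, hst⟩ := h.exists_stein_bound_rootInv ℝ hp hβ hg
  obtain ⟨C₄, hC₄, hsq⟩ := h.exists_posMean_sq_le hp hβ hg hs
  obtain ⟨C₅, hC₅, hab⟩ := h.exists_posMean_abs_le hp hβ hg hs
  obtain ⟨B, hB, hbd⟩ := exists_abs_upRate_le p β
  refine ⟨(C₁ * C₂ + C₃ * (2 * C₄ + 16) + C₃ * 16 + B * (4 * C₅ + 8)) / c,
    by positivity, fun N hN => ?_⟩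
  set ρ := rootInv N with hρ
  have hρ0 : 0 < ρ := rootInv_pos hN
  have h43 : ρ ^ 4 ≤ ρ ^ 3 := rootInv_pow_le hN (by norm_num)
  have h42 : ρ ^ 4 ≤ ρ ^ 2 := rootInv_pow_le hN (by norm_num)
  have hS := hst N hN (fun u => (u - m) * |u - m|) 16 (fun u hu => by
    have : |u - m| ≤ 4 := abs_le.2 ⟨by linarith [hu.1], by linarith [hu.2]⟩
    rw [Real.norm_eq_abs, abs_mul, abs_abs]
    nlinarith [abs_nonneg (u - m)])
  simp only [smul_eq_mul, ← hρ] at hS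
  have hd : ∀ u : ℝ, u + 2 * ρ ^ 2 - m = (u - m) + 2 * ρ ^ 2 := fun u => by ring
  have hA : posMean p N β (fun u => ‖(u + 2 * ρ ^ 2 - m) * |u + 2 * ρ ^ 2 - m|‖)
      ≤ 2 * (C₄ * ρ ^ 2) + 2 * (8 * ρ ^ 4) := by
    have h3 : posMean p N β (fun u => ‖(u + 2 * ρ ^ 2 - m) * |u + 2 * ρ ^ 2 - m|‖)
        ≤ 2 * posMean p N β (fun u => (u - m) ^ 2) + posMean p N β (fun _ => 8 * ρ ^ 4) := by
      rw [← posMean_mul, ← posMean_add]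
      refine posMean_mono fun u _ => ?_
      rw [Real.norm_eq_abs, abs_mul, abs_abs, ← sq, sq_abs, hd]
      nlinarith [sq_nonneg ((u - m) - 2 * ρ ^ 2)]
    have h4 : posMean p N β (fun _ => 8 * ρ ^ 4) ≤ 2 * (8 * ρ ^ 4) :=
      posMean_const_le (by positivity)
    linarith [hsq N hN]
  have hK : posMean p N β (fun u => upRate p β u *
      ((u + 2 * ρ ^ 2 - m) * |u + 2 * ρ ^ 2 - m| - (u - m) * |u - m|))
      ≤ (B * (4 * ρ ^ 2)) * (C₅ * ρ) + 2 * (B * (4 * ρ ^ 4)) := by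
    have h3 : posMean p N β (fun u => upRate p β u *
        ((u + 2 * ρ ^ 2 - m) * |u + 2 * ρ ^ 2 - m| - (u - m) * |u - m|))
        ≤ (B * (4 * ρ ^ 2)) * posMean p N β (fun u => |u - m|)
          + posMean p N β (fun _ => B * (4 * ρ ^ 4)) := by
      rw [← posMean_mul, ← posMean_add]
      refine posMean_mono fun u hu => ?_
      rw [hd]
      calc _ ≤ |upRate p β u * ((u - m + 2 * ρ ^ 2) * |u - m + 2 * ρ ^ 2| - (u - m) * |u - m|)| :=
            le_abs_self _
        _ ≤ B * (2 * (2 * ρ ^ 2) * |u - m| + (2 * ρ ^ 2) ^ 2) := by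
            rw [abs_mul]
            exact mul_le_mul (hbd u ⟨by linarith [hu.1], hu.2⟩).1
              (abs_mul_abs_sub_le _ _ (by positivity)) (abs_nonneg _) hB
        _ = _ := by ring
    have h4 : posMean p N β (fun _ => B * (4 * ρ ^ 4)) ≤ 2 * (B * (4 * ρ ^ 4)) :=
      posMean_const_le (by positivity)
    have h5 := mul_le_mul_of_nonneg_left (hab N hN) (by positivity : 0 ≤ B * (4 * ρ ^ 2))
    linarith
  have hL : c * posMean p N β (fun u => |u - m| ^ 3) ≤
      posMean p N β (fun u => drift p β u * ((u - m) * |u - m|)) + C₁ * (C₂ * ρ ^ 4) := by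
    refine le_trans ?_ (add_le_add_right (mul_le_mul_of_nonneg_left (hfar N hN) hC₁) _)
    rw [← posMean_mul, ← posMean_mul, ← posMean_add]
    exact posMean_mono fun u hu => (hlow u hu).2
  have hS' := (abs_le.1 hS).2
  have hA' := mul_le_mul_of_nonneg_left hA (by positivity : 0 ≤ C₃ * ρ ^ 2)
  have h5 : C₁ * (C₂ * ρ ^ 4) ≤ C₁ * (C₂ * ρ ^ 3) := by gcongr
  have h6 : C₃ * 16 * ρ ^ 4 ≤ C₃ * 16 * ρ ^ 3 := by gcongr
  have h7 : C₃ * ρ ^ 2 * (2 * (C₄ * ρ ^ 2) + 2 * (8 * ρ ^ 4)) ≤ C₃ * (2 * C₄ + 16) * ρ ^ 3 := by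
    calc C₃ * ρ ^ 2 * (2 * (C₄ * ρ ^ 2) + 2 * (8 * ρ ^ 4))
        ≤ C₃ * ρ ^ 2 * (2 * (C₄ * ρ ^ 2) + 2 * (8 * ρ ^ 2)) := by gcongr
      _ = C₃ * (2 * C₄ + 16) * ρ ^ 4 := by ring
      _ ≤ C₃ * (2 * C₄ + 16) * ρ ^ 3 := by gcongr
  have h8 : (B * (4 * ρ ^ 2)) * (C₅ * ρ) + 2 * (B * (4 * ρ ^ 4)) ≤ B * (4 * C₅ + 8) * ρ ^ 3 := by
    calc (B * (4 * ρ ^ 2)) * (C₅ * ρ) + 2 * (B * (4 * ρ ^ 4))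
        ≤ (B * (4 * ρ ^ 2)) * (C₅ * ρ) + 2 * (B * (4 * ρ ^ 3)) := by gcongr
      _ = B * (4 * C₅ + 8) * ρ ^ 3 := by ring
  rw [div_mul_eq_mul_div, le_div_iff₀ hc]
  linarith

/-- With `φ = 1` the jump term vanishes, so the averaged drift is `O(ρ ^ 2)`, and linearizing it
costs a second moment. The bias is thus of smaller order than the fluctuations and drops out of the
variance. -/
theorem IsPosMaximizer.exists_abs_posMean_sub_le (hp : 2 ≤ p) (hβ : 0 ≤ β)
    (hg : ∃ t ∈ Set.Icc (0 : ℝ) 1, 0 < gFun p β t) (hs : deriv (deriv (gFun p β)) m < 0)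
    (h : IsPosMaximizer p β m) :
    ∃ C, 0 ≤ C ∧ ∀ N : ℕ, N ≠ 0 →
      |posMean p N β (fun u => u - m)| ≤ C * rootInv N ^ 2 := by
  have h0 := h.1
  obtain ⟨C₀, hC₀, hT⟩ := exists_taylor_bound_Icc (contDiff_drift p β) h.hasDerivAt_drift
  obtain ⟨C₃, hC₃, hst⟩ := h.exists_stein_bound_rootInv ℝ hp hβ hg
  obtain ⟨C₄, hC₄, hsq⟩ := h.exists_posMean_sq_le hp hβ hg hs
  set a := 2 * (1 + m) * -(deriv (deriv (gFun p β)) m) with ha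
  have ha0 : 0 < a := mul_pos (by linarith) (by linarith)
  rw [h.drift_eq] at hT
  refine ⟨(2 * C₃ + C₃ + C₀ * C₄) / a, by positivity, fun N hN => ?_⟩
  set ρ := rootInv N with hρ
  have h42 : ρ ^ 4 ≤ ρ ^ 2 := rootInv_pow_le hN (by norm_num)
  have hS := hst N hN (fun _ => 1) 1 (by simp)
  simp only [sub_self, mul_zero, norm_one, ← hρ, mul_one, smul_eq_mul] at hS
  have hz : posMean p N β (fun _ => (0 : ℝ)) = 0 := by simp [posMean, mean]
  rw [hz, sub_zero] at hS
  have hone : posMean p N β (fun _ => (1 : ℝ)) ≤ 2 * 1 := posMean_const_le zero_le_one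
  have h3 : |posMean p N β (drift p β) - a * posMean p N β (fun u => u - m)|
      ≤ C₀ * (C₄ * ρ ^ 2) := by
    refine le_trans ?_ (mul_le_mul_of_nonneg_left (hsq N hN) hC₀)
    rw [← posMean_mul, ← posMean_mul, ← posMean_sub, ← Real.norm_eq_abs]
    refine norm_posMean_le fun u hu => ?_
    have := hT u ⟨by linarith [hu.1], hu.2⟩
    rwa [sub_zero] at this
  have h4 : C₃ * ρ ^ 2 * posMean p N β (fun _ => (1 : ℝ)) ≤ C₃ * ρ ^ 2 * (2 * 1) :=
    mul_le_mul_of_nonneg_left hone (by positivity)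
  have h5 : C₃ * ρ ^ 4 ≤ C₃ * ρ ^ 2 := by gcongr
  rw [div_mul_eq_mul_div, le_div_iff₀ ha0, abs_mul_eq_abs_mul_of_pos _ ha0]
  rw [Real.norm_eq_abs] at hS
  have h6 := abs_le.1 hS
  have h7 := abs_le.1 h3
  rw [abs_le]
  constructor <;> linarith [h6.1, h6.2, h7.1, h7.2]

theorem IsPosMaximizer.exists_abs_upRate_sub_le (h : IsPosMaximizer p β m) :
    ∃ C, 0 ≤ C ∧ ∀ u ∈ Set.Ioc (0 : ℝ) 1, |upRate p β u - (1 + m)| ≤ C * |u - m| := by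
  have h0 := h.1
  have h1 := h.lt_one
  obtain ⟨C, hC, hT⟩ := exists_taylor_bound_Icc (contDiff_upRate p β) (hasDerivAt_upRate p β m)
  rw [h.upRate_eq] at hT
  refine ⟨C + |deriv (upRate p β) m|, by positivity, fun u hu => ?_⟩
  have hd1 : |u - m| ≤ 1 := abs_le.2 ⟨by linarith [hu.1], by linarith [hu.2]⟩
  have h2 := hT u ⟨by linarith [hu.1], hu.2⟩
  have h3 : (u - m) ^ 2 ≤ |u - m| := by
    rw [← sq_abs]; nlinarith [abs_nonneg (u - m)]
  calc |upRate p β u - (1 + m)|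
      = |(upRate p β u - (1 + m) - deriv (upRate p β) m * (u - m))
          + deriv (upRate p β) m * (u - m)| := by congr 1; ring
    _ ≤ C * (u - m) ^ 2 + |deriv (upRate p β) m| * |u - m| := by
        refine (abs_add_le _ _).trans (add_le_add h2 (abs_mul _ _).le)
    _ ≤ C * |u - m| + |deriv (upRate p β) m| * |u - m| := by gcongr
    _ = _ := by ring

/-- The case `φ = u - m` again, now with the leading constants: the drift side is `2 (1 + m) s`
times the second moment up to a third moment, and the jump side is `2 (1 + m) ρ ^ 2` up to `O(ρ ^
3)`. -/
theorem IsPosMaximizer.exists_abs_posMean_sq_sub_le (hp : 2 ≤ p) (hβ : 0 ≤ β)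
    (hg : ∃ t ∈ Set.Icc (0 : ℝ) 1, 0 < gFun p β t) (hs : deriv (deriv (gFun p β)) m < 0)
    (h : IsPosMaximizer p β m) :
    ∃ C, 0 ≤ C ∧ ∀ N : ℕ, N ≠ 0 →
      |posMean p N β (fun u => (u - m) ^ 2) - rootInv N ^ 2 / -(deriv (deriv (gFun p β)) m)|
        ≤ C * rootInv N ^ 3 := by
  have h0 := h.1
  have h1 := h.lt_one
  obtain ⟨C₀, hC₀, hT⟩ := exists_taylor_bound_Icc (contDiff_drift p β) h.hasDerivAt_drift
  obtain ⟨C₁, hC₁, hK⟩ := h.exists_abs_upRate_sub_le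
  obtain ⟨C₂, hC₂, hone⟩ := h.exists_abs_posMean_one_sub_one_le hp hβ hg
  obtain ⟨C₃, hC₃, hst⟩ := h.exists_stein_bound_rootInv ℝ hp hβ hg
  obtain ⟨C₅, hC₅, hab⟩ := h.exists_posMean_abs_le hp hβ hg hs
  obtain ⟨C₆, hC₆, hcu⟩ := h.exists_posMean_abs_cube_le hp hβ hg hs
  set s := -(deriv (deriv (gFun p β)) m) with hsdef
  have hs0 : 0 < s := by linarith
  set a := 2 * (1 + m) * s with ha
  have ha0 : 0 < a := by positivity
  rw [h.drift_eq] at hT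
  refine ⟨(C₃ * (C₅ + 4) + C₃ * 4 + C₀ * C₆ + 2 * (C₁ * C₅) + 2 * ((1 + m) * C₂)) / a,
    by positivity, fun N hN => ?_⟩
  set ρ := rootInv N with hρ
  have hρ0 : 0 < ρ := rootInv_pos hN
  have h43 : ρ ^ 4 ≤ ρ ^ 3 := rootInv_pow_le hN (by norm_num)
  have h63 : ρ ^ 6 ≤ ρ ^ 3 := rootInv_pow_le hN (by norm_num)
  have hS := hst N hN (fun u => u - m) 4 (fun u hu => by
    rw [Real.norm_eq_abs, abs_le]; constructor <;> linarith [hu.1, hu.2])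
  simp only [smul_eq_mul, ← hρ] at hS
  have e1 : posMean p N β (fun u => upRate p β u * (u + 2 * ρ ^ 2 - m - (u - m)))
      = 2 * ρ ^ 2 * posMean p N β (upRate p β) := by
    rw [← posMean_mul]; congr 1; funext u; ring
  rw [e1] at hS
  have hA : posMean p N β (fun u => ‖u + 2 * ρ ^ 2 - m‖) ≤ C₅ * ρ + 2 * (2 * ρ ^ 2) := by
    have h3 : posMean p N β (fun u => ‖u + 2 * ρ ^ 2 - m‖)
        ≤ posMean p N β (fun u => |u - m|) + posMean p N β (fun _ => 2 * ρ ^ 2) := by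
      rw [← posMean_add]
      refine posMean_mono fun u _ => ?_
      rw [show u + 2 * ρ ^ 2 - m = (u - m) + 2 * ρ ^ 2 by ring, Real.norm_eq_abs]
      exact (abs_add_le _ _).trans_eq (by rw [abs_of_nonneg (by positivity : 0 ≤ 2 * ρ ^ 2)])
    have h4 : posMean p N β (fun _ => 2 * ρ ^ 2) ≤ 2 * (2 * ρ ^ 2) :=
      posMean_const_le (by positivity)
    linarith [hab N hN]
  have hA' : C₃ * ρ ^ 2 * posMean p N β (fun u => ‖u + 2 * ρ ^ 2 - m‖)
      ≤ C₃ * (C₅ + 4) * ρ ^ 3 := by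
    calc _ ≤ C₃ * ρ ^ 2 * (C₅ * ρ + 2 * (2 * ρ ^ 2)) :=
          mul_le_mul_of_nonneg_left hA (by positivity)
      _ = C₃ * (C₅ * ρ ^ 3 + 4 * ρ ^ 4) := by ring
      _ ≤ C₃ * (C₅ * ρ ^ 3 + 4 * ρ ^ 3) := by gcongr
      _ = _ := by ring
  have h6 : C₃ * 4 * ρ ^ 4 ≤ C₃ * 4 * ρ ^ 3 := by gcongr
  have hG : |posMean p N β (fun u => drift p β u * (u - m))
      - a * posMean p N β (fun u => (u - m) ^ 2)| ≤ C₀ * (C₆ * ρ ^ 3) := by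
    refine le_trans ?_ (mul_le_mul_of_nonneg_left (hcu N hN) hC₀)
    rw [← posMean_mul, ← posMean_mul, ← posMean_sub, ← Real.norm_eq_abs]
    refine norm_posMean_le fun u hu => ?_
    have h3 := hT u ⟨by linarith [hu.1], hu.2⟩
    rw [Real.norm_eq_abs, show drift p β u * (u - m) - a * (u - m) ^ 2
      = (drift p β u - 0 - a * (u - m)) * (u - m) by ring, abs_mul]
    calc _ ≤ C₀ * (u - m) ^ 2 * |u - m| := mul_le_mul_of_nonneg_right h3 (abs_nonneg _)
      _ = C₀ * |u - m| ^ 3 := by rw [← sq_abs (u - m)]; ring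
  have hKm : |posMean p N β (upRate p β) - (1 + m) * posMean p N β (fun _ => (1 : ℝ))|
      ≤ C₁ * (C₅ * ρ) := by
    refine le_trans ?_ (mul_le_mul_of_nonneg_left (hab N hN) hC₁)
    rw [← posMean_mul, ← posMean_mul, ← posMean_sub, ← Real.norm_eq_abs]
    refine norm_posMean_le fun u hu => ?_
    rw [mul_one]
    exact hK u hu
  have h7 : 2 * ρ ^ 2 * |posMean p N β (upRate p β) - (1 + m)|
      ≤ 2 * (C₁ * C₅) * ρ ^ 3 + 2 * ((1 + m) * C₂) * ρ ^ 3 := by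
    have h8 : |posMean p N β (upRate p β) - (1 + m)| ≤ C₁ * (C₅ * ρ) + (1 + m) * (C₂ * ρ ^ 4) := by
      calc |posMean p N β (upRate p β) - (1 + m)|
          = |(posMean p N β (upRate p β) - (1 + m) * posMean p N β (fun _ => (1 : ℝ)))
              + (1 + m) * (posMean p N β (fun _ => (1 : ℝ)) - 1)| := by congr 1; ring
        _ ≤ _ := by
          refine (abs_add_le _ _).trans (add_le_add hKm ?_)
          rw [abs_mul, abs_of_pos (by linarith : 0 < 1 + m)]
          exact mul_le_mul_of_nonneg_left (hone N hN) (by linarith)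
    calc _ ≤ 2 * ρ ^ 2 * (C₁ * (C₅ * ρ) + (1 + m) * (C₂ * ρ ^ 4)) :=
          mul_le_mul_of_nonneg_left h8 (by positivity)
      _ = 2 * (C₁ * C₅) * ρ ^ 3 + 2 * ((1 + m) * C₂) * ρ ^ 6 := by ring
      _ ≤ _ := by gcongr
  have h9 : |2 * ρ ^ 2 * posMean p N β (upRate p β) - 2 * (1 + m) * ρ ^ 2|
      ≤ 2 * (C₁ * C₅) * ρ ^ 3 + 2 * ((1 + m) * C₂) * ρ ^ 3 := by
    refine le_trans (le_of_eq ?_) h7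
    rw [show 2 * ρ ^ 2 * posMean p N β (upRate p β) - 2 * (1 + m) * ρ ^ 2
      = 2 * ρ ^ 2 * (posMean p N β (upRate p β) - (1 + m)) by ring, abs_mul,
      abs_of_nonneg (by positivity : 0 ≤ 2 * ρ ^ 2)]
  have hfin : |a * posMean p N β (fun u => (u - m) ^ 2) - 2 * (1 + m) * ρ ^ 2|
      ≤ (C₃ * (C₅ + 4) + C₃ * 4 + C₀ * C₆ + 2 * (C₁ * C₅) + 2 * ((1 + m) * C₂)) * ρ ^ 3 := by
    rw [Real.norm_eq_abs] at hS
    have i1 := abs_le.1 hS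
    have i2 := abs_le.1 hG
    have i3 := abs_le.1 h9
    rw [abs_le]
    constructor <;> linarith [i1.1, i1.2, i2.1, i2.2, i3.1, i3.2]
  rw [div_mul_eq_mul_div, le_div_iff₀ ha0, abs_mul_eq_abs_mul_of_pos _ ha0]
  refine le_trans (le_of_eq ?_) hfin
  congr 1
  rw [ha]
  field_simp

end Moments

/-! ### Characteristic functions and the limit of the Fisher information -/

/-- The phase `exp (i t (u - m) / ρ)`. -/
noncomputable def phase (m ρ t u : ℝ) : ℂ := Complex.exp (((t * ((u - m) / ρ) : ℝ) : ℂ) * Complex.I)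

theorem norm_phase (m ρ t u : ℝ) : ‖phase m ρ t u‖ = 1 := Complex.norm_exp_ofReal_mul_I _

/-- A flip multiplies the phase by a factor independent of `u`, so the difference in Stein's
identity factors out of the average. -/
theorem phase_add_two_mul_sq {m ρ : ℝ} (hρ : ρ ≠ 0) (t u : ℝ) :
    phase m ρ t (u + 2 * ρ ^ 2)
      = Complex.exp (((2 * t * ρ : ℝ) : ℂ) * Complex.I) * phase m ρ t u := by
  unfold phase
  rw [← Complex.exp_add, ← add_mul, ← Complex.ofReal_add]
  congr 3
  field_simp
  ring

theorem norm_exp_ofReal_mul_I_sub_one_le (x : ℝ) :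
    ‖Complex.exp ((x : ℂ) * Complex.I) - 1‖ ≤ |x| := by
  have := Real.norm_exp_I_mul_ofReal_sub_one_le (x := x)
  rwa [mul_comm, Real.norm_eq_abs] at this

theorem norm_exp_ofReal_mul_I_sub_le (x y : ℝ) :
    ‖Complex.exp ((x : ℂ) * Complex.I) - Complex.exp ((y : ℂ) * Complex.I)‖ ≤ |x - y| := by
  have h : Complex.exp ((x : ℂ) * Complex.I) - Complex.exp ((y : ℂ) * Complex.I)
      = Complex.exp ((y : ℂ) * Complex.I) * (Complex.exp (((x - y : ℝ) : ℂ) * Complex.I) - 1) := by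
    rw [mul_sub, ← Complex.exp_add, mul_one]
    congr 2
    push_cast
    ring
  rw [h, norm_mul, Complex.norm_exp_ofReal_mul_I, one_mul]
  exact norm_exp_ofReal_mul_I_sub_one_le _

theorem norm_exp_ofReal_mul_I_sub_one_sub_le (x : ℝ) :
    ‖Complex.exp ((x : ℂ) * Complex.I) - 1 - (x : ℂ) * Complex.I‖ ≤ 2 * x ^ 2 := by
  have hx : ‖(x : ℂ) * Complex.I‖ = |x| := by simp
  by_cases h : |x| ≤ 1
  · have := Complex.norm_exp_sub_one_sub_id_le (x := (x : ℂ) * Complex.I) (by rwa [hx])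
    rw [hx, sq_abs] at this
    linarith [sq_nonneg x]
  · refine (norm_sub_le _ _).trans ?_
    have := norm_exp_ofReal_mul_I_sub_one_le x
    rw [hx, ← sq_abs]
    nlinarith

section CharFun

variable {p : ℕ} {β m : ℝ}

/-- Stein's identity with the phase as test function, replacing the drift by `a (u - m)`, `upRate`
by `1 + m` and the flip factor minus one by `2 i t ρ`. Division by `a ρ` leaves an error of order
`ρ`. -/
theorem IsPosMaximizer.exists_norm_posMean_phase_le (hp : 2 ≤ p) (hβ : 0 ≤ β)
    (hg : ∃ t ∈ Set.Icc (0 : ℝ) 1, 0 < gFun p β t) (hs : deriv (deriv (gFun p β)) m < 0)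
    (h : IsPosMaximizer p β m) :
    ∃ C, 0 ≤ C ∧ ∀ N : ℕ, N ≠ 0 → ∀ t : ℝ,
      ‖posMean p N β (fun u => (((u - m) / rootInv N : ℝ) : ℂ) * phase m (rootInv N) t u)
        - ((t / -(deriv (deriv (gFun p β)) m) : ℝ) : ℂ) * Complex.I
          * posMean p N β (phase m (rootInv N) t)‖ ≤ C * (1 + t ^ 2) * rootInv N := by
  have h0 := h.1
  have h1 := h.lt_one
  obtain ⟨C₀, hC₀, hT⟩ := exists_taylor_bound_Icc (contDiff_drift p β) h.hasDerivAt_drift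
  obtain ⟨C₁, hC₁, hK⟩ := h.exists_abs_upRate_sub_le
  obtain ⟨C₃, hC₃, hst⟩ := h.exists_stein_bound_rootInv ℂ hp hβ hg
  obtain ⟨C₄, hC₄, hsq⟩ := h.exists_posMean_sq_le hp hβ hg hs
  obtain ⟨C₅, hC₅, hab⟩ := h.exists_posMean_abs_le hp hβ hg hs
  set s := -(deriv (deriv (gFun p β)) m) with hsdef
  have hs0 : 0 < s := by linarith
  set a := 2 * (1 + m) * s with ha
  have ha0 : 0 < a := by positivity
  rw [h.drift_eq] at hT
  refine ⟨(3 * C₃ + C₀ * C₄ + C₁ * C₅ + 16 * (1 + m)) / a, by positivity, fun N hN t => ?_⟩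
  set ρ := rootInv N with hρ
  have hρ0 : 0 < ρ := rootInv_pos hN
  have h42 : ρ ^ 4 ≤ ρ ^ 2 := rootInv_pow_le hN (by norm_num)
  set φ := phase m ρ t with hφ
  have hφ1 : ∀ u, ‖φ u‖ = 1 := fun u => norm_phase m ρ t u
  set w := Complex.exp (((2 * t * ρ : ℝ) : ℂ) * Complex.I) with hw
  have hS := hst N hN φ 1 (fun u _ => (hφ1 u).le)
  simp only [← hρ, hφ1, mul_one] at hS
  have e1 : posMean p N β (fun u => upRate p β u • (φ (u + 2 * ρ ^ 2) - φ u))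
      = (w - 1) * posMean p N β (fun u => upRate p β u • φ u) := by
    rw [← posMean_mul_complex]
    congr 1
    funext u
    rw [hφ, phase_add_two_mul_sq hρ0.ne', Complex.real_smul, Complex.real_smul]
    ring
  rw [e1] at hS
  have hone : posMean p N β (fun _ => (1 : ℝ)) ≤ 2 * 1 := posMean_const_le zero_le_one
  have hS2 : ‖posMean p N β (fun u => drift p β u • φ u)
      - (w - 1) * posMean p N β (fun u => upRate p β u • φ u)‖ ≤ 3 * C₃ * ρ ^ 2 := by
    have h4 : C₃ * ρ ^ 2 * posMean p N β (fun _ => (1 : ℝ)) ≤ C₃ * ρ ^ 2 * (2 * 1) :=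
      mul_le_mul_of_nonneg_left hone (by positivity)
    have h5 : C₃ * ρ ^ 4 ≤ C₃ * ρ ^ 2 := by gcongr
    linarith
  have hG : ‖posMean p N β (fun u => drift p β u • φ u)
      - (a : ℂ) * posMean p N β (fun u => ((u - m : ℝ) : ℂ) * φ u)‖ ≤ C₀ * (C₄ * ρ ^ 2) := by
    refine le_trans ?_ (mul_le_mul_of_nonneg_left (hsq N hN) hC₀)
    rw [← posMean_mul, ← posMean_mul_complex, ← posMean_sub]
    refine norm_posMean_le fun u hu => ?_
    have h3 := hT u ⟨by linarith [hu.1], hu.2⟩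
    have e : drift p β u • φ u - (a : ℂ) * (((u - m : ℝ) : ℂ) * φ u)
        = ((drift p β u - 0 - a * (u - m) : ℝ) : ℂ) * φ u := by
      rw [Complex.real_smul]; push_cast; ring
    rw [e, norm_mul, hφ1, mul_one, Complex.norm_real]
    exact h3
  have hKm : ‖posMean p N β (fun u => upRate p β u • φ u) - ((1 + m : ℝ) : ℂ) * posMean p N β φ‖
      ≤ C₁ * (C₅ * ρ) := by
    refine le_trans ?_ (mul_le_mul_of_nonneg_left (hab N hN) hC₁)
    rw [← posMean_mul, ← posMean_mul_complex, ← posMean_sub]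
    refine norm_posMean_le fun u hu => ?_
    have e : upRate p β u • φ u - ((1 + m : ℝ) : ℂ) * φ u
        = ((upRate p β u - (1 + m) : ℝ) : ℂ) * φ u := by
      rw [Complex.real_smul]; push_cast; ring
    rw [e, norm_mul, hφ1, mul_one, Complex.norm_real]
    exact hK u hu
  have hψ : ‖posMean p N β φ‖ ≤ 2 := by
    refine (norm_posMean_le (g := fun _ => (1 : ℝ)) fun u _ => (hφ1 u).le).trans (hone.trans ?_)
    norm_num
  have hw1 : ‖w - 1‖ ≤ 2 * |t| * ρ := by
    refine (norm_exp_ofReal_mul_I_sub_one_le _).trans_eq ?_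
    rw [abs_mul, abs_mul, abs_of_pos hρ0, abs_two]
  have hw2 : ‖w - 1 - ((2 * t * ρ : ℝ) : ℂ) * Complex.I‖ ≤ 8 * t ^ 2 * ρ ^ 2 := by
    refine (norm_exp_ofReal_mul_I_sub_one_sub_le _).trans_eq ?_
    ring
  have hmain : ‖(a : ℂ) * posMean p N β (fun u => ((u - m : ℝ) : ℂ) * φ u)
      - ((2 * t * ρ : ℝ) : ℂ) * Complex.I * ((1 + m : ℝ) : ℂ) * posMean p N β φ‖
      ≤ (3 * C₃ + C₀ * C₄ + C₁ * C₅ + 16 * (1 + m)) * (1 + t ^ 2) * ρ ^ 2 := by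
    set X := posMean p N β (fun u => drift p β u • φ u)
    set Y := posMean p N β (fun u => upRate p β u • φ u)
    set D := posMean p N β (fun u => ((u - m : ℝ) : ℂ) * φ u)
    set Ψ := posMean p N β φ
    -- The four summands are the errors of linearizing the drift, of Stein's identity, of freezing
    -- `upRate` at `m`, and of expanding `w`.
    have e : (a : ℂ) * D - ((2 * t * ρ : ℝ) : ℂ) * Complex.I * ((1 + m : ℝ) : ℂ) * Ψ
        = -(X - a * D) + (X - (w - 1) * Y) + (w - 1) * (Y - ((1 + m : ℝ) : ℂ) * Ψ)
          + (w - 1 - ((2 * t * ρ : ℝ) : ℂ) * Complex.I) * ((1 + m : ℝ) : ℂ) * Ψ := by ring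
    rw [e]
    have i3 : ‖(w - 1) * (Y - ((1 + m : ℝ) : ℂ) * Ψ)‖ ≤ (2 * |t| * ρ) * (C₁ * (C₅ * ρ)) := by
      rw [norm_mul]
      exact mul_le_mul hw1 hKm (norm_nonneg _) (by positivity)
    have i4 : ‖(w - 1 - ((2 * t * ρ : ℝ) : ℂ) * Complex.I) * ((1 + m : ℝ) : ℂ) * Ψ‖
        ≤ (8 * t ^ 2 * ρ ^ 2) * (1 + m) * 2 := by
      rw [norm_mul, norm_mul, Complex.norm_real, Real.norm_of_nonneg (by linarith : 0 ≤ 1 + m)]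
      gcongr
    have i5 := norm_add_le (-(X - a * D) + (X - (w - 1) * Y) + (w - 1) * (Y - ((1 + m : ℝ) : ℂ) * Ψ))
      ((w - 1 - ((2 * t * ρ : ℝ) : ℂ) * Complex.I) * ((1 + m : ℝ) : ℂ) * Ψ)
    have i6 := norm_add_le (-(X - a * D) + (X - (w - 1) * Y)) ((w - 1) * (Y - ((1 + m : ℝ) : ℂ) * Ψ))
    have i7 := norm_add_le (-(X - a * D)) (X - (w - 1) * Y)
    rw [norm_neg] at i7
    have h2t : 2 * |t| ≤ 1 + t ^ 2 := by nlinarith [sq_nonneg (1 - |t|), sq_abs t]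
    have i8 : (2 * |t| * ρ) * (C₁ * (C₅ * ρ)) ≤ C₁ * C₅ * (1 + t ^ 2) * ρ ^ 2 := by
      calc _ = (2 * |t|) * (C₁ * C₅ * ρ ^ 2) := by ring
        _ ≤ (1 + t ^ 2) * (C₁ * C₅ * ρ ^ 2) := by gcongr
        _ = _ := by ring
    have i9 : 0 ≤ 16 * (1 + m) * ρ ^ 2 := by positivity
    have i10 : 0 ≤ (3 * C₃ + C₀ * C₄) * t ^ 2 * ρ ^ 2 := by positivity
    calc _ ≤ C₀ * (C₄ * ρ ^ 2) + 3 * C₃ * ρ ^ 2 + C₁ * C₅ * (1 + t ^ 2) * ρ ^ 2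
          + (8 * t ^ 2 * ρ ^ 2) * (1 + m) * 2 := by linarith
      _ ≤ _ := by linarith
  have e2 : posMean p N β (fun u => (((u - m) / ρ : ℝ) : ℂ) * φ u)
      = ((ρ⁻¹ : ℝ) : ℂ) * posMean p N β (fun u => ((u - m : ℝ) : ℂ) * φ u) := by
    rw [← posMean_mul_complex]
    congr 1
    funext u
    push_cast
    ring
  have haC : (a : ℂ) ≠ 0 := Complex.ofReal_ne_zero.2 ha0.ne'
  have hρC : (ρ : ℂ) ≠ 0 := Complex.ofReal_ne_zero.2 hρ0.ne'
  have hsC : (s : ℂ) ≠ 0 := Complex.ofReal_ne_zero.2 hs0.ne'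
  have e3 : posMean p N β (fun u => (((u - m) / ρ : ℝ) : ℂ) * φ u)
        - ((t / s : ℝ) : ℂ) * Complex.I * posMean p N β φ
      = (((a * ρ)⁻¹ : ℝ) : ℂ) * ((a : ℂ) * posMean p N β (fun u => ((u - m : ℝ) : ℂ) * φ u)
      - ((2 * t * ρ : ℝ) : ℂ) * Complex.I * ((1 + m : ℝ) : ℂ) * posMean p N β φ) := by
    have e4 : t / s = (a * ρ)⁻¹ * (2 * t * ρ) * (1 + m) := by
      rw [ha]; field_simp
    rw [e2, e4, mul_sub]
    push_cast
    field_simp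
  rw [e3, norm_mul, Complex.norm_real, Real.norm_of_nonneg (by positivity)]
  refine (mul_le_mul_of_nonneg_left hmain (by positivity)).trans (le_of_eq ?_)
  field_simp

theorem hasDerivAt_posMean_phase (p N : ℕ) (β m ρ t : ℝ) :
    HasDerivAt (fun t => posMean p N β (phase m ρ t))
      (Complex.I * posMean p N β (fun u => (((u - m) / ρ : ℝ) : ℂ) * phase m ρ t u)) t := by
  rw [← posMean_mul_complex]
  unfold posMean mean
  refine HasDerivAt.fun_sum fun x _ => HasDerivAt.fun_const_smul _ (HasDerivAt.fun_const_smul _ ?_)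
  unfold phase
  have h1 : HasDerivAt (fun t : ℝ => ((t * ((mag x - m) / ρ) : ℝ) : ℂ) * Complex.I)
      ((((mag x - m) / ρ : ℝ) : ℂ) * Complex.I) t := by
    have := (((hasDerivAt_id' t).mul_const ((mag x - m) / ρ)).ofReal_comp).mul_const Complex.I
    simpa using this
  convert! h1.cexp using 1
  ring

/-- The approximate equation `ψ' = -(t / s) ψ` is integrated with the factor `exp (t ^ 2 / (2 s))`:
the product has derivative `O(ρ)` on `[-|t|, |t|]`, so it stays close to its value at `0`, which
tends to `1`. -/
theorem IsPosMaximizer.tendsto_posMean_phase (hp : 2 ≤ p) (hβ : 0 ≤ β)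
    (hg : ∃ t ∈ Set.Icc (0 : ℝ) 1, 0 < gFun p β t) (hs : deriv (deriv (gFun p β)) m < 0)
    (h : IsPosMaximizer p β m) (t : ℝ) :
    Tendsto (fun N => posMean p N β (phase m (rootInv N) t)) atTop
      (𝓝 ((Real.exp (-(t ^ 2 / (2 * -(deriv (deriv (gFun p β)) m)))) : ℝ) : ℂ)) := by
  obtain ⟨C, hC, hb⟩ := h.exists_norm_posMean_phase_le hp hβ hg hs
  obtain ⟨C₂, hC₂, hone⟩ := h.exists_abs_posMean_one_sub_one_le hp hβ hg
  set s := -(deriv (deriv (gFun p β)) m) with hsdef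
  have hs0 : 0 < s := by linarith
  set E : ℝ → ℝ := fun x => Real.exp (x ^ 2 / (2 * s)) with hE
  have hEder : ∀ x, HasDerivAt (fun x => ((E x : ℝ) : ℂ)) ((E x * (x / s) : ℝ) : ℂ) x := by
    intro x
    have h1 : HasDerivAt E (E x * (x / s)) x := by
      have := ((hasDerivAt_pow 2 x).div_const (2 * s)).exp
      convert! this using 1
      simp only [hE]
      field_simp
      norm_num
      ring
    exact h1.ofReal_comp
  have hbound : ∀ N : ℕ, N ≠ 0 → ‖posMean p N β (phase m (rootInv N) t) * (E t : ℂ)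
      - posMean p N β (phase m (rootInv N) 0) * (E 0 : ℂ)‖
      ≤ (C * (1 + t ^ 2) * E t * |t|) * rootInv N := by
    intro N hN
    have hρ0 := rootInv_pos hN
    have hder : ∀ x, HasDerivAt (fun x => posMean p N β (phase m (rootInv N) x) * (E x : ℂ))
        ((Complex.I * posMean p N β (fun u => (((u - m) / rootInv N : ℝ) : ℂ)
          * phase m (rootInv N) x u)) * (E x : ℂ)
          + posMean p N β (phase m (rootInv N) x) * ((E x * (x / s) : ℝ) : ℂ)) x :=
      fun x => (hasDerivAt_posMean_phase p N β m (rootInv N) x).fun_mul (hEder x)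
    have hmv := (convex_closedBall (0 : ℝ) |t|).norm_image_sub_le_of_norm_hasDerivWithin_le
      (C := C * (1 + t ^ 2) * rootInv N * E t) (x := 0) (y := t)
      (fun x _ => (hder x).hasDerivWithinAt) ?_ (by simp) (by simp)
    · refine hmv.trans_eq ?_
      rw [sub_zero, Real.norm_eq_abs]
      ring
    · intro x hx
      rw [mem_closedBall_zero_iff, Real.norm_eq_abs] at hx
      have hx2 : x ^ 2 ≤ t ^ 2 := sq_le_sq.2 hx
      have e : (Complex.I * posMean p N β (fun u => (((u - m) / rootInv N : ℝ) : ℂ)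
          * phase m (rootInv N) x u)) * (E x : ℂ)
          + posMean p N β (phase m (rootInv N) x) * ((E x * (x / s) : ℝ) : ℂ)
          = Complex.I * (posMean p N β (fun u => (((u - m) / rootInv N : ℝ) : ℂ)
          * phase m (rootInv N) x u) - ((x / s : ℝ) : ℂ) * Complex.I
          * posMean p N β (phase m (rootInv N) x)) * (E x : ℂ) := by
        push_cast
        linear_combination ((x : ℂ) / s * posMean p N β (phase m (rootInv N) x) * E x)
          * Complex.I_mul_I
      rw [e, norm_mul, norm_mul, Complex.norm_I, one_mul, Complex.norm_real,
        Real.norm_of_nonneg (Real.exp_pos _).le]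
      have h2 : E x ≤ E t := by
        refine Real.exp_le_exp.2 ?_
        gcongr
      have h3 : C * (1 + x ^ 2) * rootInv N ≤ C * (1 + t ^ 2) * rootInv N := by gcongr
      exact mul_le_mul ((hb N hN x).trans h3) h2 (Real.exp_pos _).le (by positivity)
  have hzero : Tendsto (fun N => posMean p N β (phase m (rootInv N) 0) * (E 0 : ℂ)) atTop
      (𝓝 1) := by
    have e : ∀ N, posMean p N β (phase m (rootInv N) 0) * (E 0 : ℂ)
        = ((posMean p N β (fun _ => (1 : ℝ)) : ℝ) : ℂ) := by
      intro N
      have h1 : E 0 = 1 := by simp [hE]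
      rw [h1, Complex.ofReal_one, mul_one]
      unfold posMean mean
      push_cast
      refine Finset.sum_congr rfl fun x _ => ?_
      simp [phase]
    simp_rw [e]
    rw [← Complex.ofReal_one]
    refine (Complex.continuous_ofReal.tendsto _).comp ?_
    rw [tendsto_iff_norm_sub_tendsto_zero]
    have hlim : Tendsto (fun N => C₂ * rootInv N ^ 4) atTop (𝓝 0) := by
      have := (tendsto_rootInv.pow 4).const_mul C₂
      simpa using this
    refine squeeze_zero' (Eventually.of_forall fun N => norm_nonneg _) ?_ hlim
    filter_upwards [eventually_ne_atTop 0] with N hN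
    exact hone N hN
  have hdiff : Tendsto (fun N => posMean p N β (phase m (rootInv N) t) * (E t : ℂ)
      - posMean p N β (phase m (rootInv N) 0) * (E 0 : ℂ)) atTop (𝓝 0) := by
    rw [tendsto_zero_iff_norm_tendsto_zero]
    have hlim : Tendsto (fun N => (C * (1 + t ^ 2) * E t * |t|) * rootInv N) atTop (𝓝 0) := by
      simpa using tendsto_rootInv.const_mul (C * (1 + t ^ 2) * E t * |t|)
    refine squeeze_zero' (Eventually.of_forall fun N => norm_nonneg _) ?_ hlim
    filter_upwards [eventually_ne_atTop 0] with N hN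
    exact hbound N hN
  have hprod := (hdiff.add hzero).mul_const (((Real.exp (-(t ^ 2 / (2 * s)))) : ℝ) : ℂ)
  simp only [sub_add_cancel, zero_add, one_mul] at hprod
  refine hprod.congr fun N => ?_
  rw [mul_assoc, ← Complex.ofReal_mul]
  have : E t * Real.exp (-(t ^ 2 / (2 * s))) = 1 := by
    rw [hE, ← Real.exp_add, add_neg_cancel, Real.exp_zero]
  rw [this, Complex.ofReal_one, mul_one]

/-- The limit of the Fisher information. -/
theorem IsPosMaximizer.tendsto_fisherInfo (hp : 2 ≤ p) (hβ : 0 ≤ β)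
    (hg : ∃ t ∈ Set.Icc (0 : ℝ) 1, 0 < gFun p β t) (hs : deriv (deriv (gFun p β)) m < 0)
    (h : IsPosMaximizer p β m) :
    Tendsto (fun N => fisherInfo (cwTensor p N) β) atTop
      (𝓝 ((p * m ^ (p - 1)) ^ 2 / -(deriv (deriv (gFun p β)) m))) := by
  have h0 := h.1
  have h1 := h.lt_one
  have hm1 : |m| ≤ 1 := abs_le.2 ⟨by linarith, h1.le⟩
  obtain ⟨C₁, hC₁, hfold⟩ := h.exists_norm_mean_sub_posMean_le ℝ hp hβ hg
  obtain ⟨C₂, hC₂, hvar⟩ := h.exists_abs_posMean_sq_sub_le hp hβ hg hs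
  obtain ⟨C₃, hC₃, hmean⟩ := h.exists_abs_posMean_sub_le hp hβ hg hs
  obtain ⟨C₄, hC₄, hsq⟩ := h.exists_posMean_sq_le hp hβ hg hs
  obtain ⟨C₆, hC₆, hcu⟩ := h.exists_posMean_abs_cube_le hp hβ hg hs
  set s := -(deriv (deriv (gFun p β)) m) with hsdef
  have hs0 : 0 < s := by linarith
  set b := p * m ^ (p - 1) with hb
  have hb0 : 0 ≤ b := by positivity
  set K : ℝ := p ^ 2 * 3 ^ p with hKdef
  have hK0 : 0 ≤ K := by positivity
  have hT : ∀ u : ℝ, |u| ≤ 1 → |u ^ p - m ^ p - b * (u - m)| ≤ K * (u - m) ^ 2 := fun u hu =>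
    abs_pow_sub_le (hu.trans (by norm_num)) (hm1.trans (by norm_num)) p
  have hpow1 : ∀ u : ℝ, |u| ≤ 1 → |u ^ p - m ^ p| ≤ 2 := fun u hu => by
    have h2 : |u ^ p| ≤ 1 := by rw [abs_pow]; exact pow_le_one₀ (abs_nonneg u) hu
    have h3 : |m ^ p| ≤ 1 := by rw [abs_pow]; exact pow_le_one₀ (abs_nonneg m) hm1
    exact (abs_sub _ _).trans (by linarith)
  have habs : ∀ u ∈ Set.Icc (-1 : ℝ) 1, |u| ≤ 1 := fun u hu => abs_le.2 hu
  have hd1 : ∀ u ∈ Set.Ioc (0 : ℝ) 1, |u - m| ≤ 1 := fun u hu =>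
    abs_le.2 ⟨by linarith [hu.1], by linarith [hu.2]⟩
  -- The mean of `u ^ p - m ^ p` is `O(ρ ^ 2)`, so its square contributes only `O(ρ ^ 2)` after
  -- multiplication by `N`.
  have hM1 : ∀ N : ℕ, N ≠ 0 → |mean p N β (fun u => u ^ p - m ^ p)|
      ≤ (C₁ * 2 + K * C₄ + b * C₃) * rootInv N ^ 2 := by
    intro N hN
    have h42 : rootInv N ^ 4 ≤ rootInv N ^ 2 := rootInv_pow_le hN (by norm_num)
    have i1 := hfold N hN (fun u => u ^ p - m ^ p) 2 (fun u hu => hpow1 u (habs u hu))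
      (fun he u => by rw [he.neg_pow])
    have i2 : |posMean p N β (fun u => u ^ p - m ^ p) - b * posMean p N β (fun u => u - m)|
        ≤ K * (C₄ * rootInv N ^ 2) := by
      refine le_trans ?_ (mul_le_mul_of_nonneg_left (hsq N hN) hK0)
      rw [← posMean_mul, ← posMean_mul, ← posMean_sub, ← Real.norm_eq_abs]
      exact norm_posMean_le fun u hu => hT u (habs u ⟨by linarith [hu.1], hu.2⟩)
    have i3 : |b * posMean p N β (fun u => u - m)| ≤ b * (C₃ * rootInv N ^ 2) := by
      rw [abs_mul, abs_of_nonneg hb0]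
      exact mul_le_mul_of_nonneg_left (hmean N hN) hb0
    have i4 : C₁ * 2 * rootInv N ^ 4 ≤ C₁ * 2 * rootInv N ^ 2 := by gcongr
    rw [Real.norm_eq_abs] at i1
    have j1 := abs_le.1 i1
    have j2 := abs_le.1 i2
    have j3 := abs_le.1 i3
    rw [abs_le]
    constructor <;> linarith [j1.1, j1.2, j2.1, j2.2, j3.1, j3.2]
  -- Replacing `u ^ p - m ^ p` by `b (u - m)` in the square costs a third absolute moment, hence
  -- `O(ρ ^ 3)`.
  have hM2 : ∀ N : ℕ, N ≠ 0 → |mean p N β (fun u => (u ^ p - m ^ p) ^ 2) - b ^ 2 / s * rootInv N ^ 2|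
      ≤ (C₁ * 4 + (K * (K + 2 * b)) * C₆ + b ^ 2 * C₂) * rootInv N ^ 3 := by
    intro N hN
    have h43 : rootInv N ^ 4 ≤ rootInv N ^ 3 := rootInv_pow_le hN (by norm_num)
    have i1 := hfold N hN (fun u => (u ^ p - m ^ p) ^ 2) 4 (fun u hu => by
      rw [Real.norm_eq_abs, abs_pow]
      nlinarith [hpow1 u (habs u hu), abs_nonneg (u ^ p - m ^ p)])
      (fun he u => by rw [he.neg_pow])
    have i2 : |posMean p N β (fun u => (u ^ p - m ^ p) ^ 2)
        - b ^ 2 * posMean p N β (fun u => (u - m) ^ 2)|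
        ≤ (K * (K + 2 * b)) * (C₆ * rootInv N ^ 3) := by
      refine le_trans ?_ (mul_le_mul_of_nonneg_left (hcu N hN) (by positivity))
      rw [← posMean_mul, ← posMean_mul, ← posMean_sub, ← Real.norm_eq_abs]
      refine norm_posMean_le fun u hu => ?_
      have k1 := hT u (habs u ⟨by linarith [hu.1], hu.2⟩)
      have k2 := hd1 u hu
      have k0 := abs_nonneg (u - m)
      have k3 : |u ^ p - m ^ p - b * (u - m)| ≤ K * |u - m| := by
        refine k1.trans (mul_le_mul_of_nonneg_left ?_ hK0)
        rw [← sq_abs]; nlinarith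
      have k4 : |u ^ p - m ^ p + b * (u - m)| ≤ (K + 2 * b) * |u - m| := by
        calc |u ^ p - m ^ p + b * (u - m)|
            = |(u ^ p - m ^ p - b * (u - m)) + 2 * b * (u - m)| := by congr 1; ring
          _ ≤ K * |u - m| + 2 * b * |u - m| := by
              refine (abs_add_le _ _).trans (add_le_add k3 ?_)
              rw [abs_mul, abs_of_nonneg (by positivity : 0 ≤ 2 * b)]
          _ = _ := by ring
      rw [Real.norm_eq_abs, show (u ^ p - m ^ p) ^ 2 - b ^ 2 * (u - m) ^ 2
        = (u ^ p - m ^ p - b * (u - m)) * (u ^ p - m ^ p + b * (u - m)) by ring, abs_mul]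
      calc _ ≤ (K * (u - m) ^ 2) * ((K + 2 * b) * |u - m|) :=
            mul_le_mul k1 k4 (abs_nonneg _) (by positivity)
        _ = _ := by rw [← sq_abs (u - m)]; ring
    have i3 : |b ^ 2 * posMean p N β (fun u => (u - m) ^ 2) - b ^ 2 / s * rootInv N ^ 2|
        ≤ b ^ 2 * (C₂ * rootInv N ^ 3) := by
      rw [show b ^ 2 * posMean p N β (fun u => (u - m) ^ 2) - b ^ 2 / s * rootInv N ^ 2
        = b ^ 2 * (posMean p N β (fun u => (u - m) ^ 2) - rootInv N ^ 2 / s) by ring, abs_mul,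
        abs_of_nonneg (by positivity : 0 ≤ b ^ 2)]
      exact mul_le_mul_of_nonneg_left (hvar N hN) (by positivity)
    have i4 : C₁ * 4 * rootInv N ^ 4 ≤ C₁ * 4 * rootInv N ^ 3 := by gcongr
    rw [Real.norm_eq_abs] at i1
    have j1 := abs_le.1 i1
    have j2 := abs_le.1 i2
    have j3 := abs_le.1 i3
    rw [abs_le]
    constructor <;> linarith [j1.1, j1.2, j2.1, j2.2, j3.1, j3.2]
  set A := C₁ * 4 + (K * (K + 2 * b)) * C₆ + b ^ 2 * C₂
  set B := C₁ * 2 + K * C₄ + b * C₃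
  rw [tendsto_iff_norm_sub_tendsto_zero]
  have hlim : Tendsto (fun N => A * rootInv N + B ^ 2 * rootInv N ^ 2) atTop (𝓝 0) := by
    have := (tendsto_rootInv.const_mul A).add ((tendsto_rootInv.pow 2).const_mul (B ^ 2))
    simpa using this
  refine squeeze_zero' (Eventually.of_forall fun N => norm_nonneg _) ?_ hlim
  filter_upwards [eventually_ne_atTop 0] with N hN
  rw [fisherInfo_cwTensor (by omega) hN β (m ^ p)]
  have hρ0 := rootInv_pos hN
  set ρ := rootInv N with hρ
  have hNρ : (N : ℝ) = (ρ ^ 2)⁻¹ := by rw [hρ, rootInv_sq, one_div, inv_inv]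
  have i1 := hM2 N hN
  have i2 := hM1 N hN
  rw [← hρ] at i1 i2
  set X := mean p N β (fun u => (u ^ p - m ^ p) ^ 2)
  set Y := mean p N β (fun u => u ^ p - m ^ p)
  have e : (N : ℝ) * (X - Y ^ 2) - b ^ 2 / s
      = (ρ ^ 2)⁻¹ * (X - b ^ 2 / s * ρ ^ 2) - (ρ ^ 2)⁻¹ * Y ^ 2 := by
    rw [hNρ]; field_simp; ring
  rw [e, Real.norm_eq_abs]
  refine (abs_sub _ _).trans ?_
  rw [abs_mul, abs_mul, abs_of_pos (by positivity : 0 < (ρ ^ 2)⁻¹), abs_pow]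
  have i3 : |Y| ^ 2 ≤ (B * ρ ^ 2) ^ 2 := pow_le_pow_left₀ (abs_nonneg _) i2 2
  calc _ ≤ (ρ ^ 2)⁻¹ * (A * ρ ^ 3) + (ρ ^ 2)⁻¹ * (B * ρ ^ 2) ^ 2 := by gcongr
    _ = _ := by field_simp

end CharFun

/-! ### The delta method and convergence of the estimator -/

/-- The value of the maximum pseudo-likelihood estimate at magnetization `u`. -/
noncomputable def estFun (p : ℕ) (u : ℝ) : ℝ := Real.artanh u / (p * u ^ (p - 1))

theorem hasDerivAt_estFun (p : ℕ) {u : ℝ} (h0 : 0 < u) (h1 : u < 1) :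
    HasDerivAt (estFun p) (slopeAux (p - 1) u / u ^ (p - 1 + 1) / p) u := by
  have := (hasDerivAt_artanh_div_pow (p - 1) h0 h1).div_const (p : ℝ)
  convert! this using 1
  funext v
  rw [estFun, div_div, mul_comm]

theorem contDiffAt_estFun {p : ℕ} (hp : p ≠ 0) {u : ℝ} (h0 : 0 < u) (h1 : u < 1) :
    ContDiffAt ℝ 2 (estFun p) u := by
  have he : estFun p =ᶠ[𝓝 u] fun v => ((Real.log (1 + v) - Real.log (1 - v)) / 2)
      / (p * v ^ (p - 1)) := by
    filter_upwards [Ioo_mem_nhds h0 h1] with v hv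
    rw [estFun, artanh_eq_log_sub_log (by linarith [hv.1]) hv.2]
  refine ContDiffAt.congr_of_eventuallyEq ?_ he
  have hp' : (p : ℝ) ≠ 0 := Nat.cast_ne_zero.2 hp
  refine ContDiffAt.div (ContDiffAt.div_const (ContDiffAt.sub ?_ ?_) _) (by fun_prop)
    (mul_ne_zero hp' (pow_ne_zero _ h0.ne'))
  · exact ContDiffAt.log (by fun_prop) (by linarith)
  · exact ContDiffAt.log (by fun_prop) (by linarith)

/-- The estimate at magnetization `u`, replaced by `β` away from `±m`. -/
noncomputable def truncEst (p : ℕ) (β m δ u : ℝ) : ℝ :=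
  if abs (|u| - m) < δ then estFun p |u| else β

theorem IsPosMaximizer.estFun_eq {p : ℕ} {β m : ℝ} (hp : p ≠ 0) (h : IsPosMaximizer p β m) :
    estFun p m = β := by
  have h0 := h.1
  have hp' : (p : ℝ) ≠ 0 := Nat.cast_ne_zero.2 hp
  rw [estFun, h.artanh_eq]
  field_simp

/-- Delta method for characteristic functions: near `m` the Taylor error changes the phase by at
most `|t| C (u - m) ^ 2 / ρ`, of mean `O(ρ)`; far from `m` the integrands differ by at most `2` on a
set of vanishing probability. The truncated estimate is even in `u`, so the average folds onto `u >
0`. -/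
theorem tendsto_mean_exp_truncEst {p : ℕ} {β m δ C : ℝ} (hp : 2 ≤ p) (hβ : 0 ≤ β)
    (hg : ∃ t ∈ Set.Icc (0 : ℝ) 1, 0 < gFun p β t) (hs : deriv (deriv (gFun p β)) m < 0)
    (h : IsPosMaximizer p β m) (hδ : 0 < δ) (hδm : δ ≤ m) (hC : 0 ≤ C)
    (hT : ∀ u, |u - m| < δ → |estFun p u - estFun p m - deriv (estFun p) m * (u - m)|
      ≤ C * (u - m) ^ 2) (t : ℝ) :
    Tendsto (fun N => mean p N β fun u =>
      Complex.exp (((t * ((truncEst p β m δ u - β) / rootInv N) : ℝ) : ℂ) * Complex.I)) atTop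
      (𝓝 ((Real.exp (-((t * deriv (estFun p) m) ^ 2
        / (2 * -(deriv (deriv (gFun p β)) m)))) : ℝ) : ℂ)) := by
  set κ := deriv (estFun p) m with hκ
  obtain ⟨C₁, hC₁, hfold⟩ := h.exists_norm_mean_sub_posMean_le ℂ hp hβ hg
  obtain ⟨C₂, hC₂, hfar⟩ := h.exists_posMean_far_le hp hβ hg hδ hδm
  obtain ⟨C₄, hC₄, hsq⟩ := h.exists_posMean_sq_le hp hβ hg hs
  have hlim0 := h.tendsto_posMean_phase hp hβ hg hs (t * κ)
  rw [h.estFun_eq (by omega)] at hT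
  suffices hdiff : Tendsto (fun N => (mean p N β fun u =>
      Complex.exp (((t * ((truncEst p β m δ u - β) / rootInv N) : ℝ) : ℂ) * Complex.I))
      - posMean p N β (phase m (rootInv N) (t * κ))) atTop (𝓝 0) by
    simpa using hdiff.add hlim0
  rw [tendsto_zero_iff_norm_tendsto_zero]
  have hlim : Tendsto (fun N => C₁ * rootInv N ^ 4 + (|t| * C * C₄ * rootInv N
      + 2 * C₂ * rootInv N ^ 4)) atTop (𝓝 0) := by
    have := ((tendsto_rootInv.pow 4).const_mul C₁).add
      ((tendsto_rootInv.const_mul (|t| * C * C₄)).add ((tendsto_rootInv.pow 4).const_mul (2 * C₂)))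
    simpa using this
  refine squeeze_zero' (Eventually.of_forall fun N => norm_nonneg _) ?_ hlim
  filter_upwards [eventually_ne_atTop 0] with N hN
  have hρ0 := rootInv_pos hN
  set ρ := rootInv N with hρ
  set f : ℝ → ℂ := fun u =>
    Complex.exp (((t * ((truncEst p β m δ u - β) / ρ) : ℝ) : ℂ) * Complex.I) with hf
  have hf1 : ∀ u, ‖f u‖ = 1 := fun u => Complex.norm_exp_ofReal_mul_I _
  have i1 : ‖mean p N β f - posMean p N β f‖ ≤ C₁ * ρ ^ 4 := by
    have := hfold N hN f 1 (fun u _ => (hf1 u).le) (fun _ u => by simp [hf, truncEst, abs_neg])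
    rwa [mul_one] at this
  have i2 : ‖posMean p N β f - posMean p N β (phase m ρ (t * κ))‖
      ≤ |t| * C * C₄ * ρ + 2 * C₂ * ρ ^ 4 := by
    have i3 : ‖posMean p N β f - posMean p N β (phase m ρ (t * κ))‖
        ≤ (|t| * C * ρ⁻¹) * posMean p N β (fun u => (u - m) ^ 2)
          + 2 * posMean p N β ({u : ℝ | δ ≤ |u - m|}.indicator fun _ => (1 : ℝ)) := by
      rw [← posMean_mul, ← posMean_mul, ← posMean_add, ← posMean_sub]
      refine norm_posMean_le fun u hu => ?_
      by_cases hmem : δ ≤ |u - m|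
      · rw [Set.indicator_of_mem (s := {u : ℝ | δ ≤ |u - m|}) hmem]
        have h3 : ‖f u - phase m ρ (t * κ) u‖ ≤ 2 := by
          refine (norm_sub_le _ _).trans ?_
          rw [hf1, norm_phase]; norm_num
        have h4 : 0 ≤ |t| * C * ρ⁻¹ * (u - m) ^ 2 := by positivity
        linarith
      · rw [Set.indicator_of_notMem (s := {u : ℝ | δ ≤ |u - m|}) hmem, mul_zero, add_zero]
        refine (norm_exp_ofReal_mul_I_sub_le _ _).trans ?_
        have hlt := not_le.1 hmem
        have e : truncEst p β m δ u = estFun p u := by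
          rw [truncEst, abs_of_pos hu.1, if_pos hlt]
        rw [e, show t * ((estFun p u - β) / ρ) - t * κ * ((u - m) / ρ)
          = t * (estFun p u - β - κ * (u - m)) * ρ⁻¹ by field_simp, abs_mul, abs_mul,
          abs_of_pos (inv_pos.2 hρ0)]
        calc _ ≤ |t| * (C * (u - m) ^ 2) * ρ⁻¹ := by gcongr; exact hT u hlt
          _ = _ := by ring
    refine i3.trans ?_
    have i4 := mul_le_mul_of_nonneg_left (hsq N hN) (by positivity : 0 ≤ |t| * C * ρ⁻¹)
    have i5 := hfar N hN
    have e : |t| * C * ρ⁻¹ * (C₄ * rootInv N ^ 2) = |t| * C * C₄ * ρ := by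
      rw [← hρ]; field_simp
    rw [e] at i4
    linarith
  calc _ = ‖(mean p N β f - posMean p N β f)
        + (posMean p N β f - posMean p N β (phase m ρ (t * κ)))‖ := by rw [sub_add_sub_cancel]
    _ ≤ _ := (norm_add_le _ _).trans (add_le_add i1 i2)

/-- Lévy's continuity theorem; the truncation keeps the variable real-valued, so characteristic
functions apply. -/
theorem tendstoInDistribution_truncEst {p : ℕ} {β m δ C : ℝ} (hp : 2 ≤ p) (hβ : 0 ≤ β)
    (hg : ∃ t ∈ Set.Icc (0 : ℝ) 1, 0 < gFun p β t) (hs : deriv (deriv (gFun p β)) m < 0)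
    (h : IsPosMaximizer p β m) (hδ : 0 < δ) (hδm : δ ≤ m) (hC : 0 ≤ C)
    (hT : ∀ u, |u - m| < δ → |estFun p u - estFun p m - deriv (estFun p) m * (u - m)|
      ≤ C * (u - m) ^ 2) :
    TendstoInDistribution
      (fun (N : ℕ) (x : Config N) => √(N : ℝ) * (truncEst p β m δ (mag x) - β)) atTop
      (fun z : ℝ => z) (fun N => law (cwTensor p N) β)
      (gaussianReal 0 (deriv (estFun p) m ^ 2 / -(deriv (deriv (gFun p β)) m)).toNNReal) where
  forall_aemeasurable N := (measurable_of_finite _).aemeasurable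
  aemeasurable_limit := aemeasurable_id
  tendsto := by
    refine ProbabilityMeasure.tendsto_iff_tendsto_charFun.2 fun t => ?_
    have hlim := tendsto_mean_exp_truncEst hp hβ hg hs h hδ hδm hC hT t
    have hv : 0 ≤ deriv (estFun p) m ^ 2 / -(deriv (deriv (gFun p β)) m) :=
      div_nonneg (sq_nonneg _) (by linarith)
    simp only [ProbabilityMeasure.coe_mk]
    rw [Measure.map_id', charFun_gaussianReal, Real.coe_toNNReal _ hv]
    convert! hlim using 2
    · rename_i N
      rw [charFun_apply_real, integral_map (measurable_of_finite _).aemeasurable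
        (by fun_prop), integral_law_eq_sum]
      unfold mean rootInv
      refine Finset.sum_congr rfl fun x _ => ?_
      congr 2
      push_cast
      rw [div_inv_eq_mul]
      ring
    · push_cast
      congr 1
      have : ((deriv (deriv (gFun p β)) m : ℝ) : ℂ) ≠ 0 := Complex.ofReal_ne_zero.2 hs.ne
      field_simp
      ring

/-- Convergence in distribution is unaffected by changes on events of vanishing probability. -/
theorem tendstoInDistribution_of_sum_prob_le {E : Type*} [TopologicalSpace E] [MeasurableSpace E]
    [OpensMeasurableSpace E] {Ω' : Type*} [MeasurableSpace Ω'] {μ' : Measure Ω'}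
    [IsProbabilityMeasure μ'] {p : ℕ} {β : ℝ} {X Y : (N : ℕ) → Config N → E} {Z : Ω' → E}
    (hX : TendstoInDistribution X atTop Z (fun N => law (cwTensor p N) β) μ')
    (B : ℕ → Set ℝ) (hXY : ∀ᶠ N in atTop, ∀ x : Config N, mag x ∉ B N → X N x = Y N x)
    (hB : Tendsto (fun N => mean p N β ((B N).indicator fun _ => (1 : ℝ))) atTop (𝓝 0)) :
    TendstoInDistribution Y atTop Z (fun N => law (cwTensor p N) β) μ' where
  forall_aemeasurable N := (measurable_of_finite _).aemeasurable
  aemeasurable_limit := hX.aemeasurable_limit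
  tendsto := by
    refine ProbabilityMeasure.tendsto_iff_forall_integral_tendsto.2 fun f => ?_
    have hf := ProbabilityMeasure.tendsto_iff_forall_integral_tendsto.1 hX.tendsto f
    suffices hdiff : Tendsto (fun N => (∫ x, f x ∂((law (cwTensor p N) β).map (Y N)))
        - ∫ x, f x ∂((law (cwTensor p N) β).map (X N))) atTop (𝓝 0) by
      simpa using hdiff.add hf
    rw [tendsto_zero_iff_norm_tendsto_zero]
    -- A bounded test function can change by at most `2 ‖f‖`, and only on the exceptional event.
    have hlim := hB.const_mul (2 * ‖f‖)
    rw [mul_zero] at hlim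
    refine squeeze_zero' (Eventually.of_forall fun N => norm_nonneg _) ?_ hlim
    filter_upwards [hXY] with N hN
    have hm : ∀ W : Config N → E, ∫ x, f x ∂((law (cwTensor p N) β).map W)
        = ∑ x, prob (cwTensor p N) β x • f (W x) := fun W => by
      rw [integral_map (measurable_of_finite _).aemeasurable
        f.continuous.measurable.aestronglyMeasurable, integral_law_eq_sum]
    rw [hm, hm, ← Finset.sum_sub_distrib]
    unfold mean
    rw [Finset.mul_sum]
    refine (norm_sum_le _ _).trans (Finset.sum_le_sum fun x _ => ?_)
    rw [← smul_sub, norm_smul, Real.norm_of_nonneg (prob_nonneg _ _ _), smul_eq_mul,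
      mul_left_comm]
    refine mul_le_mul_of_nonneg_left ?_ (prob_nonneg _ _ _)
    by_cases hx : mag x ∈ B N
    · rw [Set.indicator_of_mem hx, mul_one]
      refine (norm_sub_le _ _).trans ?_
      have h1 := f.norm_coe_le_norm (Y N x)
      have h2 := f.norm_coe_le_norm (X N x)
      linarith
    · rw [Set.indicator_of_notMem hx, hN x hx, sub_self, norm_zero, mul_zero]

/-- The limit law of the truncated estimate is carried to the extended reals by continuity of the
coercion. Off the far set the true estimate coincides with the truncated one, so infinite values can
occur only with vanishing probability. -/
theorem IsPosMaximizer.tendstoInDistribution_mple {p : ℕ} {β m : ℝ} (hp : 2 ≤ p) (hβ : 0 ≤ β)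
    (hg : ∃ t ∈ Set.Icc (0 : ℝ) 1, 0 < gFun p β t) (hs : deriv (deriv (gFun p β)) m < 0)
    (h : IsPosMaximizer p β m) :
    TendstoInDistribution
      (fun (N : ℕ) (x : Config N) =>
        ((√(N : ℝ) : ℝ) : EReal) * (mple (cwTensor p N) x - (β : EReal)))
      atTop (fun z : ℝ => (z : EReal)) (fun N : ℕ => law (cwTensor p N) β)
      (gaussianReal 0 (deriv (estFun p) m ^ 2 / -(deriv (deriv (gFun p β)) m)).toNNReal) := by
  have h0 := h.1
  have h1 := h.lt_one
  obtain ⟨δ₀, hδ₀, C, hC, hT⟩ := exists_taylor_bound (contDiffAt_estFun (p := p) (by omega) h0 h1)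
  -- The three radii secure the Taylor bound, a nonzero magnetization with the sign of the nearby
  -- maximizer, and `|mag x| < 1`.
  set δ := min δ₀ (min m (1 - m)) with hδdef
  have hδ : 0 < δ := lt_min hδ₀ (lt_min h0 (by linarith))
  have hδm : δ ≤ m := (min_le_right _ _).trans (min_le_left _ _)
  have hδ1 : δ ≤ 1 - m := (min_le_right _ _).trans (min_le_right _ _)
  have hreal := tendstoInDistribution_truncEst hp hβ hg hs h hδ hδm hC
    (fun u hu => hT u (hu.trans_le (min_le_left _ _)))
  have hE := hreal.continuous_comp continuous_coe_real_ereal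
  obtain ⟨C', hC', hfar⟩ := h.exists_mean_farSet_le hp hβ hg hδ
  refine tendstoInDistribution_of_sum_prob_le hE (fun _ => farSet p m δ) ?_ ?_
  · filter_upwards [eventually_ne_atTop 0] with N hN x hx
    have hnear : |mag x - m| < δ ∨ (Even p ∧ |mag x + m| < δ) := by
      by_contra! hcon
      exact hx ⟨hcon.1, hcon.2⟩
    have hfacts : mag x ≠ 0 ∧ |mag x| < 1 ∧ (0 < mag x ∨ Even p) ∧ abs (|mag x| - m) < δ := by
      rcases hnear with hn | ⟨he, hn⟩
      · have hn' := abs_lt.1 hn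
        have hpos : 0 < mag x := by linarith [hn'.1]
        rw [abs_of_pos hpos]
        exact ⟨hpos.ne', by linarith [hn'.2], Or.inl hpos, hn⟩
      · have hn' := abs_lt.1 hn
        have hneg : mag x < 0 := by linarith [hn'.2]
        rw [abs_of_neg hneg]
        refine ⟨hneg.ne, by linarith [hn'.1], Or.inr he, ?_⟩
        rw [abs_lt]
        constructor <;> linarith [hn'.1, hn'.2]
    rw [mple_cwTensor hp hN x hfacts.1 hfacts.2.1 hfacts.2.2.1]
    simp only [Function.comp_apply, truncEst, if_pos hfacts.2.2.2, estFun]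
    rw [EReal.coe_mul, EReal.coe_sub]
  · have hlim : Tendsto (fun N : ℕ => C' * rootInv N ^ 4) atTop (𝓝 0) := by
      simpa using (tendsto_rootInv.pow 4).const_mul C'
    refine squeeze_zero' (Eventually.of_forall fun N =>
      mean_nonneg fun u _ => Set.indicator_nonneg (fun _ _ => zero_le_one) u) ?_ hlim
    filter_upwards [eventually_ne_atTop 0] with N hN
    refine (hfar N hN).trans_eq ?_
    rw [rootInv_pow_four, mul_one_div]

/-- The estimator has slope `-g''(m) / (p m ^ (p - 1))` at `m`; squaring it and dividing by
`-g''(m)` leaves one factor `-g''(m)` in the numerator. -/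
theorem IsPosMaximizer.limitVariance_eq {p : ℕ} {β m : ℝ} (hp : 2 ≤ p)
    (hs : deriv (deriv (gFun p β)) m < 0) (h : IsPosMaximizer p β m) :
    deriv (estFun p) m ^ 2 / -(deriv (deriv (gFun p β)) m) = limitVariance p β m := by
  have h0 := h.1
  have h1 := h.lt_one
  have hp' : (p : ℝ) ≠ 0 := by positivity
  have e1 : deriv (estFun p) m = -(deriv (deriv (gFun p β)) m) / (p * m ^ (p - 1)) := by
    rw [(hasDerivAt_estFun p h0 h1).deriv, h.deriv_deriv_eq hp, pow_succ]
    field_simp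
  have e2 : m ^ (2 * p - 2) = (m ^ (p - 1)) ^ 2 := by
    rw [← pow_mul]; congr 1; omega
  rw [limitVariance, e1, e2]
  have := hs.ne
  field_simp

end TensorIsing

/-! ### Assembly of the theorem -/

theorem mainTheorem5 (p : ℕ) (hp : 2 ≤ p) (β : ℝ) (hβ : TensorIsing.cwThreshold p < β) :
    ∃ m : ℝ, TensorIsing.IsPosMaximizer p β m ∧
      (∀ m' : ℝ, TensorIsing.IsPosMaximizer p β m' → m' = m) ∧
      m < 1 ∧
      deriv (deriv (TensorIsing.gFun p β)) m < 0 ∧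
      TendstoInDistribution
        (fun (N : ℕ) (x : TensorIsing.Config N) =>
          ((√(N : ℝ) : ℝ) : EReal) *
            (TensorIsing.mple (TensorIsing.cwTensor p N) x - (β : EReal)))
        atTop
        (fun z : ℝ => (z : EReal))
        (fun N : ℕ => TensorIsing.law (TensorIsing.cwTensor p N) β)
        (gaussianReal 0 (TensorIsing.limitVariance p β m).toNNReal) ∧
      Tendsto (fun N : ℕ => (TensorIsing.fisherInfo (TensorIsing.cwTensor p N) β)⁻¹) atTop
        (𝓝 (TensorIsing.limitVariance p β m)) := by
  obtain ⟨hβ0, hg⟩ := TensorIsing.exists_pos_of_cwThreshold_lt hp hβ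
  obtain ⟨m, h⟩ := TensorIsing.exists_isPosMaximizer hp hβ0.le hg
  have h0 := h.1
  have hs : deriv (deriv (TensorIsing.gFun p β)) m < 0 := by
    rw [h.deriv_deriv_eq hp]
    exact neg_lt_zero.2 (div_pos (h.slopeAux_pos hp hg) h0)
  refine ⟨m, h, fun m' h' => h.unique hp hg h', h.lt_one, hs, ?_, ?_⟩
  · rw [← h.limitVariance_eq hp hs]
    exact h.tendstoInDistribution_mple hp hβ0.le hg hs
  · have hlim := h.tendsto_fisherInfo hp hβ0.le hg hs
    have hp' : (p : ℝ) ≠ 0 := by positivity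
    have hs' := hs.ne
    have hne : (p * m ^ (p - 1)) ^ 2 / -(deriv (deriv (TensorIsing.gFun p β)) m) ≠ 0 :=
      div_ne_zero (by positivity) (neg_ne_zero.2 hs')
    have e2 : m ^ (2 * p - 2) = (m ^ (p - 1)) ^ 2 := by
      rw [← pow_mul]; congr 1; omega
    have e : TensorIsing.limitVariance p β m
        = ((p * m ^ (p - 1)) ^ 2 / -(deriv (deriv (TensorIsing.gFun p β)) m))⁻¹ := by
      rw [TensorIsing.limitVariance, e2, inv_div, mul_pow]
    rw [e]
    exact hlim.inv₀ hne
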